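/- Let $\Bbbk$ be a field and $\mathcal I$ a countable set (the labels); label sets are finite subsets of $\mathcal I$, and unions of label sets are taken disjointly. There is an equivalence of categories $\widetilde\Phi:\mathsf{CA}\rightleftarrows\mathsf{wProp}:\widetilde\Psi$ between oriented circuit algebras and linear wheeled props, compatible with a bijection between wiring diagrams and graphs. The notions are the following. **Wiring diagrams.** An oriented wiring diagram $D=(\mathcal A,p,l)$ consists of label sets $A_i^{\rm out},A_i^{\rm in}$ ($0\le i\le r$; the circles $1,\dots,r$ are the input circles, $0$ is the output circle), a bijection $p:\bigsqcup_{i=0}^rA_i^{\rm out}\to\bigsqcup_{i=0}^rA_i^{\rm in}$ and an integer $l\ge 0$; it records a compact oriented $1$-manifold, up to orientation-preserving homeomorphism, whose beginning points are identified with $\bigsqcup A_i^{\rm out}$, whose ending points are identified with $\bigsqcup A_i^{\rm in}$, and which has $l$ circle components. If $D'$ has output label sets $B_0^{\rm in}=A_i^{\rm out}$, $B_0^{\rm out}=A_i^{\rm in}$, then $D\circ_iD'$ is obtained by gluing the two $1$-manifolds along the equally labelled points of the $i$-th input circle of $D$ and the output circle of $D'$; its input circles are $1,\dots,i-1$ of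 $D$, then those of $D'$, then $i+1,\dots,r$ of $D$. The identity diagrams have one input circle, with $A_1^{\rm out}=A_0^{\rm in}$, $A_1^{\rm in}=A_0^{\rm out}$, $p$ the identity of labels and $l=0$. **Circuit algebras.** An oriented circuit algebra $\mathsf V$ is an algebra over the operad of oriented wiring diagrams: $\Bbbk$-vector spaces $\mathsf V[S;T]$ for finite $S,T\subseteq\mathcal I$ and linear maps $F_D:\bigotimes_{i=1}^r\mathsf V[A_i^{\rm out};A_i^{\rm in}]\to\mathsf V[A_0^{\rm in};A_0^{\rm out}]$ for all $D$, such that $F_{D\circ_iD'}=F_D\circ(\mathrm{id}\otimes\cdots\otimes F_{D'}\otimes\cdots\otimes\mathrm{id})$, $F_{\sigma D}=F_D\circ\sigma^{-1}$ for every renumbering $\sigma$ of the input circles, and $F_D=\mathrm{id}$ for every identity diagram $D$. A morphism is a family of linear maps commuting with all $F_D$. **Graphs.** An oriented labelled graph $G$ is a finite set of flags partitioned into an ordered list of (possibly empty) vertices $v_1,\dots,v_r$ and an exceptional cell $v_\epsilon$, with an involution $\iota$ of the flags preserving $v_\epsilon$, a fixed point free involution $\pi$ of the $\iota$-fixed flags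 in $v_\epsilon$, a sign $\delta=\pm1$ on all flags except those in $v_\epsilon$ moved by $\iota$, with $\delta(\iota x)=-\delta(x)$ if $\iota x\neq x$ and $\delta(\pi x)=-\delta(x)$, an $\mathcal I$-valued labelling $\lambda$ of the flags at the vertices, injective on the flags of each sign at each vertex, and an $\mathcal I$-valued labelling $\beta$ of the boundary flags, i.e. the $\iota$-fixed flags, injective on those of each sign. Pairs of flags in $v_\epsilon$ matched by $\iota$ are free loops, pairs matched by $\pi$ are free edges. Let $\mathrm{in}(v),\mathrm{out}(v)$ be the sets of $\lambda$-labels of the positive and negative flags at $v$, and $\partial G=(\mathrm{in}(G);\mathrm{out}(G))$ the sets of $\beta$-labels of the positive and negative boundary flags. A strict isomorphism is a bijection of flags that preserves all this structure, including the order of the vertices. If $\partial H_v=(\mathrm{in}(v);\mathrm{out}(v))$ for all vertices $v$ of $G$, the graph substitution $G(\{H_v\})$ is obtained by replacing each $v$ by $H_v$, joining the edges that meet at equally labelled flags; its boundary is that of $G$, its vertices are those of the $H_v$ in lexicographic order, and its free loops are those of $G$ and of the $H_v$ and those created by the joining. $G(H_v)$ denotes substitution of $H_v$ at $v$ only (with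 corollas at the other vertices), where the corolla $C_{(I;J)}$ has one vertex, whose flags are also its boundary flags, with equal labels $(I;J)$. **Wheeled props.** An $\mathcal S$-bimodule $\mathbf E$ is a family of $\Bbbk$-vector spaces $\mathsf E[I;J]$, for finite $I,J\subseteq\mathcal I$, with commuting actions of $S_I$ from the left and $S_J$ from the right; morphisms are equivariant families of linear maps. Put $\mathbf E[G]=\bigotimes_v\mathsf E[\mathrm{in}(v);\mathrm{out}(v)]$ and $\mathsf F\mathsf E[I;J]=\operatorname{colim}_{G\in\mathcal G(I;J)}\mathbf E[G]$, where $\mathcal G(I;J)$ is the groupoid of graphs with $\partial G=(I;J)$ and isomorphisms that preserve the structure of graph and $\beta$, but may permute the order of the vertices and may permute the labels in $\mathrm{in}(v)$ and in $\mathrm{out}(v)$ at each vertex $v$; they act on $\mathbf E[G]$ by permuting the tensor factors and by the actions of $S_{\mathrm{in}(v)}$ and $S_{\mathrm{out}(v)}$. $S_I$ and $S_J$ act on $\mathsf F\mathsf E[I;J]$ by permuting boundary labels. A linear wheeled prop is an algebra $(\mathbf W,\gamma:\mathsf F\mathbf W\to\mathbf W)$ over the monad $(\mathsf F,\mu,\eta)$,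 where $\eta$ sends $x\in\mathsf E[I;J]$ to the corolla $C_{(I;J)}$ decorated by $x$, and $\mu$ sends a graph $G$ whose vertices $v$ are decorated by decorated graphs $H_v$ to $G(\{H_v\})$ with the decorations of the $H_v$. **Theorem.** 1. For a graph $G$ let $\Phi(G)=(\mathcal A,p,l)$ with $A_i^{\rm in}=\mathrm{in}(v_i)$, $A_i^{\rm out}=\mathrm{out}(v_i)$ for $1\le i\le r$, $A_0^{\rm out}=\mathrm{in}(G)$, $A_0^{\rm in}=\mathrm{out}(G)$, $p$ the matching of labels given by the edges of $G$ other than free loops, and $l$ the number of free loops. For a wiring diagram $D$ let $\Psi(D)$ be the graph whose flags at the vertex $v_i$ are the labels in $A_i^{\rm in}$ (positive) and $A_i^{\rm out}$ (negative), whose boundary is $(A_0^{\rm out};A_0^{\rm in})$, whose edges are given by $p$, and which has $l$ free loops. Then $\Phi$ and $\Psi$ are mutually inverse bijections between strict isomorphism classes of oriented labelled graphs and oriented wiring diagrams. 2. Whenever $D\circ_iD'$ is defined, $\Psi(D\circ_iD')=\Psi(D)\bigl(\Psi(D')_{i}\bigr)$, the substitution of $\Psi(D')$ into the vertex $v_i$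 of $\Psi(D)$, up to strict isomorphism. 3. There are unique natural transformations $\eta$, $\mu$ as described, they make $\mathsf F$ a monad on $\mathcal S$-bimodules, and there is an equivalence of categories $$\widetilde\Phi:\mathsf{CA}\rightleftarrows\mathsf{wProp}:\widetilde\Psi$$ such that, up to isomorphisms natural in $\mathsf V$ and in $\mathbf W$: $\widetilde\Phi(\mathsf V)[I;J]=\mathsf V[J;I]$, and the structure map $\gamma$ of $\widetilde\Phi(\mathsf V)$ is $F_{\Phi(G)}$ on the component $\mathbf E[G]$ of the colimit, where $\mathbf E$ is the underlying $\mathcal S$-bimodule of $\widetilde\Phi(\mathsf V)$; $\widetilde\Psi(\mathbf W)[S;T]=\mathsf W[T;S]$, and the action $F_D$ on $\widetilde\Psi(\mathbf W)$ is the restriction of the structure map $\gamma$ of $\mathbf W$ to the component $\mathbf W[\Psi(D)]$. -/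

import Mathlib

open CategoryTheory
open scoped TensorProduct DirectSum

universe u

/-! ## Gluing oriented 1-manifolds along end points -/

/-- A finite family of oriented intervals is recorded by a bijection `p` from their beginning points
`X ⊕ Z` to their ending points `Y ⊕ Z`; the ending point `z : Z` is to be glued to the beginning
point `z : Z`.  `StrandStep p s t` says that the interval beginning at `t` is glued to the end of
the interval beginning at `s`. -/
def StrandStep {X Y Z : Type} (p : X ⊕ Z ≃ Y ⊕ Z) (s t : X ⊕ Z) : Prop :=
  ∃ z, p s = Sum.inr z ∧ t = Sum.inr z

/-- After gluing, the component through the interval beginning at `s` runs to the unglued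
ending point `y`. -/
def StrandEnds {X Y Z : Type} (p : X ⊕ Z ≃ Y ⊕ Z) (s : X ⊕ Z) (y : Y) : Prop :=
  ∃ t, Relation.ReflTransGen (StrandStep p) s t ∧ p t = Sum.inl y

theorem StrandEnds.exists {X Y Z : Type} [Finite X] [Finite Z] (p : X ⊕ Z ≃ Y ⊕ Z) (x : X) :
    ∃ y, StrandEnds p (Sum.inl x) y := by
  by_contra hcon
  have key : ∀ t : {t // Relation.ReflTransGen (StrandStep p) (Sum.inl x) t},
      ∃ z, p t.1 = Sum.inr z := by
    rintro ⟨t, ht⟩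
    rcases h : p t with y | z
    · exact absurd ⟨y, t, ht, h⟩ hcon
    · exact ⟨z, rfl⟩
  choose z hz using key
  let f : {t // Relation.ReflTransGen (StrandStep p) (Sum.inl x) t} →
      {t // Relation.ReflTransGen (StrandStep p) (Sum.inl x) t} :=
    fun t => ⟨Sum.inr (z t), t.2.tail ⟨z t, hz t, rfl⟩⟩
  have hf : Function.Injective f := by
    intro a b hab
    have h1 : z a = z b := Sum.inr_injective (congrArg Subtype.val hab)
    exact Subtype.ext (p.injective (by rw [hz, hz, h1]))
  obtain ⟨a, ha⟩ := Finite.surjective_of_injective hf ⟨Sum.inl x, Relation.ReflTransGen.refl⟩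
  exact Sum.inr_ne_inl (congrArg Subtype.val ha)

theorem StrandEnds.injective {X Y Z : Type} {p : X ⊕ Z ≃ Y ⊕ Z} {x x' : X} {y : Y}
    (h : StrandEnds p (Sum.inl x) y) (h' : StrandEnds p (Sum.inl x') y) : x = x' := by
  obtain ⟨t, ht, hy⟩ := h
  obtain ⟨t', ht', hy'⟩ := h'
  obtain rfl : t = t' := p.injective (hy.trans hy'.symm)
  have hU : Relator.RightUnique (Function.swap (StrandStep p)) := by
    rintro a b c ⟨z, hz, ha⟩ ⟨w, hw, ha'⟩
    refine p.injective ?_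
    rw [hz, hw, Sum.inr_injective (ha.symm.trans ha')]
  have first : ∀ {s : X ⊕ Z} {x : X}, Relation.ReflTransGen (StrandStep p) s (Sum.inl x) →
      s = Sum.inl x := by
    intro s x h
    rcases Relation.ReflTransGen.cases_tail h with h | ⟨c, _, ⟨z, _, hz⟩⟩
    · exact h.symm
    · exact absurd hz Sum.inl_ne_inr
  rcases Relation.ReflTransGen.total_of_right_unique hU
    (Relation.reflTransGen_swap.2 ht) (Relation.reflTransGen_swap.2 ht') with h | h
  · exact (Sum.inl_injective (first (Relation.reflTransGen_swap.1 h))).symm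
  · exact Sum.inl_injective (first (Relation.reflTransGen_swap.1 h))

/-- The matching of beginning points with ending points of the glued 1-manifold: `glue p x` is the
ending point `y` of the component that begins at `x`, the only one with
`StrandEnds p (Sum.inl x) y`. -/
noncomputable def glue {X Y Z : Type} [Finite X] [Finite Y] [Finite Z] (p : X ⊕ Z ≃ Y ⊕ Z) :
    X ≃ Y :=
  Equiv.ofBijective (fun x => (StrandEnds.exists p x).choose) <| by
    refine Function.Injective.bijective_of_nat_card_le (fun x x' h => ?_) (le_of_eq ?_)
    · have h1 := (StrandEnds.exists p x).choose_spec
      have h2 := (StrandEnds.exists p x').choose_spec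
      exact h1.injective (h ▸ h2)
    · have h := Nat.card_congr p
      rw [Nat.card_sum, Nat.card_sum] at h
      omega

/-- The circles created by the gluing: the components of the glued 1-manifold that never reach an
unglued ending point. -/
def GlueLoop {X Y Z : Type} (p : X ⊕ Z ≃ Y ⊕ Z) : Type :=
  Quot fun z w : {z : Z // ¬ ∃ y, StrandEnds p (Sum.inr z) y} => p (Sum.inr z.1) = Sum.inr w.1

instance {X Y Z : Type} [Finite Z] (p : X ⊕ Z ≃ Y ⊕ Z) : Finite (GlueLoop p) :=
  inferInstanceAs (Finite (Quot _))

/-! ## Oriented wiring diagrams -/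

/-- A pair of finite sets of labels from the alphabet `L`. -/
abbrev Profile (L : Type) := Finset L × Finset L

/-- An oriented wiring diagram with input circles indexed by `ι`.  The `i`-th input circle carries
the label sets `c i = (Aᵢ^out, Aᵢ^in)` and the output circle carries `c₀ = (A₀^in, A₀^out)`.
A compact oriented 1-manifold whose beginning points are identified with `⨆ Aᵢ^out` and whose ending
points are identified with `⨆ Aᵢ^in` (disjoint unions over all circles) is, up to
orientation-preserving homeomorphism, the perfect matching `p` given by its intervals, together with
the number `l` of its circle components. -/
@[ext]
structure WiringDiagram {L ι : Type} (c : ι → Profile L) (c₀ : Profile L) where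
  p : (Σ i, (c i).1) ⊕ c₀.2 ≃ (Σ i, (c i).2) ⊕ c₀.1
  l : ℕ

namespace WiringDiagram

/-- The identity diagram: one input circle, and every strand joins a label on the input circle with
the label of the same name on the output circle. -/
def ident {L : Type} (c₀ : Profile L) : WiringDiagram (fun _ : Fin 1 => c₀) c₀ where
  p :=
    { toFun := Sum.elim (fun a => Sum.inr a.2) (fun a => Sum.inl ⟨0, a⟩)
      invFun := Sum.elim (fun a => Sum.inr a.2) (fun a => Sum.inl ⟨0, a⟩)
      left_inv := by
        rintro (⟨i, a⟩ | a)
        · obtain rfl := Subsingleton.elim i 0; rfl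
        · rfl
      right_inv := by
        rintro (⟨i, a⟩ | a)
        · obtain rfl := Subsingleton.elim i 0; rfl
        · rfl }
  l := 0

/-- Renumbering of the input circles. -/
def reindex {L ι ι' : Type} {c : ι → Profile L} {c₀ : Profile L} (D : WiringDiagram c c₀)
    (e : ι' ≃ ι) : WiringDiagram (fun i => c (e i)) c₀ where
  p := ((Equiv.sigmaCongrLeft (β := fun i => (c i).1) e).sumCongr (Equiv.refl _)).trans
    (D.p.trans ((Equiv.sigmaCongrLeft (β := fun i => (c i).2) e).sumCongr (Equiv.refl _)).symm)
  l := D.l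

/-- Input circles of a composite `D ∘ᵢ D'`: those of `D` other than the `i`-th, and those of `D'`. -/
def compColour {L ι κ : Type} (c : ι → Profile L) (i : ι) (d : κ → Profile L) :
    {j : ι // j ≠ i} ⊕ κ → Profile L :=
  Sum.elim (fun j => c j) d

/-- Sorting the points of `D` and `D'` into those that stay and those that get glued, when the
circle `i` of `D` is glued to the output circle of `D'`; `q` selects one of the two label sets of
a circle, `A` and `B` are the corresponding sets on the output circles of `D` and `D'`. -/
noncomputable def sortPoints {L ι κ : Type} (c : ι → Profile L) (i : ι) (d : κ → Profile L)
    (q : Profile L → Finset L) (A B : Type) :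
    ((Σ t, q (compColour c i d t)) ⊕ A) ⊕ (q (c i) ⊕ B) ≃
      ((Σ j, q (c j)) ⊕ A) ⊕ ((Σ k, q (d k)) ⊕ B) :=
  Equiv.ofBijective
    (fun
      | .inl (.inl ⟨.inl j, a⟩) => .inl (.inl ⟨j.1, a⟩)
      | .inl (.inl ⟨.inr k, a⟩) => .inr (.inl ⟨k, a⟩)
      | .inl (.inr a) => .inl (.inr a)
      | .inr (.inl a) => .inl (.inl ⟨i, a⟩)
      | .inr (.inr b) => .inr (.inr b)) <| by
    constructor
    · rintro ((⟨⟨j, hj⟩ | k, a⟩ | a) | (a | b)) ((⟨⟨j', hj'⟩ | k', a'⟩ | a') | (a' | b')) h <;>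
        first
        | exact absurd (congrArg Sigma.fst (Sum.inl_injective (Sum.inl_injective h))) hj
        | exact absurd (congrArg Sigma.fst (Sum.inl_injective (Sum.inl_injective h))).symm hj'
        | (cases h; done)
        | (cases h; rfl)
    · rintro ((⟨j, a⟩ | a) | (⟨k, a⟩ | b))
      · by_cases hj : j = i
        · subst hj
          exact ⟨.inr (.inl a), rfl⟩
        · exact ⟨.inl (.inl ⟨.inl ⟨j, hj⟩, a⟩), rfl⟩
      · exact ⟨.inl (.inr a), rfl⟩
      · exact ⟨.inl (.inl ⟨.inr k, a⟩), rfl⟩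
      · exact ⟨.inr (.inr b), rfl⟩

/-- The strands of `D ⊔ D'`, sorted for gluing the `i`-th input circle of `D` to the output circle
of `D'`.  A beginning point of `D` on that circle is glued to the ending point of `D'` with the same
label, and an ending point of `D` to the beginning point of `D'` with the same label. -/
noncomputable def compStrands {L ι κ : Type} {c : ι → Profile L} {c₀ : Profile L}
    (D : WiringDiagram c c₀) (i : ι) {d : κ → Profile L} (D' : WiringDiagram d (c i)) :
    ((Σ t, (compColour c i d t).1) ⊕ c₀.2) ⊕ ((c i).1 ⊕ (c i).2) ≃
      ((Σ t, (compColour c i d t).2) ⊕ c₀.1) ⊕ ((c i).1 ⊕ (c i).2) :=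
  (sortPoints c i d Prod.fst c₀.2 (c i).2).trans <|
    (D.p.sumCongr D'.p).trans <|
      (sortPoints c i d Prod.snd c₀.1 (c i).1).symm.trans <|
        (Equiv.refl _).sumCongr (Equiv.sumComm _ _)

/-- The composite `D ∘ᵢ D'` before the input circles are numbered. -/
noncomputable def compAt {L ι κ : Type} [Finite ι] [Finite κ] {c : ι → Profile L} {c₀ : Profile L}
    (D : WiringDiagram c c₀) (i : ι) {d : κ → Profile L} (D' : WiringDiagram d (c i)) :
    WiringDiagram (compColour c i d) c₀ where
  p := glue (compStrands D i D')
  l := D.l + D'.l + Nat.card (GlueLoop (compStrands D i D'))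

/-- The numbering of the input circles of `D ∘ᵢ D'`: first those of `D` before `i`, then those of
`D'`, then those of `D` after `i`. -/
def slot {r : ℕ} (i : Fin r) (s : ℕ) : Fin (r - 1 + s) ≃ {j : Fin r // j ≠ i} ⊕ Fin s where
  toFun m :=
    if h : m.1 < i.1 then .inl ⟨⟨m.1, h.trans i.2⟩, fun e => by simp [← e] at h⟩
    else if h' : m.1 < i.1 + s then .inr ⟨m.1 - i.1, by omega⟩
    else .inl ⟨⟨m.1 - s + 1, by omega⟩, fun e => by
      have := congrArg Fin.val e
      simp only at this
      omega⟩
  invFun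
    | .inl j => if h : j.1.1 < i.1 then ⟨j.1.1, by have := i.2; omega⟩ else
        ⟨j.1.1 - 1 + s, by have := j.1.2; have := Fin.val_ne_of_ne j.2; omega⟩
    | .inr k => ⟨i.1 + k.1, by omega⟩
  left_inv m := by
    apply Fin.ext
    by_cases h : m.1 < i.1
    · simp [h]
    · by_cases h' : m.1 < i.1 + s
      · simp only [h, h', dite_true, dite_false]
        omega
      · simp only [h, h', dite_false]
        split_ifs <;> simp only <;> omega
  right_inv := by
    rintro (⟨j, hj⟩ | k)
    · have hj' : j.1 ≠ i.1 := fun h => hj (Fin.ext h)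
      by_cases h : j.1 < i.1
      · simp [h]
      · have h1 : ¬ j.1 - 1 + s < i.1 := by omega
        have h2 : ¬ j.1 - 1 + s < i.1 + s := by omega
        simp only [h, h1, h2, dite_false, Sum.inl.injEq, Subtype.mk.injEq]
        apply Fin.ext
        simp only
        omega
    · have h2 : i.1 + k.1 < i.1 + s := by omega
      simp [h2]

/-- The composition `D ∘ᵢ D'` of wiring diagrams. -/
noncomputable def comp {L : Type} {r s : ℕ} {c : Fin r → Profile L} {c₀ : Profile L}
    (D : WiringDiagram c c₀) (i : Fin r) {d : Fin s → Profile L} (D' : WiringDiagram d (c i)) :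
    WiringDiagram (fun m => compColour c i d (slot i s m)) c₀ :=
  (D.compAt i D').reindex (slot i s)

/-- A family indexed by the input circles of `D ∘ᵢ D'` from families indexed by the remaining input
circles of `D` and by those of `D'`. -/
def compInputs {L ι κ : Type} {c : ι → Profile L} {i : ι} {d : κ → Profile L}
    {E : Profile L → Type u} (x : ∀ j : {j // j ≠ i}, E (c j)) (y : ∀ k, E (d k)) :
    ∀ t, E (compColour c i d t)
  | .inl j => x j
  | .inr k => y k

end WiringDiagram

/-! ## Oriented circuit algebras -/

/-- The family with `a` at the index `i` and `x` at the other indices. -/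
noncomputable def insertInput {L ι : Type} {c : ι → Profile L} {E : Profile L → Type u} (i : ι)
    (a : E (c i)) (x : ∀ j : {j // j ≠ i}, E (c j)) : ∀ j, E (c j) :=
  open Classical in fun j => if h : j = i then cast (congrArg (fun j => E (c j)) h.symm) a else x ⟨j, h⟩

/-- An oriented circuit algebra over `k`: an algebra over the coloured operad of oriented wiring
diagrams.  The space `carrier (S, T)` is `V[S^out; T^in]`.  The axioms say, on pure tensors, that
the identity diagrams act as identities, that `F_{D ∘ᵢ D'} = F_D ∘ (id ⊗ ⋯ ⊗ F_{D'} ⊗ ⋯ ⊗ id)`,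
and that `F_{σD} = F_D ∘ σ⁻¹`. -/
structure CircuitAlgebra (k : Type u) [Field k] (L : Type) where
  carrier : Profile L → Type u
  [addCommGroup : ∀ S, AddCommGroup (carrier S)]
  [module : ∀ S, Module k (carrier S)]
  act : ∀ {r : ℕ} {c : Fin r → Profile L} {c₀ : Profile L}, WiringDiagram c c₀ →
    (⨂[k] i, carrier (c i)) →ₗ[k] carrier c₀
  act_ident : ∀ (c₀ : Profile L) (x : carrier c₀),
    act (WiringDiagram.ident c₀) (PiTensorProduct.tprod k fun _ => x) = x
  act_comp : ∀ {r s : ℕ} {c : Fin r → Profile L} {c₀ : Profile L} (D : WiringDiagram c c₀)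
    (i : Fin r) {d : Fin s → Profile L} (D' : WiringDiagram d (c i))
    (x : ∀ j : {j // j ≠ i}, carrier (c j)) (y : ∀ m, carrier (d m)),
    act (D.comp i D')
        (PiTensorProduct.tprod k fun m => WiringDiagram.compInputs x y (WiringDiagram.slot i s m)) =
      act D (PiTensorProduct.tprod k (insertInput i (act D' (PiTensorProduct.tprod k y)) x))
  act_perm : ∀ {r : ℕ} {c : Fin r → Profile L} {c₀ : Profile L} (D : WiringDiagram c c₀)
    (σ : Equiv.Perm (Fin r)) (x : ∀ j, carrier (c j)),
    act (D.reindex σ) (PiTensorProduct.tprod k fun j => x (σ j)) =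
      act D (PiTensorProduct.tprod k x)

namespace CircuitAlgebra

attribute [instance] CircuitAlgebra.addCommGroup CircuitAlgebra.module

/-- A morphism of circuit algebras: linear maps that commute with the action of all wiring
diagrams. -/
@[ext]
structure Hom {k : Type u} [Field k] {L : Type} (V W : CircuitAlgebra k L) where
  hom : ∀ S, V.carrier S →ₗ[k] W.carrier S
  comm : ∀ {r : ℕ} {c : Fin r → Profile L} {c₀ : Profile L} (D : WiringDiagram c c₀)
    (x : ∀ i, V.carrier (c i)),
    hom c₀ (V.act D (PiTensorProduct.tprod k x)) =
      W.act D (PiTensorProduct.tprod k fun i => hom (c i) (x i))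

instance {k : Type u} [Field k] {L : Type} : Category (CircuitAlgebra k L) where
  Hom := Hom
  id V := { hom := fun _ => LinearMap.id, comm := fun _ _ => rfl }
  comp f g :=
    { hom := fun S => (g.hom S).comp (f.hom S)
      comm := fun D x => by simp [f.comm, g.comm] }

end CircuitAlgebra

/-! ## Oriented labelled graphs -/

/-- An oriented labelled graph with set of flags `F`, whose vertices are indexed by `V`.

* `cell` is the partition of the flags into vertices `v` (`some v`) and the exceptional cell
  (`none`); parts may be empty.
* `ι` is the involution gluing flags to edges; it preserves the exceptional cell.
* `π` is the fixed point free involution on the `ι`-fixed exceptional flags.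
* `δ` is the orientation; it is defined on all flags except those of free loops.
* `lam` is the labelling of the flags at vertices, `beta` the labelling of the boundary `∂G`, the
  set of `ι`-fixed flags.
* `c v = (in(v); out(v))` is the neighbourhood of `v` and `b = (in(G); out(G))`: `lam` is injective
  on the positive flags at `v`, with image `in(v)`, and on the negative flags at `v`, with image
  `out(v)`; `beta` is injective on the positive boundary flags, with image `in(G)`, and on the
  negative ones, with image `out(G)`. -/
@[ext]
structure FlagGraph {L V : Type} (c : V → Profile L) (b : Profile L) (F : Type) where
  cell : F → Option V
  ι : F → F
  ι_ι : ∀ f, ι (ι f) = f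
  cell_ι : ∀ f, cell f = none → cell (ι f) = none
  π : {f // cell f = none ∧ ι f = f} → {f // cell f = none ∧ ι f = f}
  π_π : ∀ f, π (π f) = f
  π_ne : ∀ f, π f ≠ f
  δ : {f // cell f ≠ none ∨ ι f = f} → ℤˣ
  δ_ι : ∀ f h h', ι f ≠ f → δ ⟨ι f, h'⟩ = -δ ⟨f, h⟩
  δ_π : ∀ f, δ ⟨(π f).1, Or.inr (π f).2.2⟩ = -δ ⟨f.1, Or.inr f.2.2⟩
  lam : {f // cell f ≠ none} → L
  beta : {f // ι f = f} → L
  lam_in : ∀ v, Set.BijOn lam {f | cell f.1 = some v ∧ δ ⟨f.1, Or.inl f.2⟩ = 1} (c v).1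
  lam_out : ∀ v, Set.BijOn lam {f | cell f.1 = some v ∧ δ ⟨f.1, Or.inl f.2⟩ = -1} (c v).2
  beta_in : Set.BijOn beta {f | δ ⟨f.1, Or.inr f.2⟩ = 1} b.1
  beta_out : Set.BijOn beta {f | δ ⟨f.1, Or.inr f.2⟩ = -1} b.2

namespace FlagGraph

/-- Flags of sign `ε` at the vertices of `G`. -/
def VFlag {L V F : Type} {c : V → Profile L} {b : Profile L} (G : FlagGraph c b F) (ε : ℤˣ) :
    Type :=
  {f : F // ∃ h : G.cell f ≠ none, G.δ ⟨f, Or.inl h⟩ = ε}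

/-- Boundary flags of sign `ε` of `G`. -/
def BFlag {L V F : Type} {c : V → Profile L} {b : Profile L} (G : FlagGraph c b F) (ε : ℤˣ) :
    Type :=
  {f : F // ∃ h : G.ι f = f, G.δ ⟨f, Or.inr h⟩ = ε}

/-- Flags of free loops of `G`. -/
def LoopFlag {L V F : Type} {c : V → Profile L} {b : Profile L} (G : FlagGraph c b F) : Type :=
  {f : F // G.cell f = none ∧ G.ι f ≠ f}

instance {L V F : Type} [Finite F] {c : V → Profile L} {b : Profile L} (G : FlagGraph c b F)
    (ε : ℤˣ) : Finite (G.VFlag ε) :=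
  inferInstanceAs (Finite (Subtype _))

instance {L V F : Type} [Finite F] {c : V → Profile L} {b : Profile L} (G : FlagGraph c b F)
    (ε : ℤˣ) : Finite (G.BFlag ε) :=
  inferInstanceAs (Finite (Subtype _))

instance {L V F : Type} [Finite F] {c : V → Profile L} {b : Profile L} (G : FlagGraph c b F) :
    Finite G.LoopFlag :=
  inferInstanceAs (Finite (Subtype _))

/-- The other flag of a free loop. -/
def loopMate {L V F : Type} {c : V → Profile L} {b : Profile L} (G : FlagGraph c b F)
    (f : G.LoopFlag) : G.LoopFlag :=
  ⟨G.ι f.1, G.cell_ι _ f.2.1, fun h => f.2.2 (by rw [G.ι_ι] at h; exact h.symm)⟩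

theorem loopMate_loopMate {L V F : Type} {c : V → Profile L} {b : Profile L}
    (G : FlagGraph c b F) (f : G.LoopFlag) : G.loopMate (G.loopMate f) = f :=
  Subtype.ext (G.ι_ι f.1)

theorem loopMate_ne {L V F : Type} {c : V → Profile L} {b : Profile L}
    (G : FlagGraph c b F) (f : G.LoopFlag) : G.loopMate f ≠ f :=
  fun h => f.2.2 (congrArg Subtype.val h)

/-- An end of an edge is a flag at a vertex or a boundary flag (an edge running from a vertex to the
boundary consists of a single flag, which then stands for both ends).  This sends an end of an edge
to its other end. -/
noncomputable def otherEnd {L V F : Type} {c : V → Profile L} {b : Profile L} (G : FlagGraph c b F)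
    {ε ε' : ℤˣ} (hε : ε' = -ε) : G.VFlag ε ⊕ G.BFlag ε' → G.VFlag ε' ⊕ G.BFlag ε :=
  open Classical in fun
  | .inl f =>
      if h : G.ι f.1 = f.1 then .inr ⟨f.1, h, f.2.2⟩
      else .inl ⟨G.ι f.1, fun h' => f.2.1 (by have := G.cell_ι _ h'; rwa [G.ι_ι] at this), by
        rw [G.δ_ι f.1 (Or.inl f.2.1) _ h, f.2.2, hε]⟩
  | .inr f =>
      if h : G.cell f.1 = none then
        .inr ⟨(G.π ⟨f.1, h, f.2.1⟩).1, (G.π ⟨f.1, h, f.2.1⟩).2.2, by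
          rw [G.δ_π, f.2.2, hε, neg_neg]⟩
      else .inl ⟨f.1, h, f.2.2⟩

theorem otherEnd_otherEnd {L V F : Type} {c : V → Profile L} {b : Profile L} (G : FlagGraph c b F)
    {ε ε' : ℤˣ} (hε : ε' = -ε) (hε' : ε = -ε') (x : G.VFlag ε ⊕ G.BFlag ε') :
    G.otherEnd hε' (G.otherEnd hε x) = x := by
  rcases x with ⟨f, hf, hf'⟩ | ⟨f, hf, hf'⟩
  · by_cases h : G.ι f = f
    · simp [otherEnd, h, hf]
    · have : ¬ f = G.ι f := fun e => h e.symm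
      simp [otherEnd, h, G.ι_ι, this]
  · by_cases h : G.cell f = none
    · have := (G.π ⟨f, h, hf⟩).2.1
      simp [otherEnd, h, this, G.π_π]
    · simp [otherEnd, h, hf]

/-- The edges of `G` other than free loops: every edge runs from a negative flag at a vertex or an
incoming boundary flag to a positive flag at a vertex or an outgoing boundary flag. -/
noncomputable def edge {L V F : Type} {c : V → Profile L} {b : Profile L} (G : FlagGraph c b F) :
    G.VFlag (-1) ⊕ G.BFlag 1 ≃ G.VFlag 1 ⊕ G.BFlag (-1) where
  toFun := G.otherEnd (by simp)
  invFun := G.otherEnd rfl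
  left_inv := G.otherEnd_otherEnd _ _
  right_inv := G.otherEnd_otherEnd _ _

/-- Flags at vertices are the same as labels in the neighbourhoods of the vertices. -/
noncomputable def vertexLabel {L V F : Type} {c : V → Profile L} {b : Profile L}
    (G : FlagGraph c b F) {ε : ℤˣ} (q : Profile L → Finset L)
    (h : ∀ v, Set.BijOn G.lam {f | G.cell f.1 = some v ∧ G.δ ⟨f.1, Or.inl f.2⟩ = ε} (q (c v))) :
    G.VFlag ε ≃ Σ v, q (c v) :=
  Equiv.ofBijective
    (fun f => ⟨(G.cell f.1).get (Option.isSome_iff_ne_none.2 f.2.1), G.lam ⟨f.1, f.2.1⟩,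
      (h _).mapsTo ⟨(Option.some_get _).symm, f.2.2⟩⟩) <| by
    constructor
    · rintro ⟨f, hf, hf'⟩ ⟨g, hg, hg'⟩ hfg
      have key : ∀ (v w : V) (x : q (c v)) (y : q (c w)),
          (⟨v, x⟩ : Σ v, q (c v)) = ⟨w, y⟩ → v = w ∧ (x : L) = y := by
        intro v w x y hxy
        cases hxy
        exact ⟨rfl, rfl⟩
      obtain ⟨h1, h2⟩ := key _ _ _ _ hfg
      have h3 := (h _).injOn (x₁ := ⟨f, hf⟩) (x₂ := ⟨g, hg⟩)
        ⟨(Option.some_get _).symm, hf'⟩ ⟨by rw [h1]; exact (Option.some_get _).symm, hg'⟩ h2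
      exact Subtype.ext (Subtype.mk.inj h3)
    · rintro ⟨v, a, ha⟩
      obtain ⟨⟨f, hf⟩, ⟨hv, hδ⟩, hl⟩ := (h v).surjOn ha
      have key : ∀ (w : V) (x : q (c w)), w = v → (x : L) = a →
          (⟨w, x⟩ : Σ v, q (c v)) = ⟨v, a, ha⟩ := by
        rintro w ⟨x, hx⟩ rfl rfl
        rfl
      exact ⟨⟨f, hf, hδ⟩, key _ _ (Option.get_of_eq_some _ hv) hl⟩

/-- Boundary flags are the same as boundary labels. -/
noncomputable def boundaryLabel {L V F : Type} {c : V → Profile L} {b : Profile L}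
    (G : FlagGraph c b F) {ε : ℤˣ} {s : Finset L}
    (h : Set.BijOn G.beta {f | G.δ ⟨f.1, Or.inr f.2⟩ = ε} s) : G.BFlag ε ≃ s :=
  Equiv.ofBijective (fun f => ⟨G.beta ⟨f.1, f.2.1⟩, h.mapsTo f.2.2⟩) <| by
    constructor
    · rintro ⟨f, hf, hf'⟩ ⟨g, hg, hg'⟩ hfg
      exact Subtype.ext (Subtype.mk.inj
        (h.injOn (x₁ := ⟨f, hf⟩) (x₂ := ⟨g, hg⟩) hf' hg' (congrArg Subtype.val hfg)))
    · rintro ⟨a, ha⟩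
      obtain ⟨⟨f, hf⟩, hδ, hl⟩ := h.surjOn ha
      exact ⟨⟨f, hf, hδ⟩, Subtype.ext hl⟩

/-- Renaming the flags of a graph. -/
def transport {L V F F' : Type} {c : V → Profile L} {b : Profile L} (G : FlagGraph c b F)
    (e : F ≃ F') : FlagGraph c b F' :=
  have hι : ∀ {f}, e (G.ι (e.symm f)) = f ↔ G.ι (e.symm f) = e.symm f :=
    fun {_} => e.eq_symm_apply.symm
  have hb : ∀ {P : F → Prop} {Q : F' → Prop} (hPQ : ∀ f, Q f ↔ P (e.symm f)) {lab : Subtype P → L}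
      {S : Set (Subtype P)} {S' : Set (Subtype Q)} {B : Set L}
      (_ : ∀ f, f ∈ S' ↔ (⟨e.symm f.1, (hPQ _).1 f.2⟩ : Subtype P) ∈ S), Set.BijOn lab S B →
      Set.BijOn (fun f : Subtype Q => lab ⟨e.symm f.1, (hPQ _).1 f.2⟩) S' B := by
    intro P Q hPQ lab S S' B hS h
    refine ⟨fun f hf => h.mapsTo ((hS f).1 hf), fun f hf g hg hfg => ?_, fun a ha => ?_⟩
    · have := h.injOn ((hS f).1 hf) ((hS g).1 hg) hfg
      exact Subtype.ext (e.symm.injective (congrArg Subtype.val this))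
    · obtain ⟨f, hf, rfl⟩ := h.surjOn ha
      refine ⟨⟨e f.1, (hPQ _).2 (by simpa using f.2)⟩, (hS _).2 (by simpa using hf), by simp⟩
  { cell := fun f => G.cell (e.symm f)
    ι := fun f => e (G.ι (e.symm f))
    ι_ι := fun f => by simp [G.ι_ι]
    cell_ι := fun f h => by simpa using G.cell_ι _ h
    π := fun f =>
      ⟨e (G.π ⟨e.symm f.1, f.2.1, hι.1 f.2.2⟩).1, by
        simpa using (G.π ⟨e.symm f.1, f.2.1, hι.1 f.2.2⟩).2⟩
    π_π := fun f => by simp [G.π_π]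
    π_ne := fun f h => G.π_ne ⟨e.symm f.1, f.2.1, hι.1 f.2.2⟩
      (Subtype.ext (e.eq_symm_apply.2 (congrArg Subtype.val h)))
    δ := fun f => G.δ ⟨e.symm f.1, f.2.imp_right hι.1⟩
    δ_ι := fun f h h' hne => by
      have := G.δ_ι (e.symm f) (h.imp_right hι.1) (by simpa using h'.imp_right hι.1)
        (fun h => hne (hι.2 h))
      simpa using this
    δ_π := fun f => by simpa using G.δ_π ⟨e.symm f.1, f.2.1, hι.1 f.2.2⟩
    lam := fun f => G.lam ⟨e.symm f.1, f.2⟩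
    beta := fun f => G.beta ⟨e.symm f.1, hι.1 f.2⟩
    lam_in := fun v => hb (fun _ => Iff.rfl) (fun _ => Iff.rfl) (G.lam_in v)
    lam_out := fun v => hb (fun _ => Iff.rfl) (fun _ => Iff.rfl) (G.lam_out v)
    beta_in := hb (fun _ => hι) (fun _ => Iff.rfl) G.beta_in
    beta_out := hb (fun _ => hι) (fun _ => Iff.rfl) G.beta_out }


theorem sigma_label_ext {L V : Type} {q : V → Finset L} {x y : Σ v, q v} (h : x.1 = y.1)
    (h' : (x.2 : L) = y.2) : x = y := by
  obtain ⟨v, a⟩ := x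
  obtain ⟨w, a'⟩ := y
  obtain rfl : v = w := h
  obtain rfl : a = a' := Subtype.ext h'
  rfl

/-- The flags of the graph with prescribed edges: the given flags at vertices, two flags for every
free edge, and the given flags of free loops. -/
abbrev EdgeFlag {VN VP BN BP : Type} (e : VN ⊕ BP ≃ VP ⊕ BN) (O : Type) : Type :=
  (VN ⊕ VP) ⊕ (({w : BP × BN // e (Sum.inr w.1) = Sum.inr w.2} × Bool) ⊕ O)

/-- The graph with prescribed edges.  Its negative and positive flags at vertices are `VN` and `VP`,
in bijection with the labels in the neighbourhoods of the vertices, its outgoing and incoming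
boundary points are `BN` and `BP`, in bijection with the boundary labels, `e` says which edge runs
from where to where, and `o` matches the flags `O` of the free loops. -/
noncomputable def ofEdges {L V : Type} {c : V → Profile L} {b : Profile L} {VN VP BN BP O : Type}
    (lN : VN ≃ Σ v, (c v).2) (lP : VP ≃ Σ v, (c v).1) (mN : BN ≃ b.2) (mP : BP ≃ b.1)
    (e : VN ⊕ BP ≃ VP ⊕ BN) (o : O → O) (oo : ∀ x, o (o x) = x) (o_ne : ∀ x, o x ≠ x) :
    FlagGraph c b (EdgeFlag e O) :=
  let cell : EdgeFlag e O → Option V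
    | .inl (.inl a) => some (lN a).1
    | .inl (.inr a) => some (lP a).1
    | .inr _ => none
  let ι : EdgeFlag e O → EdgeFlag e O
    | .inl (.inl a) => Sum.elim (fun a' => .inl (.inr a')) (fun _ => .inl (.inl a)) (e (.inl a))
    | .inl (.inr a) =>
        Sum.elim (fun a' => .inl (.inl a')) (fun _ => .inl (.inr a)) (e.symm (.inl a))
    | .inr (.inl f) => .inr (.inl f)
    | .inr (.inr x) => .inr (.inr (o x))
  let sgn : EdgeFlag e O → ℤˣ
    | .inl (.inl _) => -1
    | .inl (.inr _) => 1
    | .inr (.inl (_, true)) => 1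
    | .inr (.inl (_, false)) => -1
    | .inr (.inr _) => 1
  let beta : {f // ι f = f} → L := fun
    | ⟨.inl (.inl a), _⟩ => Sum.elim (fun a' => (lP a').2.1) (fun y => (mN y).1) (e (.inl a))
    | ⟨.inl (.inr a), _⟩ =>
        Sum.elim (fun a' => (lN a').2.1) (fun x => (mP x).1) (e.symm (.inl a))
    | ⟨.inr (.inl (w, true)), _⟩ => mP w.1.1
    | ⟨.inr (.inl (w, false)), _⟩ => mN w.1.2
    | ⟨.inr (.inr x), h⟩ => absurd (Sum.inr_injective (Sum.inr_injective h)) (o_ne x)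
  have key_in : ∀ f : {f // ι f = f}, sgn f.1 = 1 → ∃ x, beta f = mP x ∧
      ((∃ a, f.1 = .inl (.inr a) ∧ e (.inr x) = .inl a) ∨
        ∃ w, f.1 = .inr (.inl (w, true)) ∧ w.1.1 = x) := by
    rintro ⟨(a | a) | ⟨w, _ | _⟩ | x, h⟩ hs
    · simp [sgn] at hs
    · rcases he : e.symm (.inl a) with a' | x
      · simp [ι, he] at h
      · refine ⟨x, by simp [beta, he], Or.inl ⟨a, rfl, ?_⟩⟩
        rw [← he, Equiv.apply_symm_apply]
    · simp [sgn] at hs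
    · exact ⟨w.1.1, rfl, Or.inr ⟨w, rfl, rfl⟩⟩
    · exact absurd (Sum.inr_injective (Sum.inr_injective h)) (o_ne x)
  have key_out : ∀ f : {f // ι f = f}, sgn f.1 = -1 → ∃ y, beta f = mN y ∧
      ((∃ a, f.1 = .inl (.inl a) ∧ e (.inl a) = .inr y) ∨
        ∃ w, f.1 = .inr (.inl (w, false)) ∧ w.1.2 = y) := by
    rintro ⟨(a | a) | ⟨w, _ | _⟩ | x, h⟩ hs
    · rcases he : e (.inl a) with a' | y
      · simp [ι, he] at h
      · exact ⟨y, by simp [beta, he], Or.inl ⟨a, rfl, he⟩⟩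
    · simp [sgn] at hs
    · exact ⟨w.1.2, rfl, Or.inr ⟨w, rfl, rfl⟩⟩
    · simp [sgn] at hs
    · exact absurd (Sum.inr_injective (Sum.inr_injective h)) (o_ne x)
  { cell := cell
    ι := ι
    ι_ι := by
      rintro ((a | a) | f | x)
      · rcases h : e (.inl a) with a' | y
        · have h' : e.symm (.inl a') = .inl a := by rw [← h, Equiv.symm_apply_apply]
          simp [ι, h, h']
        · simp [ι, h]
      · rcases h : e.symm (.inl a) with a' | y
        · have h' : e (.inl a') = .inl a := by rw [← h, Equiv.apply_symm_apply]
          simp [ι, h, h']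
        · simp [ι, h]
      · rfl
      · simp [ι, oo]
    cell_ι := by
      rintro ((a | a) | f | x) h
      · cases h
      · cases h
      · rfl
      · rfl
    π := fun
      | ⟨.inl (.inl _), h⟩ => absurd h.1 (Option.some_ne_none _)
      | ⟨.inl (.inr _), h⟩ => absurd h.1 (Option.some_ne_none _)
      | ⟨.inr (.inl (w, ε)), _⟩ => ⟨.inr (.inl (w, !ε)), rfl, rfl⟩
      | ⟨.inr (.inr x), h⟩ => absurd (Sum.inr_injective (Sum.inr_injective h.2)) (o_ne x)
    π_π := by
      rintro ⟨(a | a) | ⟨w, ε⟩ | x, h⟩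
      · exact absurd h.1 (Option.some_ne_none _)
      · exact absurd h.1 (Option.some_ne_none _)
      · simp
      · exact absurd (Sum.inr_injective (Sum.inr_injective h.2)) (o_ne x)
    π_ne := by
      rintro ⟨(a | a) | ⟨w, ε⟩ | x, h⟩
      · exact absurd h.1 (Option.some_ne_none _)
      · exact absurd h.1 (Option.some_ne_none _)
      · simp
      · exact absurd (Sum.inr_injective (Sum.inr_injective h.2)) (o_ne x)
    δ := fun f => sgn f.1
    δ_ι := by
      rintro ((a | a) | f | x) h h' hne
      · rcases he : e (.inl a) with a' | y
        · simp [ι, he, sgn]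
        · simp [ι, he] at hne
      · rcases he : e.symm (.inl a) with a' | y
        · simp [ι, he, sgn]
        · simp [ι, he] at hne
      · exact absurd rfl hne
      · rcases h with h | h
        · exact absurd rfl h
        · exact absurd (Sum.inr_injective (Sum.inr_injective h)) (o_ne x)
    δ_π := by
      rintro ⟨(a | a) | ⟨w, _ | _⟩ | x, h⟩
      · exact absurd h.1 (Option.some_ne_none _)
      · exact absurd h.1 (Option.some_ne_none _)
      · simp [sgn]
      · simp [sgn]
      · exact absurd (Sum.inr_injective (Sum.inr_injective h.2)) (o_ne x)
    lam := fun
      | ⟨.inl (.inl a), _⟩ => (lN a).2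
      | ⟨.inl (.inr a), _⟩ => (lP a).2
      | ⟨.inr _, h⟩ => absurd rfl h
    beta := beta
    lam_in := by
      intro v
      refine ⟨?_, ?_, ?_⟩
      · rintro ⟨(a | a) | f, hf⟩ ⟨h, h'⟩
        · simp [sgn] at h'
        · obtain rfl := Option.some_injective _ h
          exact (lP a).2.2
        · exact absurd rfl hf
      · rintro ⟨(a | a) | f, hf⟩ ⟨h, h'⟩ ⟨(a' | a') | f', hf'⟩ ⟨g, g'⟩ hl
        all_goals first
          | exact absurd rfl hf
          | exact absurd rfl hf'
          | (simp [sgn] at h'; done)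
          | (simp [sgn] at g'; done)
          | skip
        have h1 : (lP a).1 = (lP a').1 := Option.some_injective _ (h.trans g.symm)
        obtain rfl := lP.injective (sigma_label_ext h1 hl)
        rfl
      · rintro a ha
        refine ⟨⟨.inl (.inr (lP.symm ⟨v, a, ha⟩)), Option.some_ne_none _⟩, ⟨?_, rfl⟩, ?_⟩
        · simp [cell]
        · exact congrArg (fun t : Σ v, (c v).1 => (t.2 : L)) (lP.apply_symm_apply _)
    lam_out := by
      intro v
      refine ⟨?_, ?_, ?_⟩
      · rintro ⟨(a | a) | f, hf⟩ ⟨h, h'⟩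
        · obtain rfl := Option.some_injective _ h
          exact (lN a).2.2
        · simp [sgn] at h'
        · exact absurd rfl hf
      · rintro ⟨(a | a) | f, hf⟩ ⟨h, h'⟩ ⟨(a' | a') | f', hf'⟩ ⟨g, g'⟩ hl
        all_goals first
          | exact absurd rfl hf
          | exact absurd rfl hf'
          | (simp [sgn] at h'; done)
          | (simp [sgn] at g'; done)
          | skip
        have h1 : (lN a).1 = (lN a').1 := Option.some_injective _ (h.trans g.symm)
        obtain rfl := lN.injective (sigma_label_ext h1 hl)
        rfl
      · rintro a ha
        refine ⟨⟨.inl (.inl (lN.symm ⟨v, a, ha⟩)), Option.some_ne_none _⟩, ⟨?_, rfl⟩, ?_⟩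
        · simp [cell]
        · exact congrArg (fun t : Σ v, (c v).2 => (t.2 : L)) (lN.apply_symm_apply _)
    beta_in := by
      refine ⟨?_, ?_, ?_⟩
      · intro f hf
        obtain ⟨x, hx, _⟩ := key_in f hf
        rw [hx]
        exact (mP x).2
      · intro f hf g hg hfg
        obtain ⟨x, hx, hx'⟩ := key_in f hf
        obtain ⟨y, hy, hy'⟩ := key_in g hg
        obtain rfl : x = y := mP.injective (Subtype.ext (by rw [← hx, ← hy, hfg]))
        refine Subtype.ext ?_
        rcases hx' with ⟨a, ha, ha'⟩ | ⟨w, hw, hw'⟩ <;> rcases hy' with ⟨a₂, hb, hb'⟩ | ⟨w₂, hz, hz'⟩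
        · rw [ha, hb, Sum.inl_injective (ha'.symm.trans hb')]
        · have := w₂.2
          rw [hz', ha'] at this
          exact absurd this Sum.inl_ne_inr
        · have := w.2
          rw [hw', hb'] at this
          exact absurd this Sum.inl_ne_inr
        · have : w = w₂ := Subtype.ext (Prod.ext (hw'.trans hz'.symm)
            (Sum.inr_injective (w.2.symm.trans ((congrArg (fun x => e (.inr x))
              (hw'.trans hz'.symm)).trans w₂.2))))
          rw [hw, hz, this]
      · intro a ha
        rcases he : e (.inr (mP.symm ⟨a, ha⟩)) with a' | y
        · have he' : e.symm (.inl a') = .inr (mP.symm ⟨a, ha⟩) := by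
            rw [← he, Equiv.symm_apply_apply]
          exact ⟨⟨.inl (.inr a'), by simp [ι, he']⟩, rfl, by simp [beta, he']⟩
        · exact ⟨⟨.inr (.inl (⟨(_, y), he⟩, true)), rfl⟩, rfl, by simp [beta]⟩
    beta_out := by
      refine ⟨?_, ?_, ?_⟩
      · intro f hf
        obtain ⟨x, hx, _⟩ := key_out f hf
        rw [hx]
        exact (mN x).2
      · intro f hf g hg hfg
        obtain ⟨x, hx, hx'⟩ := key_out f hf
        obtain ⟨y, hy, hy'⟩ := key_out g hg
        obtain rfl : x = y := mN.injective (Subtype.ext (by rw [← hx, ← hy, hfg]))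
        refine Subtype.ext ?_
        rcases hx' with ⟨a, ha, ha'⟩ | ⟨w, hw, hw'⟩ <;> rcases hy' with ⟨a₂, hb, hb'⟩ | ⟨w₂, hz, hz'⟩
        · rw [ha, hb, Sum.inl_injective (e.injective (ha'.trans hb'.symm))]
        · have := w₂.2
          rw [hz', ← ha'] at this
          exact absurd (e.injective this) Sum.inr_ne_inl
        · have := w.2
          rw [hw', ← hb'] at this
          exact absurd (e.injective this) Sum.inr_ne_inl
        · have : w = w₂ := Subtype.ext (Prod.ext (Sum.inr_injective (e.injective
            (w.2.trans ((congrArg Sum.inr (hw'.trans hz'.symm)).trans w₂.2.symm))))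
            (hw'.trans hz'.symm))
          rw [hw, hz, this]
      · intro a ha
        rcases he : e.symm (.inr (mN.symm ⟨a, ha⟩)) with a' | x
        · have he' : e (.inl a') = .inr (mN.symm ⟨a, ha⟩) := by
            rw [← he, Equiv.apply_symm_apply]
          exact ⟨⟨.inl (.inl a'), by simp [ι, he']⟩, rfl, by simp [beta, he']⟩
        · have he' : e (.inr x) = .inr (mN.symm ⟨a, ha⟩) := by
            rw [← he, Equiv.apply_symm_apply]
          exact ⟨⟨.inr (.inl (⟨(x, _), he'⟩, false)), rfl⟩, rfl, by simp [beta]⟩ }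

/-- The corolla `C_(I;J)`: one vertex with neighbourhood `(I;J)` whose flags are also the boundary
flags, with the same labels. -/
noncomputable def corolla {L : Type} (b : Profile L) :
    FlagGraph (fun _ : Fin 1 => b) b
      (EdgeFlag (Equiv.sumComm b.2 b.1 : b.2 ⊕ b.1 ≃ b.1 ⊕ b.2) Empty) :=
  ofEdges (Equiv.uniqueSigma fun _ : Fin 1 => (b.2 : Type)).symm
    (Equiv.uniqueSigma fun _ : Fin 1 => (b.1 : Type)).symm (Equiv.refl _) (Equiv.refl _)
    (Equiv.sumComm _ _) Empty.elim (fun x => x.elim) (fun x => x.elim)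

end FlagGraph

/-- A permutation of a finite set of labels, extended by the identity. -/
noncomputable def extendPerm {L : Type} (s : Finset L) : Equiv.Perm s →* Equiv.Perm L :=
  open Classical in Equiv.Perm.ofSubtype (p := (· ∈ s))

theorem extendPerm_coe {L : Type} {s : Finset L} (σ : Equiv.Perm s) (a : s) :
    extendPerm s σ a = σ a := by
  classical
  exact Equiv.Perm.ofSubtype_apply_coe σ a

theorem extendPerm_bijOn {L : Type} {s : Finset L} (σ : Equiv.Perm s) :
    Set.BijOn (extendPerm s σ) s s := by
  refine ⟨fun a ha => ?_, (extendPerm s σ).injective.injOn, fun a ha => ?_⟩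
  · rw [extendPerm_coe σ ⟨a, ha⟩]
    exact (σ ⟨a, ha⟩).2
  · refine ⟨σ.symm ⟨a, ha⟩, (σ.symm ⟨a, ha⟩).2, ?_⟩
    rw [extendPerm_coe, Equiv.apply_symm_apply]

/-- The group acting on `E[I;J]` from the left by `S_I` and from the right by `S_J`. -/
abbrev LabelGroup {L : Type} (b : Profile L) : Type :=
  Equiv.Perm b.1 × (Equiv.Perm b.2)ᵐᵒᵖ

/-- The action on incoming labels: `σ` sends the label `i` to `σ i`. -/
noncomputable def actIn {L : Type} {b : Profile L} (g : LabelGroup b) : Equiv.Perm L :=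
  extendPerm b.1 g.1

/-- The action on outgoing labels; since `S_J` acts from the right, `τ` sends `j` to `τ⁻¹ j`. -/
noncomputable def actOut {L : Type} {b : Profile L} (g : LabelGroup b) : Equiv.Perm L :=
  extendPerm b.2 g.2.unop⁻¹

theorem actIn_mul {L : Type} {b : Profile L} (g h : LabelGroup b) :
    actIn (g * h) = actIn g * actIn h := by
  simp [actIn]

theorem actOut_mul {L : Type} {b : Profile L} (g h : LabelGroup b) :
    actOut (g * h) = actOut g * actOut h := by
  simp [actOut]

theorem actIn_one {L : Type} {b : Profile L} : actIn (1 : LabelGroup b) = 1 := by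
  simp [actIn]

theorem actOut_one {L : Type} {b : Profile L} : actOut (1 : LabelGroup b) = 1 := by
  simp [actOut]

namespace FlagGraph

/-- The graph `σGτ` obtained from `G` by permuting the boundary labels. -/
noncomputable def relabel {L V F : Type} {c : V → Profile L} {b : Profile L} (g : LabelGroup b)
    (G : FlagGraph c b F) : FlagGraph c b F :=
  { G with
    beta := fun f =>
      if G.δ ⟨f.1, Or.inr f.2⟩ = 1 then actIn g (G.beta f) else actOut g (G.beta f)
    beta_in := by
      refine ((extendPerm_bijOn g.1).comp G.beta_in).congr fun f hf => ?_
      exact (if_pos hf).symm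
    beta_out := by
      refine ((extendPerm_bijOn g.2.unop⁻¹).comp G.beta_out).congr fun f hf => ?_
      refine (if_neg fun h => ?_).symm
      exact absurd (h.symm.trans hf) (by decide) }

theorem relabel_one {L V F : Type} {c : V → Profile L} {b : Profile L} (G : FlagGraph c b F) :
    G.relabel 1 = G := by
  ext1 <;> try rfl
  refine heq_of_eq (funext fun f => ?_)
  simp [relabel, actIn_one, actOut_one]

theorem relabel_mul {L V F : Type} {c : V → Profile L} {b : Profile L} (g h : LabelGroup b)
    (G : FlagGraph c b F) : G.relabel (g * h) = (G.relabel h).relabel g := by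
  ext1 <;> try rfl
  refine heq_of_eq (funext fun f => ?_)
  simp only [relabel, actIn_mul, actOut_mul, Equiv.Perm.mul_apply]
  split_ifs <;> rfl

/-- A rearrangement of summands. -/
def shuffle (A B N P : Type) : (A ⊕ B) ⊕ (N ⊕ P) ≃ (N ⊕ B) ⊕ (A ⊕ P) where
  toFun
    | .inl (.inl a) => .inr (.inl a)
    | .inl (.inr b) => .inl (.inr b)
    | .inr (.inl n) => .inl (.inl n)
    | .inr (.inr p) => .inr (.inr p)
  invFun
    | .inr (.inl a) => .inl (.inl a)
    | .inl (.inr b) => .inl (.inr b)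
    | .inl (.inl n) => .inr (.inl n)
    | .inr (.inr p) => .inr (.inr p)
  left_inv := by rintro ((a | b) | (n | p)) <;> rfl
  right_inv := by rintro ((n | b) | (a | p)) <;> rfl

/-- A positive flag at a vertex `v` of `G` is identified with the positive leg of `H v` that has the
same label. -/
noncomputable def legIn {L V F : Type} {c : V → Profile L} {b : Profile L} (G : FlagGraph c b F)
    {W K : V → Type} {d : ∀ v, W v → Profile L} (H : ∀ v, FlagGraph (d v) (c v) (K v)) :
    G.VFlag 1 ≃ Σ v, (H v).BFlag 1 :=
  (G.vertexLabel Prod.fst G.lam_in).trans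
    (Equiv.sigmaCongrRight fun v => ((H v).boundaryLabel (H v).beta_in).symm)

/-- A negative flag at a vertex `v` of `G` is identified with the negative leg of `H v` that has the
same label. -/
noncomputable def legOut {L V F : Type} {c : V → Profile L} {b : Profile L} (G : FlagGraph c b F)
    {W K : V → Type} {d : ∀ v, W v → Profile L} (H : ∀ v, FlagGraph (d v) (c v) (K v)) :
    G.VFlag (-1) ≃ Σ v, (H v).BFlag (-1) :=
  (G.vertexLabel Prod.snd G.lam_out).trans
    (Equiv.sigmaCongrRight fun v => ((H v).boundaryLabel (H v).beta_out).symm)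

/-- The edges of `G` and of all `H v`, sorted for gluing at the flags at the vertices of `G`.
At a negative flag `f` of `G` the edge of `H v` that ends at the leg identified with `f` is glued
to the edge of `G` that begins at `f`; at a positive flag `f` of `G` the edge of `G` that ends at
`f` is glued to the edge of `H v` that begins at the leg identified with `f`. -/
noncomputable def substStrands {L V F : Type} {c : V → Profile L} {b : Profile L}
    (G : FlagGraph c b F) {W K : V → Type} {d : ∀ v, W v → Profile L}
    (H : ∀ v, FlagGraph (d v) (c v) (K v)) :
    ((Σ v, (H v).VFlag (-1)) ⊕ G.BFlag 1) ⊕ (G.VFlag (-1) ⊕ G.VFlag 1) ≃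
      ((Σ v, (H v).VFlag 1) ⊕ G.BFlag (-1)) ⊕ (G.VFlag (-1) ⊕ G.VFlag 1) :=
  let beginnings : ((Σ v, (H v).VFlag (-1)) ⊕ G.BFlag 1) ⊕ (G.VFlag (-1) ⊕ G.VFlag 1) ≃
      (G.VFlag (-1) ⊕ G.BFlag 1) ⊕ (Σ v, (H v).VFlag (-1) ⊕ (H v).BFlag 1) :=
    (shuffle _ _ _ _).trans <| (Equiv.refl _).sumCongr <|
      ((Equiv.refl _).sumCongr (G.legIn H)).trans (Equiv.sigmaSumDistrib _ _).symm
  let endings : ((Σ v, (H v).VFlag 1) ⊕ G.BFlag (-1)) ⊕ (G.VFlag (-1) ⊕ G.VFlag 1) ≃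
      (G.VFlag 1 ⊕ G.BFlag (-1)) ⊕ (Σ v, (H v).VFlag 1 ⊕ (H v).BFlag (-1)) :=
    ((Equiv.refl _).sumCongr (Equiv.sumComm _ _)).trans <|
      (shuffle _ _ _ _).trans <| (Equiv.refl _).sumCongr <|
        ((Equiv.refl _).sumCongr (G.legOut H)).trans (Equiv.sigmaSumDistrib _ _).symm
  beginnings.trans <|
    (G.edge.sumCongr (Equiv.sigmaCongrRight fun v => (H v).edge)).trans endings.symm

/-- The graph substitution `G({H_v})`.  Its flags at vertices are those of the `H v`, its boundary
is that of `G`, its edges are obtained by gluing those of `G` and of the `H v`, and its free loops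
are those of `G`, those of the `H v` and those that the gluing creates.  The vertices, which are
those of the `H v`, are renamed along `q`. -/
noncomputable def subst {L V F U : Type} [Finite V] [Finite F] {c : V → Profile L} {b : Profile L}
    (G : FlagGraph c b F) {W K : V → Type} [∀ v, Finite (K v)] {d : ∀ v, W v → Profile L}
    (H : ∀ v, FlagGraph (d v) (c v) (K v)) (q : U ≃ Σ v, W v) :
    FlagGraph (fun u => d (q u).1 (q u).2) b
      (EdgeFlag (glue (G.substStrands H))
        ((G.LoopFlag ⊕ Σ v, (H v).LoopFlag) ⊕ (GlueLoop (G.substStrands H) × Bool))) :=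
  ofEdges
    ((Equiv.sigmaCongrRight fun v => (H v).vertexLabel Prod.snd (H v).lam_out).trans <|
      (Equiv.sigmaAssoc fun v w => ((d v w).2 : Type)).symm.trans
        (Equiv.sigmaCongrLeft (β := fun t : Σ v, W v => ((d t.1 t.2).2 : Type)) q).symm)
    ((Equiv.sigmaCongrRight fun v => (H v).vertexLabel Prod.fst (H v).lam_in).trans <|
      (Equiv.sigmaAssoc fun v w => ((d v w).1 : Type)).symm.trans
        (Equiv.sigmaCongrLeft (β := fun t : Σ v, W v => ((d t.1 t.2).1 : Type)) q).symm)
    (G.boundaryLabel G.beta_out) (G.boundaryLabel G.beta_in)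
    (glue (G.substStrands H))
    (Sum.map (Sum.map G.loopMate (Sigma.map id fun v => (H v).loopMate)) (Prod.map id not))
    (by
      rintro ((f | ⟨v, f⟩) | ⟨x, ε⟩)
      · simp [loopMate_loopMate]
      · simp [Sigma.map, loopMate_loopMate]
      · simp)
    (by
      rintro ((f | ⟨v, f⟩) | ⟨x, ε⟩)
      · simp [loopMate_ne]
      · simp [Sigma.map, loopMate_ne]
      · simp)

end FlagGraph

/-- An oriented labelled graph with finitely many flags and numbered vertices and with boundary
`b = (I;J)`: an object of the category `𝒢(I;J)`.  Flags only matter up to bijection, so the set of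
flags is taken to be some `Fin n`. -/
structure OGraph {L : Type} (b : Profile L) where
  r : ℕ
  c : Fin r → Profile L
  n : ℕ
  graph : FlagGraph c b (Fin n)

namespace OGraph

/-- The graph with its flags numbered in some way. -/
noncomputable def ofFlagGraph {L F : Type} [Finite F] {b : Profile L} {r : ℕ} {c : Fin r → Profile L}
    (G : FlagGraph c b F) : OGraph b where
  r := r
  c := c
  n := Nat.card F
  graph := G.transport (Finite.equivFin F)

/-- The corolla with the given vertex and boundary labels. -/
noncomputable def corolla {L : Type} (b : Profile L) : OGraph b :=
  ofFlagGraph (FlagGraph.corolla b)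

/-- The permuted graph `σGτ`. -/
noncomputable def relabel {L : Type} {b : Profile L} (g : LabelGroup b) (G : OGraph b) :
    OGraph b :=
  { G with graph := G.graph.relabel g }

/-- Graph substitution `G({H_v})`, with the vertices numbered lexicographically. -/
noncomputable def subst {L : Type} {b : Profile L} (G : OGraph b) (H : ∀ v, OGraph (G.c v)) :
    OGraph b :=
  ofFlagGraph (G.graph.subst (fun v => (H v).graph)
    (finSigmaFinEquiv (n := fun v => (H v).r)).symm)

/-- Graph substitution `G(H)` into the single vertex `v`. -/
noncomputable def substAt {L : Type} {b : Profile L} (G : OGraph b) (v : Fin G.r)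
    (H : OGraph (G.c v)) : OGraph b :=
  G.subst (Function.update (fun w => corolla (G.c w)) v H)

/-- An isomorphism of graphs that may permute the vertices (along `s`), and that may change the
labels of the flags at every vertex `v'` by permutations `θ v'` of `in(v')` and `out(v')`. -/
structure Iso {L : Type} {b : Profile L} (G G' : OGraph b) where
  s : Fin G.r ≃ Fin G'.r
  nbh : ∀ v, G.c v = G'.c (s v)
  φ : Fin G.n ≃ Fin G'.n
  θ : ∀ v', LabelGroup (G'.c v')
  cell : ∀ f, G'.graph.cell (φ f) = (G.graph.cell f).map s
  ι : ∀ f, G'.graph.ι (φ f) = φ (G.graph.ι f)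
  π : ∀ f h h', (G'.graph.π ⟨φ f, h'⟩).1 = φ (G.graph.π ⟨f, h⟩).1
  δ : ∀ f h h', G'.graph.δ ⟨φ f, h'⟩ = G.graph.δ ⟨f, h⟩
  beta : ∀ f h h', G'.graph.beta ⟨φ f, h'⟩ = G.graph.beta ⟨f, h⟩
  lam_in : ∀ f h h' v', G'.graph.cell (φ f) = some v' → G.graph.δ ⟨f, Or.inl h⟩ = 1 →
    G'.graph.lam ⟨φ f, h'⟩ = actIn (θ v') (G.graph.lam ⟨f, h⟩)
  lam_out : ∀ f h h' v', G'.graph.cell (φ f) = some v' → G.graph.δ ⟨f, Or.inl h⟩ = -1 →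
    G'.graph.lam ⟨φ f, h'⟩ = actOut (θ v') (G.graph.lam ⟨f, h⟩)

/-- Two oriented labelled graphs are (strictly) isomorphic if there is a bijection of flags that
preserves the ordered partition, the involutions, the orientation and all labels. -/
def StrictIso {L : Type} {b : Profile L} (G G' : OGraph b) : Prop :=
  ∃ e : Iso G G', Monotone e.s ∧ ∀ v', e.θ v' = 1

/-- Isomorphisms are compatible with permutations of the boundary labels. -/
def Iso.relabel {L : Type} {b : Profile L} {G G' : OGraph b} (e : Iso G G') (g : LabelGroup b) :
    Iso (G.relabel g) (G'.relabel g) where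
  s := e.s
  nbh := e.nbh
  φ := e.φ
  θ := e.θ
  cell := e.cell
  ι := e.ι
  π := e.π
  δ := e.δ
  beta := fun f h h' => by
    have h1 := e.δ f (Or.inr h) (Or.inr h')
    have h2 := e.beta f h h'
    change (if G'.graph.δ _ = 1 then actIn g (G'.graph.beta _) else actOut g (G'.graph.beta _)) =
      if G.graph.δ _ = 1 then actIn g (G.graph.beta _) else actOut g (G.graph.beta _)
    erw [h1, h2]
    rfl
  lam_in := e.lam_in
  lam_out := e.lam_out

end OGraph

/-! ## `𝒮`-bimodules and the graph substitution monad -/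

/-- An `𝒮`-bimodule: vector spaces `E[I;J]` indexed by pairs of finite sets of labels, with commuting
actions of `S_I` from the left and of `S_J` from the right. -/
structure SBimodule (k : Type u) [Field k] (L : Type) where
  carrier : Profile L → Type u
  [addCommGroup : ∀ b, AddCommGroup (carrier b)]
  [module : ∀ b, Module k (carrier b)]
  ρ : ∀ b, Representation k (LabelGroup b) (carrier b)

namespace SBimodule

attribute [instance] SBimodule.addCommGroup SBimodule.module

/-- A morphism of `𝒮`-bimodules: an equivariant family of linear maps. -/
@[ext]
structure Hom {k : Type u} [Field k] {L : Type} (E E' : SBimodule k L) where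
  hom : ∀ b, E.carrier b →ₗ[k] E'.carrier b
  equivariant : ∀ b g x, hom b (E.ρ b g x) = E'.ρ b g (hom b x)

instance {k : Type u} [Field k] {L : Type} : Category (SBimodule k L) where
  Hom := Hom
  id E := { hom := fun _ => LinearMap.id, equivariant := fun _ _ _ => rfl }
  comp f g :=
    { hom := fun b => (g.hom b).comp (f.hom b)
      equivariant := fun b γ x => by simp [f.equivariant, g.equivariant] }

/-- The direct sum of the spaces of decorations `E[G] = ⨂_v E[in(v);out(v)]` of all graphs `G` with
boundary `b = (I;J)`. -/
abbrev DecorationSum {k : Type u} [Field k] {L : Type} (E : SBimodule k L) (b : Profile L) :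
    Type u :=
  ⨁ G : OGraph b, ⨂[k] v, E.carrier (G.c v)

open Classical in
/-- The identifications made by isomorphisms of graphs.  An isomorphism `G → G'` identifies `E[G]`
with `E[G']` by permuting the tensor factors as it permutes the vertices, and by acting on the factor
at every vertex by the permutations of the labels at that vertex. -/
noncomputable def isoRelations {k : Type u} [Field k] {L : Type} (E : SBimodule k L)
    (b : Profile L) : Submodule k (E.DecorationSum b) :=
  Submodule.span k {z | ∃ (G G' : OGraph b) (e : G.Iso G') (y : ∀ v', E.carrier (G'.c v')),
    z = DirectSum.lof k (OGraph b) (fun G => ⨂[k] v, E.carrier (G.c v)) G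
          (PiTensorProduct.tprod k fun v => cast (congrArg E.carrier (e.nbh v).symm) (y (e.s v))) -
        DirectSum.lof k (OGraph b) (fun G => ⨂[k] v, E.carrier (G.c v)) G'
          (PiTensorProduct.tprod k fun v' => E.ρ _ (e.θ v') (y v'))}

/-- The space `FE[I;J]`, the colimit of the spaces of decorations `E[G]` over all graphs `G` with
boundary `(I;J)` and their isomorphisms. -/
def Free {k : Type u} [Field k] {L : Type} (E : SBimodule k L) (b : Profile L) : Type u :=
  E.DecorationSum b ⧸ E.isoRelations b

noncomputable instance {k : Type u} [Field k] {L : Type} (E : SBimodule k L) (b : Profile L) :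
    AddCommGroup (E.Free b) :=
  inferInstanceAs (AddCommGroup (_ ⧸ E.isoRelations b))

noncomputable instance {k : Type u} [Field k] {L : Type} (E : SBimodule k L) (b : Profile L) :
    Module k (E.Free b) :=
  inferInstanceAs (Module k (_ ⧸ E.isoRelations b))

open Classical in
/-- The structure map `E[G] → FE[I;J]`. -/
noncomputable def ofGraph {k : Type u} [Field k] {L : Type} (E : SBimodule k L) {b : Profile L}
    (G : OGraph b) : (⨂[k] v, E.carrier (G.c v)) →ₗ[k] E.Free b :=
  (E.isoRelations b).mkQ.comp
    (DirectSum.lof k (OGraph b) (fun G => ⨂[k] v, E.carrier (G.c v)) G)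

theorem ofGraph_iso {k : Type u} [Field k] {L : Type} (E : SBimodule k L) {b : Profile L}
    {G G' : OGraph b} (e : G.Iso G') (y : ∀ v', E.carrier (G'.c v')) :
    E.ofGraph G (PiTensorProduct.tprod k fun v =>
        cast (congrArg E.carrier (e.nbh v).symm) (y (e.s v))) =
      E.ofGraph G' (PiTensorProduct.tprod k fun v' => E.ρ _ (e.θ v') (y v')) :=
  (Submodule.Quotient.eq _).2 (Submodule.subset_span ⟨G, G', e, y, rfl⟩)

theorem free_hom_ext {k : Type u} [Field k] {L : Type} {E : SBimodule k L} {b : Profile L}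
    {M : Type u} [AddCommGroup M] [Module k M] {f g : E.Free b →ₗ[k] M}
    (h : ∀ (G : OGraph b) (x : ∀ v, E.carrier (G.c v)),
      f (E.ofGraph G (PiTensorProduct.tprod k x)) = g (E.ofGraph G (PiTensorProduct.tprod k x))) :
    f = g := by
  classical
  refine Submodule.linearMap_qext _ (DirectSum.linearMap_ext k fun G => ?_)
  refine PiTensorProduct.ext (MultilinearMap.ext fun x => ?_)
  convert h G x using 1 <;> simp [ofGraph] <;> congr!

open Classical in
/-- The universal property of the colimit. -/
noncomputable def freeDesc {k : Type u} [Field k] {L : Type} (E : SBimodule k L) {b : Profile L}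
    {M : Type u} [AddCommGroup M] [Module k M]
    (f : ∀ G : OGraph b, (⨂[k] v, E.carrier (G.c v)) →ₗ[k] M)
    (hf : ∀ (G G' : OGraph b) (e : G.Iso G') (y : ∀ v', E.carrier (G'.c v')),
      f G (PiTensorProduct.tprod k fun v =>
          cast (congrArg E.carrier (e.nbh v).symm) (y (e.s v))) =
        f G' (PiTensorProduct.tprod k fun v' => E.ρ _ (e.θ v') (y v'))) :
    E.Free b →ₗ[k] M :=
  (E.isoRelations b).liftQ (DirectSum.toModule k _ _ f) <| by
    refine Submodule.span_le.2 ?_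
    rintro _ ⟨G, G', e, y, rfl⟩
    simp only [SetLike.mem_coe, LinearMap.mem_ker, map_sub, DirectSum.toModule_lof]
    rw [hf, sub_self]

theorem freeDesc_ofGraph {k : Type u} [Field k] {L : Type} (E : SBimodule k L) {b : Profile L}
    {M : Type u} [AddCommGroup M] [Module k M]
    (f : ∀ G : OGraph b, (⨂[k] v, E.carrier (G.c v)) →ₗ[k] M) (hf) (G : OGraph b)
    (x : ⨂[k] v, E.carrier (G.c v)) : E.freeDesc f hf (E.ofGraph G x) = f G x := by
  classical
  exact DirectSum.toModule_lof (φ := f) k G x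

/-- The map `FE[I;J] → FE[I;J]` that permutes the boundary labels of graphs. -/
noncomputable def relabelMap {k : Type u} [Field k] {L : Type} (E : SBimodule k L) {b : Profile L}
    (g : LabelGroup b) : E.Free b →ₗ[k] E.Free b :=
  E.freeDesc (fun G => E.ofGraph (G.relabel g)) fun _ _ e y => E.ofGraph_iso (e.relabel g) y

theorem relabelMap_ofGraph {k : Type u} [Field k] {L : Type} (E : SBimodule k L) {b : Profile L}
    (g : LabelGroup b) (G : OGraph b) (x : ⨂[k] v, E.carrier (G.c v)) :
    E.relabelMap g (E.ofGraph G x) = E.ofGraph (G.relabel g) x :=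
  E.freeDesc_ofGraph _ _ G x

/-- The `𝒮`-bimodule `FE`: permutations of the labels act on the boundary labels of graphs. -/
noncomputable def freeBimodule {k : Type u} [Field k] {L : Type} (E : SBimodule k L) :
    SBimodule k L where
  carrier := E.Free
  ρ b :=
    { toFun := E.relabelMap
      map_one' := by
        refine free_hom_ext fun G x => (E.relabelMap_ofGraph 1 G _).trans ?_
        obtain ⟨r, c, n, G⟩ := G
        change E.ofGraph ⟨r, c, n, G.relabel 1⟩ _ = E.ofGraph ⟨r, c, n, G⟩ _
        rw [FlagGraph.relabel_one]
      map_mul' := fun g h => by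
        refine free_hom_ext fun G x => (E.relabelMap_ofGraph (g * h) G _).trans ?_
        refine Eq.trans ?_ ((congrArg (E.relabelMap g) (E.relabelMap_ofGraph h G _)).trans
          (E.relabelMap_ofGraph g (G.relabel h) _)).symm
        obtain ⟨r, c, n, G⟩ := G
        change E.ofGraph ⟨r, c, n, G.relabel (g * h)⟩ _ =
          E.ofGraph ⟨r, c, n, (G.relabel h).relabel g⟩ _
        rw [FlagGraph.relabel_mul] }

theorem hom_cast {k : Type u} [Field k] {L : Type} {E E' : SBimodule k L} (f : E ⟶ E')
    {b b' : Profile L} (h : b = b') (x : E.carrier b) :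
    f.hom b' (cast (congrArg E.carrier h) x) = cast (congrArg E'.carrier h) (f.hom b x) := by
  subst h
  rfl

/-- The map `FE[I;J] → FE'[I;J]` that applies `f` to all decorations. -/
noncomputable def freeMap {k : Type u} [Field k] {L : Type} {E E' : SBimodule k L} (f : E ⟶ E')
    (b : Profile L) : E.Free b →ₗ[k] E'.Free b :=
  E.freeDesc (fun G => (E'.ofGraph G).comp (PiTensorProduct.map fun v => f.hom (G.c v)))
    fun G G' e y => by
      simp only [LinearMap.comp_apply, PiTensorProduct.map_tprod, f.equivariant]
      exact (congrArg (fun z => E'.ofGraph G (PiTensorProduct.tprod k z)) (funext fun v =>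
        hom_cast f (e.nbh v).symm (y (e.s v)))).trans (E'.ofGraph_iso e fun v' => f.hom _ (y v'))

theorem freeMap_ofGraph {k : Type u} [Field k] {L : Type} {E E' : SBimodule k L} (f : E ⟶ E')
    {b : Profile L} (G : OGraph b) (x : ∀ v, E.carrier (G.c v)) :
    freeMap f b (E.ofGraph G (PiTensorProduct.tprod k x)) =
      E'.ofGraph G (PiTensorProduct.tprod k fun v => f.hom _ (x v)) := by
  rw [freeMap, freeDesc_ofGraph, LinearMap.comp_apply, PiTensorProduct.map_tprod]

/-- The endofunctor `F` of the category of `𝒮`-bimodules. -/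
noncomputable def freeFunctor (k : Type u) [Field k] (L : Type) : SBimodule k L ⥤ SBimodule k L where
  obj E := E.freeBimodule
  map {E E'} f :=
    { hom := freeMap f
      equivariant := fun b g x => by
        refine LinearMap.congr_fun (f := (freeMap f b).comp (E.relabelMap g))
          (g := (E'.relabelMap g).comp (freeMap f b)) (free_hom_ext fun G x => ?_) x
        rw [LinearMap.comp_apply, LinearMap.comp_apply, relabelMap_ofGraph, freeMap_ofGraph,
          relabelMap_ofGraph]
        exact freeMap_ofGraph f (G.relabel g) x }
  map_id E := Hom.ext (funext fun b => free_hom_ext fun G x => freeMap_ofGraph (𝟙 E) G x)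
  map_comp f g := Hom.ext (funext fun b => free_hom_ext fun G x =>
    (freeMap_ofGraph (f ≫ g) G x).trans ((congrArg (freeMap g b) (freeMap_ofGraph f G x)).trans
      (freeMap_ofGraph g G _)).symm)

end SBimodule

/-- The graph substitution monad: the endofunctor `F` with a monad structure whose unit sends a
vector `x` to the corolla decorated by `x`, and whose multiplication substitutes the decorating
graphs into the vertices that they decorate.  As the displayed elements span, there is at most one
such structure. -/
structure GraphSubstitutionMonad (k : Type u) [Field k] (L : Type) where
  η : 𝟭 (SBimodule k L) ⟶ SBimodule.freeFunctor k L
  μ : SBimodule.freeFunctor k L ⋙ SBimodule.freeFunctor k L ⟶ SBimodule.freeFunctor k L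
  η_apply : ∀ (E : SBimodule k L) (b : Profile L) (x : E.carrier b),
    (η.app E).hom b x = E.ofGraph (OGraph.corolla b) (PiTensorProduct.tprod k fun _ => x)
  μ_apply : ∀ (E : SBimodule k L) (b : Profile L) (G : OGraph b) (H : ∀ v, OGraph (G.c v))
    (x : ∀ v w, E.carrier ((H v).c w)),
    (μ.app E).hom b (E.freeBimodule.ofGraph G
        (PiTensorProduct.tprod k fun v => E.ofGraph (H v) (PiTensorProduct.tprod k (x v)))) =
      E.ofGraph (G.subst H) (PiTensorProduct.tprod k fun m =>
        x (finSigmaFinEquiv.symm m).1 (finSigmaFinEquiv.symm m).2)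
  assoc : ∀ E, (SBimodule.freeFunctor k L).map (μ.app E) ≫ μ.app E =
    μ.app ((SBimodule.freeFunctor k L).obj E) ≫ μ.app E
  left_unit : ∀ E, η.app ((SBimodule.freeFunctor k L).obj E) ≫ μ.app E = 𝟙 _
  right_unit : ∀ E, (SBimodule.freeFunctor k L).map (η.app E) ≫ μ.app E = 𝟙 _

/-- The underlying monad. -/
noncomputable def GraphSubstitutionMonad.monad {k : Type u} [Field k] {L : Type}
    (T : GraphSubstitutionMonad k L) : Monad (SBimodule k L) where
  toFunctor := SBimodule.freeFunctor k L
  η := T.η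
  μ := T.μ
  assoc := T.assoc
  left_unit := T.left_unit
  right_unit := T.right_unit

/-! ## Graphs and wiring diagrams -/

/-- The wiring diagram `Φ(G)`: `Aᵢ^out = out(vᵢ)`, `Aᵢ^in = in(vᵢ)` for the input circles,
`A₀^out = in(G)`, `A₀^in = out(G)`, the matching is given by the edges of `G`, read on labels, and
the circles are the free loops of `G`. -/
noncomputable def OGraph.toWiringDiagram {L : Type} {b : Profile L} (G : OGraph b) :
    WiringDiagram (fun v => (G.c v).swap) b.swap where
  p := ((G.graph.vertexLabel Prod.snd G.graph.lam_out).sumCongr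
      (G.graph.boundaryLabel G.graph.beta_in)).symm.trans <| G.graph.edge.trans <|
    (G.graph.vertexLabel Prod.fst G.graph.lam_in).sumCongr
      (G.graph.boundaryLabel G.graph.beta_out)
  l := Nat.card G.graph.LoopFlag / 2

/-- The graph `Ψ(D)`: its flags at vertices are the labels on the input circles of `D`, its edges are
given by the matching of `D`, and it has one free loop, with two flags, for every circle of `D`. -/
noncomputable def WiringDiagram.toGraph {L : Type} {r : ℕ} {c : Fin r → Profile L}
    {c₀ : Profile L} (D : WiringDiagram c c₀) : OGraph c₀.swap :=
  OGraph.ofFlagGraph (c := fun v => (c v).swap) <|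
    FlagGraph.ofEdges (Equiv.refl _) (Equiv.refl _) (Equiv.refl _) (Equiv.refl _) D.p
      (Prod.map id not : Fin D.l × Bool → Fin D.l × Bool) (fun ⟨i, ε⟩ => by cases ε <;> rfl) (fun ⟨i, ε⟩ h => by
        simpa using congrArg Prod.snd h)

/-! ## Gluing in stages -/

section Gluing

variable {X Y Z : Type}

/-! A strict isomorphism class of graphs and a wiring diagram carry the same data: a bijection from
beginning points to ending points, and a number of circles. The matching `edge` of a graph, read on
labels, is the bijection of its diagram. Conversely, an equality of diagrams gives bijections of the
flags of each kind that fit together to an isomorphism (`FlagGraph.exists_isIso`), whence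
`OGraph.strictIso_iff`. Under this dictionary the corolla is the identity diagram and graph
substitution is the simultaneous composite `WiringDiagram.multi` (`FlagGraph.toDiagram_subst`), so
that every question about graphs becomes one about diagrams.

The geometric content is that strands may be glued in stages: the final matching is the same and the
numbers of created circles add up. This is isolated in `IsStage`, with the consequences
`IsStage.glue_eq` and `IsStage.card_glueLoop`. Gluing `D`, `D'` and further diagrams in two
different orders gives the one associativity law that needs geometry, `multi_nestDiagram`. For
decorated diagrams up to renumbering (`DecClass`) it says that grafting respects partial composition
(`graft_insertInput`), so decorated diagrams form an algebra in sets over the operad. In any such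
algebra the axioms for partial composites already determine the simultaneous ones
(`SetAlgebra.eval_graft`); applied to the free algebra this yields full associativity of grafting
(`graft_multi`). Decorating every circle by its own number turns equality of classes into equality
of numbered diagrams, and this compares `D ∘ᵢ D'` with substitution at a vertex.

Linearly, `Free` is spanned by the classes `gen q` of decorated diagrams, and a function of `q`
extends to a linear map once it is multilinear in the decorations and turns a relabelling of an
input circle into the action on its decoration (`exists_linearMap_gen`). Hence grafting extends to
multilinear maps `freeAct`, and `Free` is itself an algebra over the operad. Every linear algebra
has a structure map `LinAlgebra.str`, evaluation of decorated diagrams; that of the free algebra is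
the multiplication of the monad. The associativity laws of the monad and of its algebras are both
`LinAlgebra.str_str`, which on generators is `eval_graft`. Conversely the laws of a monad algebra,
read on generators, are the operad axioms. The symmetric group actions are no additional datum of a
circuit algebra: they are the actions of the diagrams `permDiag`. Neither passage changes the
underlying spaces, so unit and counit of the equivalence are identity maps on them. -/

theorem StrandStep.right_unique {p : X ⊕ Z ≃ Y ⊕ Z} {s t t' : X ⊕ Z} (h : StrandStep p s t)
    (h' : StrandStep p s t') : t = t' := by
  obtain ⟨z, hz, rfl⟩ := h
  obtain ⟨w, hw, rfl⟩ := h'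
  exact congrArg Sum.inr (Sum.inr_injective (hz.symm.trans hw))

theorem StrandEnds.of_step {p : X ⊕ Z ≃ Y ⊕ Z} {s t : X ⊕ Z} {y : Y} (h : StrandStep p s t)
    (h' : StrandEnds p t y) : StrandEnds p s y :=
  let ⟨u, hu, hy⟩ := h'
  ⟨u, hu.head h, hy⟩

theorem StrandEnds.of_steps {p : X ⊕ Z ≃ Y ⊕ Z} {s t : X ⊕ Z} {y : Y}
    (h : Relation.ReflTransGen (StrandStep p) s t) (h' : StrandEnds p t y) : StrandEnds p s y :=
  let ⟨u, hu, hy⟩ := h'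
  ⟨u, h.trans hu, hy⟩

theorem StrandEnds.step {p : X ⊕ Z ≃ Y ⊕ Z} {s t : X ⊕ Z} {y : Y} (h : StrandStep p s t)
    (h' : StrandEnds p s y) : StrandEnds p t y := by
  obtain ⟨u, hu, hy⟩ := h'
  rcases Relation.ReflTransGen.cases_head hu with rfl | ⟨v, hv, hvu⟩
  · obtain ⟨z, hz, -⟩ := h
    exact absurd (hy.symm.trans hz) Sum.inl_ne_inr
  · obtain rfl := h.right_unique hv
    exact ⟨u, hvu, hy⟩

theorem StrandEnds.right_unique {p : X ⊕ Z ≃ Y ⊕ Z} {s : X ⊕ Z} {y y' : Y}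
    (h : StrandEnds p s y) (h' : StrandEnds p s y') : y = y' := by
  obtain ⟨u, hu, hy⟩ := h
  induction hu using Relation.ReflTransGen.head_induction_on with
  | refl =>
    obtain ⟨v, hv, hy'⟩ := h'
    rcases Relation.ReflTransGen.cases_head hv with rfl | ⟨w, ⟨z, hz, -⟩, -⟩
    · exact Sum.inl_injective (hy.symm.trans hy')
    · exact absurd (hy.symm.trans hz) Sum.inl_ne_inr
  | head hab _ ih => exact ih (h'.step hab)

theorem strandEnds_of_eq_inl {p : X ⊕ Z ≃ Y ⊕ Z} {s : X ⊕ Z} {y : Y} (h : p s = .inl y) :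
    StrandEnds p s y :=
  ⟨s, .refl, h⟩

theorem strandEnds_of_eq_inr {p : X ⊕ Z ≃ Y ⊕ Z} {s : X ⊕ Z} {y : Y} {z : Z} (h : p s = .inr z)
    (h' : StrandEnds p (.inr z) y) : StrandEnds p s y :=
  h'.of_step ⟨z, h, rfl⟩

theorem strandEnds_glue [Finite X] [Finite Y] [Finite Z] (p : X ⊕ Z ≃ Y ⊕ Z) (x : X) :
    StrandEnds p (.inl x) (glue p x) :=
  (StrandEnds.exists p x).choose_spec

theorem glue_eq_iff [Finite X] [Finite Y] [Finite Z] {p : X ⊕ Z ≃ Y ⊕ Z} {x : X} {y : Y} :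
    glue p x = y ↔ StrandEnds p (.inl x) y :=
  ⟨fun h => h ▸ strandEnds_glue p x, fun h => (strandEnds_glue p x).right_unique h⟩

theorem card_glueLoop_eq_zero {p : X ⊕ Z ≃ Y ⊕ Z} (h : ∀ z, ∃ y, StrandEnds p (.inr z) y) :
    Nat.card (GlueLoop p) = 0 := by
  have : IsEmpty (GlueLoop p) := ⟨fun q => Quot.ind (β := fun _ => False) (fun z => z.2 (h z.1)) q⟩
  exact Nat.card_of_isEmpty

/-- The quotient identifies points that are one gluing apart, so a path has to be cut into steps
through points of `GlueLoop`. This is possible because a strand that ends still ends one step later: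
if the last point of the path never ends, neither do the earlier ones. -/
theorem glueLoop_mk_eq {p : X ⊕ Z ≃ Y ⊕ Z} {z w : Z}
    (h : Relation.ReflTransGen (StrandStep p) (.inr z) (.inr w))
    (hz : ¬ ∃ y, StrandEnds p (.inr z) y) (hw : ¬ ∃ y, StrandEnds p (.inr w) y) :
    (Quot.mk _ ⟨z, hz⟩ : GlueLoop p) = Quot.mk _ ⟨w, hw⟩ := by
  suffices H : ∀ s, Relation.ReflTransGen (StrandStep p) (.inr z) s → ∀ w, s = .inr w →
      ∀ hw : ¬ ∃ y, StrandEnds p (.inr w) y,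
        (Quot.mk _ ⟨z, hz⟩ : GlueLoop p) = Quot.mk _ ⟨w, hw⟩ from H _ h w rfl hw
  intro s hs
  induction hs with
  | refl =>
    intro w hw' hw
    obtain rfl := Sum.inr_injective hw'
    rfl
  | @tail b c hzb hbc ih =>
    rintro w rfl hw
    rcases b with x | v
    -- A step always arrives at a glued point, so a path that starts at one never visits `X`.
    · rcases Relation.ReflTransGen.cases_tail hzb with h | ⟨d, _, ⟨e, _, he⟩⟩
      · exact absurd h Sum.inl_ne_inr
      · exact absurd he Sum.inl_ne_inr
    · have hv : ¬ ∃ y, StrandEnds p (.inr v) y := fun ⟨y, hy⟩ => hw ⟨y, hy.step hbc⟩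
      refine (ih v rfl hv).trans (Quot.sound ?_)
      obtain ⟨e, he, he'⟩ := hbc
      exact he.trans (congrArg Sum.inr (Sum.inr_injective he').symm)

end Gluing

/-- `IsStage T q p a b ζ iX iY` says that gluing the strands `T` can be done in two stages: first a
part `p` of the strands is glued along `Z₂`, and then the resulting strands, together with the
remaining ones, form the strands `q`, which are glued along `Z₁`. -/
structure IsStage {X Y Z₁ X₂ Y₂ Z₂ XT YT ZT : Type} [Finite X₂] [Finite Y₂] [Finite Z₂]
    (T : XT ⊕ ZT ≃ YT ⊕ ZT) (q : X ⊕ Z₁ ≃ Y ⊕ Z₁) (p : X₂ ⊕ Z₂ ≃ Y₂ ⊕ Z₂)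
    (a : X ≃ XT) (b : Y ≃ YT) (ζ : Z₁ ⊕ Z₂ ≃ ZT) (iX : X₂ → X ⊕ Z₁) (iY : Y₂ → Y ⊕ Z₁) :
    Prop where
  inner : ∀ s, T (Sum.elim (fun x => (iX x).map a (ζ ∘ .inl)) (fun z => .inr (ζ (.inr z))) s) =
    Sum.elim (fun y => (iY y).map b (ζ ∘ .inl)) (fun z => .inr (ζ (.inr z))) (p s)
  glued : ∀ x, q (iX x) = iY (glue p x)
  outer : ∀ s, (∃ x, s = iX x) ∨ T (s.map a (ζ ∘ .inl)) = (q s).map b (ζ ∘ .inl)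

namespace IsStage

variable {X Y Z₁ X₂ Y₂ Z₂ XT YT ZT : Type} [Finite X₂] [Finite Y₂] [Finite Z₂]
  {T : XT ⊕ ZT ≃ YT ⊕ ZT} {q : X ⊕ Z₁ ≃ Y ⊕ Z₁} {p : X₂ ⊕ Z₂ ≃ Y₂ ⊕ Z₂}
  {a : X ≃ XT} {b : Y ≃ YT} {ζ : Z₁ ⊕ Z₂ ≃ ZT} {iX : X₂ → X ⊕ Z₁} {iY : Y₂ → Y ⊕ Z₁}

/-- With `a`, `b`, `ζ` naming points in `T`, the field `inner` says that strands of `p` are strands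
of `T`, `glued` that the strands of `q` beginning in the image of `iX` are the glued strands of `p`,
and `outer` that the other strands of `q` are strands of `T`. So paths of `p` are paths of `T` as
they stand. -/
theorem inner_steps (h : IsStage T q p a b ζ iX iY) {s t : X₂ ⊕ Z₂}
    (hst : Relation.ReflTransGen (StrandStep p) s t) :
    Relation.ReflTransGen (StrandStep T)
      (Sum.elim (fun x => (iX x).map a (ζ ∘ .inl)) (fun z => .inr (ζ (.inr z))) s)
      (Sum.elim (fun x => (iX x).map a (ζ ∘ .inl)) (fun z => .inr (ζ (.inr z))) t) := by
  induction hst with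
  | refl => exact .refl
  | @tail c d _ hcd ih =>
    obtain ⟨z, hz, rfl⟩ := hcd
    exact ih.tail ⟨ζ (.inr z), by rw [h.inner, hz]; rfl, rfl⟩

/-- A strand of `q` is a single strand of `T` or a glued strand of `p`, and the latter unfolds to a
path of `T` with the same end. -/
theorem outer_path (h : IsStage T q p a b ζ iX iY) (s : X ⊕ Z₁) :
    ∃ t, Relation.ReflTransGen (StrandStep T) (s.map a (ζ ∘ .inl)) t ∧
      T t = (q s).map b (ζ ∘ .inl) := by
  rcases h.outer s with ⟨x, rfl⟩ | hs
  · obtain ⟨t, ht, hy⟩ := strandEnds_glue p x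
    refine ⟨_, h.inner_steps ht, ?_⟩
    rw [h.inner, hy, h.glued]
    rfl
  · exact ⟨_, .refl, hs⟩

theorem outer_steps (h : IsStage T q p a b ζ iX iY) {s t : X ⊕ Z₁}
    (hst : Relation.ReflTransGen (StrandStep q) s t) :
    Relation.ReflTransGen (StrandStep T) (s.map a (ζ ∘ .inl)) (t.map a (ζ ∘ .inl)) := by
  induction hst with
  | refl => exact .refl
  | @tail c d _ hcd ih =>
    obtain ⟨z, hz, rfl⟩ := hcd
    obtain ⟨t, ht, ht'⟩ := h.outer_path c
    exact (ih.trans ht).tail ⟨ζ (.inl z), by rw [ht', hz]; rfl, rfl⟩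

theorem ends (h : IsStage T q p a b ζ iX iY) {s : X ⊕ Z₁} {y : Y} (hs : StrandEnds q s y) :
    StrandEnds T (s.map a (ζ ∘ .inl)) (b y) := by
  obtain ⟨t, ht, hy⟩ := hs
  obtain ⟨u, hu, hu'⟩ := h.outer_path t
  exact ⟨u, (h.outer_steps ht).trans hu, by rw [hu', hy]; rfl⟩

/-- A converse of `outer_steps`: walking along `T`, one is always at a point that `q` visits too, or
part of the way along a glued strand of `p` whose beginning `q` visits. Leaving such a strand
completes one step of `q`. -/
theorem trace (h : IsStage T q p a b ζ iX iY) {s : X ⊕ Z₁} {u : XT ⊕ ZT}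
    (hu : Relation.ReflTransGen (StrandStep T) (s.map a (ζ ∘ .inl)) u) :
    (∃ t, u = t.map a (ζ ∘ .inl) ∧ Relation.ReflTransGen (StrandStep q) s t) ∨
      ∃ x w, u = Sum.elim (fun x => (iX x).map a (ζ ∘ .inl)) (fun z => .inr (ζ (.inr z))) w ∧
        Relation.ReflTransGen (StrandStep p) (.inl x) w ∧
        Relation.ReflTransGen (StrandStep q) s (iX x) := by
  have inner_case : ∀ x w z, Relation.ReflTransGen (StrandStep p) (.inl x) w →
      Relation.ReflTransGen (StrandStep q) s (iX x) →
      T (Sum.elim (fun x => (iX x).map a (ζ ∘ .inl)) (fun z => .inr (ζ (.inr z))) w) = .inr z →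
      (∃ t, .inr z = t.map a (ζ ∘ .inl) ∧ Relation.ReflTransGen (StrandStep q) s t) ∨
      ∃ x w, .inr z = Sum.elim (fun x => (iX x).map a (ζ ∘ .inl)) (fun z => .inr (ζ (.inr z))) w ∧
        Relation.ReflTransGen (StrandStep p) (.inl x) w ∧
        Relation.ReflTransGen (StrandStep q) s (iX x) := by
    intro x w z hw hs hz
    rw [h.inner] at hz
    rcases hp : p w with y | w'
    · have hg : glue p x = y := glue_eq_iff.2 ⟨w, hw, hp⟩
      rw [hp] at hz
      have hq := h.glued x
      rw [hg] at hq
      rcases hi : iY y with y' | z₁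
      · simp [hi] at hz
      · have hz' : z = ζ (.inl z₁) := by simpa [hi] using hz.symm
        exact .inl ⟨.inr z₁, by rw [hz']; rfl, hs.tail ⟨z₁, by rw [hq, hi], rfl⟩⟩
    · rw [hp] at hz
      have hz' : z = ζ (.inr w') := by simpa using hz.symm
      exact .inr ⟨x, .inr w', by rw [hz']; rfl, hw.tail ⟨w', hp, rfl⟩, hs⟩
  induction hu with
  | refl => exact .inl ⟨s, rfl, .refl⟩
  | @tail c d _ hcd ih =>
    obtain ⟨z, hz, rfl⟩ := hcd
    rcases ih with ⟨t, rfl, ht⟩ | ⟨x, w, rfl, hw, hs⟩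
    · rcases h.outer t with ⟨x, rfl⟩ | ho
      · exact inner_case x (.inl x) z .refl ht hz
      · rw [ho] at hz
        rcases hq : q t with y | z₁
        · simp [hq] at hz
        · have hz' : z = ζ (.inl z₁) := by simpa [hq] using hz.symm
          exact .inl ⟨.inr z₁, by rw [hz']; rfl, ht.tail ⟨z₁, hq, rfl⟩⟩
    · exact inner_case x w z hw hs hz

theorem of_ends (h : IsStage T q p a b ζ iX iY) {s : X ⊕ Z₁} {y : YT}
    (hs : StrandEnds T (s.map a (ζ ∘ .inl)) y) : ∃ y', StrandEnds q s y' := by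
  obtain ⟨u, hu, hy⟩ := hs
  have inner_case : ∀ x w, Relation.ReflTransGen (StrandStep p) (.inl x) w →
      Relation.ReflTransGen (StrandStep q) s (iX x) →
      T (Sum.elim (fun x => (iX x).map a (ζ ∘ .inl)) (fun z => .inr (ζ (.inr z))) w) = .inl y →
      ∃ y', StrandEnds q s y' := by
    intro x w hw hs hz
    rw [h.inner] at hz
    rcases hp : p w with y₂ | w'
    · have hg : glue p x = y₂ := glue_eq_iff.2 ⟨w, hw, hp⟩
      rw [hp] at hz
      have hq := h.glued x
      rw [hg] at hq
      rcases hi : iY y₂ with y' | z₁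
      · exact ⟨y', iX x, hs, by rw [hq, hi]⟩
      · simp [hi] at hz
    · rw [hp] at hz
      simp at hz
  rcases h.trace hu with ⟨t, rfl, ht⟩ | ⟨x, w, rfl, hw, hs⟩
  · rcases h.outer t with ⟨x, rfl⟩ | ho
    · exact inner_case x (.inl x) .refl ht hy
    · rw [ho] at hy
      rcases hq : q t with y' | z₁
      · exact ⟨y', t, ht, hq⟩
      · simp [hq] at hy
  · exact inner_case x w hw hs hy

/-- A path of `T` that starts inside `p` either stays there until it ends, or leaves, and it can
leave only where a strand of `p` ends. -/
theorem of_inner_ends (h : IsStage T q p a b ζ iX iY) {s : X₂ ⊕ Z₂} {y : YT}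
    (hs : StrandEnds T
      (Sum.elim (fun x => (iX x).map a (ζ ∘ .inl)) (fun z => .inr (ζ (.inr z))) s) y) :
    ∃ y', StrandEnds p s y' := by
  obtain ⟨u, hu, hy⟩ := hs
  have key : (∃ w, u =
      Sum.elim (fun x => (iX x).map a (ζ ∘ .inl)) (fun z => .inr (ζ (.inr z))) w ∧
        Relation.ReflTransGen (StrandStep p) s w) ∨ ∃ y', StrandEnds p s y' := by
    clear hy
    induction hu with
    | refl => exact .inl ⟨s, rfl, .refl⟩
    | @tail c d _ hcd ih =>
      rcases ih with ⟨w, rfl, hw⟩ | ih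
      · obtain ⟨z, hz, rfl⟩ := hcd
        rw [h.inner] at hz
        rcases hp : p w with y₂ | w'
        · exact .inr ⟨y₂, w, hw, hp⟩
        · rw [hp] at hz
          have hz' : z = ζ (.inr w') := by simpa using hz.symm
          exact .inl ⟨.inr w', by rw [hz']; rfl, hw.tail ⟨w', hp, rfl⟩⟩
      · exact .inr ih
  rcases key with ⟨w, rfl, hw⟩ | key
  · rw [h.inner] at hy
    rcases hp : p w with y₂ | w'
    · exact ⟨y₂, w, hw, hp⟩
    · rw [hp] at hy
      simp at hy
  · exact key

theorem glue_eq [Finite X] [Finite Y] [Finite Z₁] [Finite XT] [Finite YT] [Finite ZT]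
    (h : IsStage T q p a b ζ iX iY) (x : X) : glue T (a x) = b (glue q x) :=
  glue_eq_iff.2 (h.ends (strandEnds_glue q x))

/-- The glued strand of `p` stops at `y` although the strand of `T` goes on for ever, so `y` must be
a point that is glued in the outer stage. -/
theorem exit (h : IsStage T q p a b ζ iX iY) {z : Z₂} {y : Y₂}
    (hy : StrandEnds p (.inr z) y) (hz : ¬ ∃ y, StrandEnds T (.inr (ζ (.inr z))) y) :
    ∃ z₁, iY y = .inr z₁ ∧
      Relation.ReflTransGen (StrandStep T) (.inr (ζ (.inr z))) (.inr (ζ (.inl z₁))) := by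
  obtain ⟨t, ht, hp⟩ := hy
  have h1 := h.inner_steps ht
  have h2 := h.inner t
  rw [hp] at h2
  rcases hi : iY y with y' | z₁
  · refine absurd ⟨b y', _, h1, ?_⟩ hz
    rw [h2]
    simp [hi]
  · refine ⟨z₁, rfl, h1.tail ⟨ζ (.inl z₁), ?_, rfl⟩⟩
    rw [h2]
    simp [hi]

/-- A circle of `T` that passes through `Z₁` is a circle of `q`, and one that stays in `Z₂` is a
circle of `p`. -/
theorem card_glueLoop [Finite Z₁] (h : IsStage T q p a b ζ iX iY) :
    Nat.card (GlueLoop T) = Nat.card (GlueLoop q) + Nat.card (GlueLoop p) := by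
  have n1 : ∀ z, (¬ ∃ y, StrandEnds q (.inr z) y) → ¬ ∃ y, StrandEnds T (.inr (ζ (.inl z))) y :=
    fun z hz ⟨y, hy⟩ => hz (h.of_ends (s := .inr z) hy)
  have n1' : ∀ z, (¬ ∃ y, StrandEnds T (.inr (ζ (.inl z))) y) → ¬ ∃ y, StrandEnds q (.inr z) y :=
    fun z hz ⟨y, hy⟩ => hz ⟨b y, h.ends hy⟩
  have n2 : ∀ z, (¬ ∃ y, StrandEnds p (.inr z) y) → ¬ ∃ y, StrandEnds T (.inr (ζ (.inr z))) y :=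
    fun z hz ⟨y, hy⟩ => hz (h.of_inner_ends (s := .inr z) hy)
  have nstep : ∀ {s t}, Relation.ReflTransGen (StrandStep T) s t → (¬ ∃ y, StrandEnds T s y) →
      ¬ ∃ y, StrandEnds T t y := fun hst hs ⟨y, hy⟩ => hs ⟨y, hy.of_steps hst⟩
  let f : GlueLoop q ⊕ GlueLoop p → GlueLoop T := Sum.elim
    (Quot.lift (fun z => Quot.mk _ ⟨ζ (.inl z.1), n1 z.1 z.2⟩) (by
      rintro ⟨z, hz⟩ ⟨w, hw⟩ hzw
      exact glueLoop_mk_eq (h.outer_steps (.single ⟨w, hzw, rfl⟩)) _ _))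
    (Quot.lift (fun z => Quot.mk _ ⟨ζ (.inr z.1), n2 z.1 z.2⟩) (by
      rintro ⟨z, hz⟩ ⟨w, hw⟩ hzw
      exact glueLoop_mk_eq (h.inner_steps (.single ⟨w, hzw, rfl⟩)) _ _))
  -- The inverse of `f` on points. A point of `Z₁` keeps its circle; a point of `Z₂` is moved
  -- forward to the point of `Z₁` where its strand of `p` ends, and if there is no such end it lies
  -- on a circle of `p`. The value is characterized by its properties because points of `ZT` are
  -- split into `Z₁` and `Z₂` only through `ζ`.
  have hex : ∀ z : {z // ¬ ∃ y, StrandEnds T (.inr z) y}, ∃ c : GlueLoop q ⊕ GlueLoop p,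
      (∀ z₁, z.1 = ζ (.inl z₁) → ∃ hz, c = .inl (Quot.mk _ ⟨z₁, hz⟩)) ∧
      ∀ z₂, z.1 = ζ (.inr z₂) →
        (∀ y, StrandEnds p (.inr z₂) y → ∃ z₁ hz, iY y = .inr z₁ ∧ c = .inl (Quot.mk _ ⟨z₁, hz⟩)) ∧
        ((¬ ∃ y, StrandEnds p (.inr z₂) y) → ∃ hz, c = .inr (Quot.mk _ ⟨z₂, hz⟩)) := by
    rintro ⟨z, hz⟩
    obtain ⟨z | z, rfl⟩ := ζ.surjective z
    · refine ⟨.inl (Quot.mk _ ⟨z, n1' z hz⟩), fun z₁ h1 => ?_, fun z₂ h2 => ?_⟩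
      · obtain rfl : z = z₁ := Sum.inl_injective (ζ.injective h1)
        exact ⟨_, rfl⟩
      · exact absurd (ζ.injective h2) Sum.inl_ne_inr
    · by_cases hy : ∃ y, StrandEnds p (.inr z) y
      · obtain ⟨y, hy⟩ := hy
        obtain ⟨z₁, hz₁, hs⟩ := h.exit hy hz
        refine ⟨.inl (Quot.mk _ ⟨z₁, n1' _ (nstep hs hz)⟩), fun z₁ h1 => ?_, fun z₂ h2 => ?_⟩
        · exact absurd (ζ.injective h1) Sum.inr_ne_inl
        · obtain rfl : z = z₂ := Sum.inr_injective (ζ.injective h2)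
          refine ⟨fun y' hy' => ?_, fun hn => absurd ⟨y, hy⟩ hn⟩
          obtain rfl := hy.right_unique hy'
          exact ⟨z₁, _, hz₁, rfl⟩
      · refine ⟨.inr (Quot.mk _ ⟨z, hy⟩), fun z₁ h1 => ?_, fun z₂ h2 => ?_⟩
        · exact absurd (ζ.injective h1) Sum.inr_ne_inl
        · obtain rfl : z = z₂ := Sum.inr_injective (ζ.injective h2)
          exact ⟨fun y' hy' => absurd ⟨y', hy'⟩ hy, fun _ => ⟨_, rfl⟩⟩
  choose g hg using hex
  have gstep : ∀ z w : {z // ¬ ∃ y, StrandEnds T (.inr z) y}, T (.inr z.1) = .inr w.1 →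
      g z = g w := by
    rintro ⟨z, hz⟩ ⟨w, hw⟩ hzw
    obtain ⟨z | z, rfl⟩ := ζ.surjective z
    · obtain ⟨hz', hgz⟩ := (hg ⟨_, hz⟩).1 z rfl
      rw [hgz]
      have outer_case : T (Sum.map a (ζ ∘ .inl) (.inr z)) = (q (.inr z)).map b (ζ ∘ .inl) →
          Sum.inl (Quot.mk _ ⟨z, hz'⟩) = g ⟨w, hw⟩ := by
        intro ho
        have ho' := hzw.symm.trans ho
        rcases hq : q (.inr z) with y | z₁
        · simp [hq] at ho'
        · have hw' : w = ζ (.inl z₁) := by simpa [hq] using ho'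
          subst hw'
          obtain ⟨hw', hgw⟩ := (hg ⟨_, hw⟩).1 z₁ rfl
          rw [hgw]
          exact congrArg Sum.inl (Quot.sound hq)
      rcases h.outer (.inr z) with ⟨x, hx⟩ | ho
      · have h1 := h.inner (.inl x)
        have h2 := h.glued x
        have h3 := strandEnds_glue p x
        simp only [Sum.elim_inl, ← hx] at h1
        -- Here `z` begins a glued strand of `p`. If that strand has a single piece, `T` and `q`
        -- agree at `z`. Otherwise `T` enters `Z₂`, and `g` moves the point reached forward to the
        -- end of the same glued strand, which is where `q` goes from `z`.
        rcases hp : p (.inl x) with y | z₂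
        · obtain hy : glue p x = y := glue_eq_iff.2 (strandEnds_of_eq_inl hp)
          apply outer_case
          rw [h1, hp, hx, h2, hy]
          rfl
        · have hw' : w = ζ (.inr z₂) := by
            rw [hp] at h1
            have := hzw.symm.trans h1
            simpa using this
          subst hw'
          obtain ⟨z₁, hz₁, hi, hgw⟩ := ((hg ⟨_, hw⟩).2 z₂ rfl).1 (glue p x)
            (h3.step ⟨z₂, hp, rfl⟩)
          rw [hgw]
          refine congrArg Sum.inl (Quot.sound ?_)
          change q (.inr z) = .inr z₁
          rw [hx, h2, hi]
      · exact outer_case ho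
    · have h1 := h.inner (.inr z)
      rcases hp : p (.inr z) with y | z₂
      · obtain ⟨z₁, hz₁, hi, hgz⟩ := ((hg ⟨_, hz⟩).2 z rfl).1 y (strandEnds_of_eq_inl hp)
        have hw' : w = ζ (.inl z₁) := by
          rw [hp] at h1
          have := hzw.symm.trans h1
          simpa [hi] using this
        subst hw'
        obtain ⟨hw', hgw⟩ := (hg ⟨_, hw⟩).1 z₁ rfl
        rw [hgz, hgw]
      · have hw' : w = ζ (.inr z₂) := by
          rw [hp] at h1
          have := hzw.symm.trans h1
          simpa using this
        subst hw'
        by_cases hy : ∃ y, StrandEnds p (.inr z) y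
        · obtain ⟨y, hy⟩ := hy
          obtain ⟨z₁, hz₁, hi, hgz⟩ := ((hg ⟨_, hz⟩).2 z rfl).1 y hy
          obtain ⟨z₁', hz₁', hi', hgw⟩ := ((hg ⟨_, hw⟩).2 z₂ rfl).1 y (hy.step ⟨z₂, hp, rfl⟩)
          obtain rfl : z₁ = z₁' := Sum.inr_injective (hi.symm.trans hi')
          rw [hgz, hgw]
        · obtain ⟨h1, hgz⟩ := ((hg ⟨_, hz⟩).2 z rfl).2 hy
          obtain ⟨h2, hgw⟩ := ((hg ⟨_, hw⟩).2 z₂ rfl).2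
            fun ⟨y, hy'⟩ => hy ⟨y, strandEnds_of_eq_inr hp hy'⟩
          rw [hgz, hgw]
          exact congrArg Sum.inr (Quot.sound hp)
  rw [← Nat.card_sum]
  refine (Nat.card_congr (Equiv.ofBijective f ⟨?_, ?_⟩)).symm
  · refine Function.LeftInverse.injective (g := Quot.lift g gstep) ?_
    rintro (c | c)
    · induction c using Quot.ind with | mk z =>
      obtain ⟨hz, hgz⟩ := (hg ⟨_, n1 _ z.2⟩).1 z.1 rfl
      exact hgz
    · induction c using Quot.ind with | mk z =>
      obtain ⟨hz, hgz⟩ := ((hg ⟨_, n2 _ z.2⟩).2 z.1 rfl).2 z.2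
      exact hgz
  · intro c
    induction c using Quot.ind with | mk z =>
    obtain ⟨z, hz⟩ := z
    obtain ⟨z | z, rfl⟩ := ζ.surjective z
    · exact ⟨.inl (Quot.mk _ ⟨z, n1' z hz⟩), rfl⟩
    · by_cases hy : ∃ y, StrandEnds p (.inr z) y
      · obtain ⟨y, hy⟩ := hy
        obtain ⟨z₁, hz₁, hs⟩ := h.exit hy hz
        exact ⟨.inl (Quot.mk _ ⟨z₁, n1' _ (nstep hs hz)⟩), (glueLoop_mk_eq hs _ _).symm⟩
      · exact ⟨.inr (Quot.mk _ ⟨z, hy⟩), rfl⟩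

end IsStage

/-! ### Invariance of gluing under renaming of points -/

section Transport

variable {X Y Z X' Y' Z' : Type}

/-- A renaming of points is a stage whose inner part is empty, so that the invariance of the
matching and of the number of circles are special cases of the results on stages. -/
theorem isStage_transport {p : X ⊕ Z ≃ Y ⊕ Z} {p' : X' ⊕ Z' ≃ Y' ⊕ Z'} (a : X ≃ X') (b : Y ≃ Y')
    (ζ : Z ≃ Z') (h : ∀ s, p' (s.map a ζ) = (p s).map b ζ) :
    IsStage p' p (Equiv.refl (Empty ⊕ Empty)) a b ((Equiv.sumEmpty Z Empty).trans ζ)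
      Empty.elim Empty.elim where
  inner := by rintro (x | x) <;> exact x.elim
  glued x := x.elim
  outer s := .inr (h s)

theorem glue_transport [Finite X] [Finite Y] [Finite Z] [Finite X'] [Finite Y'] [Finite Z']
    {p : X ⊕ Z ≃ Y ⊕ Z} {p' : X' ⊕ Z' ≃ Y' ⊕ Z'} (a : X ≃ X') (b : Y ≃ Y')
    (ζ : Z ≃ Z') (h : ∀ s, p' (s.map a ζ) = (p s).map b ζ) (x : X) :
    glue p' (a x) = b (glue p x) :=
  (isStage_transport a b ζ h).glue_eq x

theorem card_glueLoop_transport [Finite Z] {p : X ⊕ Z ≃ Y ⊕ Z} {p' : X' ⊕ Z' ≃ Y' ⊕ Z'}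
    (a : X ≃ X') (b : Y ≃ Y') (ζ : Z ≃ Z') (h : ∀ s, p' (s.map a ζ) = (p s).map b ζ) :
    Nat.card (GlueLoop p') = Nat.card (GlueLoop p) := by
  rw [(isStage_transport a b ζ h).card_glueLoop, card_glueLoop_eq_zero (p := Equiv.refl (Empty ⊕ Empty)) (fun z => z.elim), add_zero]

end Transport

/-! ## Simultaneous composition of wiring diagrams -/

namespace WiringDiagram

variable {L : Type}

section Basic

variable {ι ι' ι'' : Type} {c : ι → Profile L} {c₀ : Profile L}

/-- The bijection of points induced by a renumbering `e` of the circles. -/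
def reindexPoints (c : ι → Profile L) (q : Profile L → Finset L) (A : Type) (e : ι' ≃ ι) :
    (Σ i, q (c (e i))) ⊕ A ≃ (Σ i, q (c i)) ⊕ A :=
  (Equiv.sigmaCongrLeft (β := fun i => (q (c i) : Type)) e).sumCongr (Equiv.refl _)

theorem eq_reindex {D : WiringDiagram c c₀} {e : ι' ≃ ι}
    {D' : WiringDiagram (fun i => c (e i)) c₀}
    (h : ∀ s, D.p (reindexPoints c Prod.fst c₀.2 e s) = reindexPoints c Prod.snd c₀.1 e (D'.p s))
    (hl : D'.l = D.l) : D' = D.reindex e := by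
  refine WiringDiagram.ext (Equiv.ext fun s => ?_) hl
  exact ((reindexPoints c Prod.snd c₀.1 e).eq_symm_apply).2 (h s).symm

theorem p_reindexPoints (D : WiringDiagram c c₀) (e : ι' ≃ ι) (s) :
    D.p (reindexPoints c Prod.fst c₀.2 e s) =
      reindexPoints c Prod.snd c₀.1 e ((D.reindex e).p s) :=
  ((reindexPoints c Prod.snd c₀.1 e).symm_apply_eq (x := D.p (reindexPoints c Prod.fst c₀.2 e s))).1
    rfl

theorem reindexPoints_refl (q : Profile L → Finset L) (A : Type) (s) :
    reindexPoints c q A (Equiv.refl ι) s = s := by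
  rcases s with ⟨i, a⟩ | a <;> rfl

theorem reindexPoints_trans (q : Profile L → Finset L) (A : Type) (e : ι' ≃ ι) (f : ι'' ≃ ι') (s) :
    reindexPoints c q A (f.trans e) s =
      reindexPoints c q A e (reindexPoints (fun i => c (e i)) q A f s) := by
  rcases s with ⟨i, a⟩ | a <;> rfl

theorem reindex_refl (D : WiringDiagram c c₀) : D.reindex (Equiv.refl ι) = D := by
  refine (eq_reindex (D' := D) (e := Equiv.refl ι) (fun s => ?_) rfl).symm
  exact (congrArg D.p (reindexPoints_refl _ _ s)).trans (reindexPoints_refl _ _ _).symm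

theorem reindex_reindex (D : WiringDiagram c c₀) (e : ι' ≃ ι) (f : ι'' ≃ ι') :
    (D.reindex e).reindex f = D.reindex (f.trans e) := by
  refine eq_reindex (e := f.trans e) (D' := (D.reindex e).reindex f) (fun s => ?_) rfl
  have h1 := p_reindexPoints (D.reindex e) f s
  have h2 := p_reindexPoints D e (reindexPoints (fun i => c (e i)) Prod.fst c₀.2 f s)
  exact (congrArg D.p (reindexPoints_trans _ _ e f s)).trans (h2.trans
    ((congrArg _ h1).trans (reindexPoints_trans _ _ e f _).symm))

end Basic

section Multi

variable {ι : Type} {c : ι → Profile L} {c₀ : Profile L} {κ : ι → Type}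
  {d : ∀ i, κ i → Profile L}

/-- The beginning points of `P` and of the diagrams at its input circles, sorted into those that
stay and those that get glued. -/
def plugBegin (c : ι → Profile L) (d : ∀ i, κ i → Profile L) (A : Type) :
    ((Σ t : Σ i, κ i, (d t.1 t.2).1) ⊕ A) ⊕ ((Σ i, (c i).1) ⊕ (Σ i, (c i).2)) ≃
      ((Σ i, (c i).1) ⊕ A) ⊕ (Σ i, (Σ k, (d i k).1) ⊕ (c i).2) where
  toFun
    | .inl (.inl ⟨⟨i, k⟩, a⟩) => .inr ⟨i, .inl ⟨k, a⟩⟩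
    | .inl (.inr a) => .inl (.inr a)
    | .inr (.inl a) => .inl (.inl a)
    | .inr (.inr ⟨i, a⟩) => .inr ⟨i, .inr a⟩
  invFun
    | .inr ⟨i, .inl ⟨k, a⟩⟩ => .inl (.inl ⟨⟨i, k⟩, a⟩)
    | .inl (.inr a) => .inl (.inr a)
    | .inl (.inl a) => .inr (.inl a)
    | .inr ⟨i, .inr a⟩ => .inr (.inr ⟨i, a⟩)
  left_inv := by rintro ((⟨⟨i, k⟩, a⟩ | a) | (⟨i, a⟩ | ⟨i, a⟩)) <;> rfl
  right_inv := by rintro ((⟨i, a⟩ | a) | ⟨i, (⟨k, a⟩ | a)⟩) <;> rfl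

/-- The ending points of `P` and of the diagrams at its input circles, sorted into those that
stay and those that get glued. -/
def plugEnd (c : ι → Profile L) (d : ∀ i, κ i → Profile L) (B : Type) :
    ((Σ t : Σ i, κ i, (d t.1 t.2).2) ⊕ B) ⊕ ((Σ i, (c i).1) ⊕ (Σ i, (c i).2)) ≃
      ((Σ i, (c i).2) ⊕ B) ⊕ (Σ i, (Σ k, (d i k).2) ⊕ (c i).1) where
  toFun
    | .inl (.inl ⟨⟨i, k⟩, a⟩) => .inr ⟨i, .inl ⟨k, a⟩⟩
    | .inl (.inr a) => .inl (.inr a)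
    | .inr (.inr a) => .inl (.inl a)
    | .inr (.inl ⟨i, a⟩) => .inr ⟨i, .inr a⟩
  invFun
    | .inr ⟨i, .inl ⟨k, a⟩⟩ => .inl (.inl ⟨⟨i, k⟩, a⟩)
    | .inl (.inr a) => .inl (.inr a)
    | .inl (.inl a) => .inr (.inr a)
    | .inr ⟨i, .inr a⟩ => .inr (.inl ⟨i, a⟩)
  left_inv := by rintro ((⟨⟨i, k⟩, a⟩ | a) | (⟨i, a⟩ | ⟨i, a⟩)) <;> rfl
  right_inv := by rintro ((⟨i, a⟩ | a) | ⟨i, (⟨k, a⟩ | a)⟩) <;> rfl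

/-- The strands of `P` and of all `K i`, sorted for gluing the output circles of the `K i` to the
input circles of `P`. -/
def plug {A B : Type} (P : (Σ i, (c i).1) ⊕ A ≃ (Σ i, (c i).2) ⊕ B)
    (K : ∀ i, WiringDiagram (d i) (c i)) :
    ((Σ t : Σ i, κ i, (d t.1 t.2).1) ⊕ A) ⊕ ((Σ i, (c i).1) ⊕ (Σ i, (c i).2)) ≃
      ((Σ t : Σ i, κ i, (d t.1 t.2).2) ⊕ B) ⊕ ((Σ i, (c i).1) ⊕ (Σ i, (c i).2)) :=
  (plugBegin c d A).trans
    ((P.sumCongr (Equiv.sigmaCongrRight fun i => (K i).p)).trans (plugEnd c d B).symm)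

section

variable {A B : Type} (P : (Σ i, (c i).1) ⊕ A ≃ (Σ i, (c i).2) ⊕ B)
  (K : ∀ i, WiringDiagram (d i) (c i))

theorem plug_inl_inr (a) : plug P K (.inl (.inr a)) =
    (plugEnd c d B).symm (.inl (P (.inr a))) := rfl

theorem plug_inr_inl (a) : plug P K (.inr (.inl a)) =
    (plugEnd c d B).symm (.inl (P (.inl a))) := rfl

end

/-- The simultaneous composite of `D` with diagrams `K i` at all its input circles. -/
noncomputable def multi [Finite ι] [∀ i, Finite (κ i)] (D : WiringDiagram c c₀)
    (K : ∀ i, WiringDiagram (d i) (c i)) :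
    WiringDiagram (fun t : Σ i, κ i => d t.1 t.2) c₀ where
  p := glue (plug D.p K)
  l := D.l + (∑ᶠ i, (K i).l) + Nat.card (GlueLoop (plug D.p K))

end Multi

section MultiReindex

variable {ι ι' : Type} {c : ι → Profile L} {c₀ : Profile L} {κ κ' : ι → Type}
  {d : ∀ i, κ i → Profile L}

/-- Renumbering the input circles of the `K i` renames only points that are not glued; the transport
lemmas apply with the identity on glued points. -/
theorem multi_reindex_right [Finite ι] [∀ i, Finite (κ i)] [∀ i, Finite (κ' i)]
    (D : WiringDiagram c c₀) (K : ∀ i, WiringDiagram (d i) (c i)) (e : ∀ i, κ' i ≃ κ i) :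
    (D.multi fun i => (K i).reindex (e i)) = (D.multi K).reindex (Equiv.sigmaCongrRight e) := by
  let a : (Σ t : Σ i, κ' i, (d t.1 (e t.1 t.2)).1) ⊕ c₀.2 ≃ (Σ t : Σ i, κ i, (d t.1 t.2).1) ⊕ c₀.2 :=
    (Equiv.sigmaCongrLeft (β := fun t : Σ i, κ i => ((d t.1 t.2).1 : Type))
      (Equiv.sigmaCongrRight e)).sumCongr (Equiv.refl _)
  let b : (Σ t : Σ i, κ' i, (d t.1 (e t.1 t.2)).2) ⊕ c₀.1 ≃ (Σ t : Σ i, κ i, (d t.1 t.2).2) ⊕ c₀.1 :=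
    (Equiv.sigmaCongrLeft (β := fun t : Σ i, κ i => ((d t.1 t.2).2 : Type))
      (Equiv.sigmaCongrRight e)).sumCongr (Equiv.refl _)
  have key : ∀ s, plug D.p K (s.map a (Equiv.refl _)) =
      (plug D.p (fun i => (K i).reindex (e i)) s).map b (Equiv.refl _) := by
    have hK : ∀ i s, (plugEnd c d c₀.1).symm (.inr ⟨i, (K i).p
        (reindexPoints (d i) Prod.fst (c i).2 (e i) s)⟩) =
        ((plugEnd c (fun i k => d i (e i k)) c₀.1).symm
          (.inr ⟨i, ((K i).reindex (e i)).p s⟩)).map b (Equiv.refl _) := by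
      intro i s
      rw [p_reindexPoints]
      rcases ((K i).reindex (e i)).p s with ⟨k, y⟩ | y <;> rfl
    have hD : ∀ s, (plugEnd c d c₀.1).symm (.inl (D.p s)) =
        ((plugEnd c (fun i k => d i (e i k)) c₀.1).symm (.inl (D.p s))).map b (Equiv.refl _) := by
      intro s
      rcases D.p s with y | y <;> rfl
    rintro ((⟨⟨i, k⟩, x⟩ | x) | (x | ⟨i, x⟩))
    · exact hK i (.inl ⟨k, x⟩)
    · exact hD (.inr x)
    · exact hD (.inl x)
    · exact hK i (.inr x)
  refine eq_reindex (e := Equiv.sigmaCongrRight e) (D := D.multi K)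
    (D' := D.multi fun i => (K i).reindex (e i)) (fun s => ?_) ?_
  · exact glue_transport a b (Equiv.refl _) key s
  · exact congrArg (_ + ·) (card_glueLoop_transport a b (Equiv.refl _) key).symm

theorem multi_reindex_left [Finite ι] [Finite ι'] [∀ i, Finite (κ i)]
    (D : WiringDiagram c c₀) (K : ∀ i, WiringDiagram (d i) (c i)) (e : ι' ≃ ι) :
    ((D.reindex e).multi fun i => K (e i)) =
      (D.multi K).reindex (Equiv.sigmaCongrLeft (β := κ) e) := by
  let a : (Σ t : Σ i, κ (e i), (d (e t.1) t.2).1) ⊕ c₀.2 ≃ (Σ t : Σ i, κ i, (d t.1 t.2).1) ⊕ c₀.2 :=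
    (Equiv.sigmaCongrLeft (β := fun t : Σ i, κ i => ((d t.1 t.2).1 : Type))
      (Equiv.sigmaCongrLeft (β := κ) e)).sumCongr (Equiv.refl _)
  let b : (Σ t : Σ i, κ (e i), (d (e t.1) t.2).2) ⊕ c₀.1 ≃ (Σ t : Σ i, κ i, (d t.1 t.2).2) ⊕ c₀.1 :=
    (Equiv.sigmaCongrLeft (β := fun t : Σ i, κ i => ((d t.1 t.2).2 : Type))
      (Equiv.sigmaCongrLeft (β := κ) e)).sumCongr (Equiv.refl _)
  let ζ : (Σ i, (c (e i)).1) ⊕ (Σ i, (c (e i)).2) ≃ (Σ i, (c i).1) ⊕ (Σ i, (c i).2) :=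
    (Equiv.sigmaCongrLeft (β := fun i => ((c i).1 : Type)) e).sumCongr
      (Equiv.sigmaCongrLeft (β := fun i => ((c i).2 : Type)) e)
  have key : ∀ s, plug D.p K (s.map a ζ) =
      (plug (D.reindex e).p (fun i => K (e i)) s).map b ζ := by
    have hK : ∀ i s, (plugEnd c d c₀.1).symm (.inr ⟨e i, (K (e i)).p s⟩) =
        ((plugEnd (fun i => c (e i)) (fun i k => d (e i) k) c₀.1).symm
          (.inr ⟨i, (K (e i)).p s⟩)).map b ζ := by
      intro i s
      rcases (K (e i)).p s with ⟨k, y⟩ | y <;> rfl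
    have hD : ∀ s, (plugEnd c d c₀.1).symm (.inl (D.p
        (reindexPoints c Prod.fst c₀.2 e s))) =
        ((plugEnd (fun i => c (e i)) (fun i k => d (e i) k) c₀.1).symm
          (.inl ((D.reindex e).p s))).map b ζ := by
      intro s
      rw [p_reindexPoints]
      rcases (D.reindex e).p s with y | y <;> rfl
    rintro ((⟨⟨i, k⟩, x⟩ | x) | (x | ⟨i, x⟩))
    · exact hK i (.inl ⟨k, x⟩)
    · exact hD (.inr x)
    · exact hD (.inl x)
    · exact hK i (.inr x)
  refine eq_reindex (e := Equiv.sigmaCongrLeft (β := κ) e) (D := D.multi K)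
    (D' := (D.reindex e).multi fun i => K (e i)) (fun s => ?_) ?_
  · exact glue_transport a b ζ key s
  · refine congrArg₂ (· + ·) (congrArg (_ + ·) ?_) (card_glueLoop_transport a b ζ key).symm
    exact finsum_comp_equiv e (f := fun i => (K i).l)

end MultiReindex

end WiringDiagram

namespace WiringDiagram

variable {L : Type}

/-! ### Diagrams that permute labels, and the unit laws -/

section Perm

/-- The diagram with one input circle whose strands join the label `a` on the input circle with the
label `u a`, respectively `w a`, on the output circle. -/
def permDiag {S : Profile L} (θ : Equiv.Perm S.1 × Equiv.Perm S.2) :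
    WiringDiagram (fun _ : Fin 1 => S) S where
  p :=
    { toFun := Sum.elim (fun a => .inr (θ.1 a.2)) (fun a => .inl ⟨0, θ.2.symm a⟩)
      invFun := Sum.elim (fun a => .inr (θ.2 a.2)) (fun a => .inl ⟨0, θ.1.symm a⟩)
      left_inv := by
        rintro (⟨i, a⟩ | a)
        · obtain rfl := Subsingleton.elim i 0
          simp
        · simp
      right_inv := by
        rintro (⟨i, a⟩ | a)
        · obtain rfl := Subsingleton.elim i 0
          simp
        · simp }
  l := 0

theorem permDiag_one (S : Profile L) : permDiag (S := S) 1 = ident S :=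
  WiringDiagram.ext (Equiv.ext (by rintro (a | a) <;> rfl)) rfl

variable {ι : Type} {c : ι → Profile L} {c₀ : Profile L}

/-- Relabelling the input circles: the label `a` becomes the former label `θ a`. -/
def conj (D : WiringDiagram c c₀) (θ : ∀ i, Equiv.Perm (c i).1 × Equiv.Perm (c i).2) :
    WiringDiagram c c₀ where
  p := ((Equiv.sigmaCongrRight fun i => (θ i).1).sumCongr (Equiv.refl _)).trans
    (D.p.trans ((Equiv.sigmaCongrRight fun i => (θ i).2).sumCongr (Equiv.refl _)).symm)
  l := D.l

/-- Relabelling the output circle: the label `a` becomes `θ a`. -/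
def conjOut (D : WiringDiagram c c₀) (θ : Equiv.Perm c₀.1 × Equiv.Perm c₀.2) :
    WiringDiagram c c₀ where
  p := ((Equiv.refl _).sumCongr θ.2.symm).trans (D.p.trans ((Equiv.refl _).sumCongr θ.1))
  l := D.l

theorem conj_one (D : WiringDiagram c c₀) : D.conj (fun _ => 1) = D := by
  have h1 : ∀ (q : ι → Finset L) (A : Type) (s : (Σ i, q i) ⊕ A),
      s.map (Equiv.sigmaCongrRight fun i => (1 : Equiv.Perm (q i))) (Equiv.refl _) = s := by
    rintro q A (⟨i, a⟩ | a) <;> rfl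
  refine WiringDiagram.ext (Equiv.ext fun s => ?_) rfl
  exact (Equiv.symm_apply_eq ((Equiv.sigmaCongrRight fun i => (1 : Equiv.Perm (c i).2)).sumCongr
    (Equiv.refl _))).2 ((congrArg D.p (h1 _ _ s)).trans (h1 _ _ _).symm)

theorem conjOut_one (D : WiringDiagram c c₀) : D.conjOut 1 = D := by
  refine WiringDiagram.ext (Equiv.ext fun s => ?_) rfl
  have h1 : ∀ (A B : Type) (s : A ⊕ B), s.map (Equiv.refl _) (1 : Equiv.Perm B) = s := by
    rintro A B (a | a) <;> rfl
  exact (h1 _ _ _).trans (congrArg D.p (h1 _ _ s))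

/-- A label-permuting diagram has no strand from its output circle back to it. So a strand of `P`
that arrives at circle `j` crosses the diagram there once and then ends. -/
theorem strandEnds_plug_permDiag {A B : Type} (P : (Σ i, (c i).1) ⊕ A ≃ (Σ i, (c i).2) ⊕ B)
    (θ : ∀ i, Equiv.Perm (c i).1 × Equiv.Perm (c i).2) {s} {t}
    (hs : plug P (fun i => permDiag (θ i)) s = (plugEnd c (fun i (_ : Fin 1) => c i) B).symm (.inl t)) :
    StrandEnds (plug P (fun i => permDiag (θ i))) s
      (t.map (fun y => ⟨⟨y.1, 0⟩, (θ y.1).2.symm y.2⟩) id) := by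
  rcases t with ⟨j, b⟩ | b
  · exact strandEnds_of_eq_inr hs (strandEnds_of_eq_inl rfl)
  · exact strandEnds_of_eq_inl hs

/-- Every path ends after at most two gluings: no circle arises, and the matching is that of `D`
with the labels permuted at both ends of its strands. For trivial `θ` this is the right unit law;
`permDiag_multi` gives the left one. -/
theorem multi_permDiag [Finite ι] (D : WiringDiagram c c₀)
    (θ : ∀ i, Equiv.Perm (c i).1 × Equiv.Perm (c i).2) :
    (D.multi fun i => permDiag (θ i)) =
      (D.conj θ).reindex (Equiv.sigmaUnique ι fun _ => Fin 1) := by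
  refine eq_reindex (e := Equiv.sigmaUnique ι fun _ => Fin 1)
    (D' := D.multi fun i => permDiag (θ i)) (fun s => ?_) ?_
  · have hy : ∀ s, reindexPoints c Prod.snd c₀.1 (Equiv.sigmaUnique ι fun _ => Fin 1)
        ((D.p s).map (fun y => ⟨⟨y.1, (0 : Fin 1)⟩, (θ y.1).2.symm y.2⟩) id) =
        (((Equiv.sigmaCongrRight fun i => (θ i).2).sumCongr (Equiv.refl _)).symm (D.p s)) := by
      intro s
      rcases D.p s with y | y <;> rfl
    rcases s with ⟨⟨i, k⟩, a⟩ | a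
    · obtain rfl := Subsingleton.elim k 0
      have h : glue (plug D.p fun i => permDiag (θ i)) (.inl ⟨⟨i, 0⟩, a⟩) = _ :=
        glue_eq_iff.2 (strandEnds_of_eq_inr (p := plug D.p fun i => permDiag (θ i))
          (z := .inl ⟨i, (θ i).1 a⟩) rfl (strandEnds_plug_permDiag D.p θ rfl))
      exact (hy _).symm.trans (congrArg _ h.symm)
    · have h : glue (plug D.p fun i => permDiag (θ i)) (.inr a) = _ :=
        glue_eq_iff.2 (strandEnds_plug_permDiag D.p θ rfl)
      exact (hy _).symm.trans (congrArg _ h.symm)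
  · refine (congrArg₂ (fun x y => D.l + x + y) ?_ (card_glueLoop_eq_zero ?_)).trans
      (add_zero (D.l + 0))
    · exact finsum_eq_zero_of_forall_eq_zero fun i => rfl
    · rintro (a | ⟨i, a⟩)
      · exact ⟨_, strandEnds_plug_permDiag D.p θ rfl⟩
      · exact ⟨_, strandEnds_of_eq_inl rfl⟩

/-- Forgetting the only value of the first index. -/
def forgetFin (κ : Type) : (Σ _ : Fin 1, κ) ≃ κ where
  toFun t := t.2
  invFun k := ⟨0, k⟩
  left_inv := by
    rintro ⟨i, k⟩
    obtain rfl := Subsingleton.elim i 0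
    rfl
  right_inv _ := rfl

theorem strandEnds_plug_of_permDiag {S : Profile L} (θ : Equiv.Perm S.1 × Equiv.Perm S.2)
    (D : WiringDiagram c S) {s} {i} {t}
    (hs : plug (permDiag θ).p (fun _ => D) s =
      (plugEnd (fun _ : Fin 1 => S) (fun _ => c) S.1).symm (.inr ⟨i, t⟩)) :
    StrandEnds (plug (permDiag θ).p (fun _ => D)) s
      (t.map (fun y => ⟨⟨0, y.1⟩, y.2⟩) θ.1) := by
  obtain rfl := Subsingleton.elim i 0
  rcases t with b | b
  · exact strandEnds_of_eq_inl hs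
  · exact strandEnds_of_eq_inr hs (strandEnds_of_eq_inl rfl)

theorem permDiag_multi [Finite ι] {S : Profile L} (θ : Equiv.Perm S.1 × Equiv.Perm S.2)
    (D : WiringDiagram c S) :
    ((permDiag θ).multi fun _ => D) = (D.conjOut θ).reindex (forgetFin ι) := by
  refine eq_reindex (e := forgetFin ι) (D' := (permDiag θ).multi fun _ => D) (fun s => ?_) ?_
  · have hy : ∀ s, reindexPoints c Prod.snd S.1 (forgetFin ι)
        ((D.p s).map (fun y => ⟨⟨0, y.1⟩, y.2⟩) θ.1) =
        ((Equiv.refl _).sumCongr θ.1) (D.p s) := by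
      intro s
      rcases D.p s with y | y <;> rfl
    rcases s with ⟨⟨k, i⟩, a⟩ | a
    · have h : glue (plug (permDiag θ).p fun _ => D) (.inl ⟨⟨k, i⟩, a⟩) = _ :=
        glue_eq_iff.2 (strandEnds_plug_of_permDiag θ D rfl)
      exact (hy _).symm.trans (congrArg _ h.symm)
    · have h : glue (plug (permDiag θ).p fun _ => D) (.inr a) = _ :=
        glue_eq_iff.2 (strandEnds_of_eq_inr (p := plug (permDiag θ).p fun _ => D)
          (z := .inr ⟨0, θ.2.symm a⟩) rfl (strandEnds_plug_of_permDiag θ D rfl))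
      exact (hy _).symm.trans (congrArg _ h.symm)
  · refine (congrArg₂ (fun x y => 0 + x + y) ?_ (card_glueLoop_eq_zero ?_)).trans (zero_add D.l)
    · exact finsum_unique _
    · rintro (⟨i, a⟩ | ⟨i, a⟩)
      · exact ⟨_, strandEnds_of_eq_inl rfl⟩
      · exact ⟨_, strandEnds_plug_of_permDiag θ D rfl⟩

end Perm

/-! ### Gluing inside a diagram before plugging its input circles -/

section PlugGlue

variable {ι : Type} {c : ι → Profile L} {κ : ι → Type} {d : ∀ i, κ i → Profile L} {A B Z : Type}

/-- Regrouping of points. -/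
def regroup (X A Z₁ Z₂ : Type) : (X ⊕ A) ⊕ (Z₁ ⊕ Z₂) ≃ (X ⊕ (A ⊕ Z₂)) ⊕ Z₁ where
  toFun
    | .inl (.inl x) => .inl (.inl x)
    | .inl (.inr a) => .inl (.inr (.inl a))
    | .inr (.inl z) => .inr z
    | .inr (.inr z) => .inl (.inr (.inr z))
  invFun
    | .inl (.inl x) => .inl (.inl x)
    | .inl (.inr (.inl a)) => .inl (.inr a)
    | .inr z => .inr (.inl z)
    | .inl (.inr (.inr z)) => .inr (.inr z)
  left_inv := by rintro ((x | a) | (z | z)) <;> rfl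
  right_inv := by rintro ((x | (a | z)) | z) <;> rfl

/-- The strands of `P` and of all `K i`, sorted for gluing the points `Z` of `P` and the output
circles of the `K i` at the same time. -/
def plugTotal (P : ((Σ i, (c i).1) ⊕ A) ⊕ Z ≃ ((Σ i, (c i).2) ⊕ B) ⊕ Z)
    (K : ∀ i, WiringDiagram (d i) (c i)) :
    ((Σ t : Σ i, κ i, (d t.1 t.2).1) ⊕ A) ⊕ (((Σ i, (c i).1) ⊕ (Σ i, (c i).2)) ⊕ Z) ≃
      ((Σ t : Σ i, κ i, (d t.1 t.2).2) ⊕ B) ⊕ (((Σ i, (c i).1) ⊕ (Σ i, (c i).2)) ⊕ Z) :=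
  (regroup _ _ _ _).trans
    ((plug ((Equiv.sumAssoc _ _ _).symm.trans (P.trans (Equiv.sumAssoc _ _ _))) K).trans
      (regroup _ _ _ _).symm)

/-- Where the ending points of `P` go. -/
def totalEnd (d : ∀ i, κ i → Profile L) : ((Σ i, (c i).2) ⊕ B) ⊕ Z →
    ((Σ t : Σ i, κ i, (d t.1 t.2).2) ⊕ B) ⊕ (((Σ i, (c i).1) ⊕ (Σ i, (c i).2)) ⊕ Z)
  | .inl (.inl y) => .inr (.inl (.inr y))
  | .inl (.inr b) => .inl (.inr b)
  | .inr z => .inr (.inr z)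

/-- Where the ending points of the diagrams `K i` go. -/
def totalEndK (d : ∀ i, κ i → Profile L) (B Z : Type) (i : ι) : (Σ k, (d i k).2) ⊕ (c i).1 →
    ((Σ t : Σ i, κ i, (d t.1 t.2).2) ⊕ B) ⊕ (((Σ i, (c i).1) ⊕ (Σ i, (c i).2)) ⊕ Z)
  | .inl ⟨k, y⟩ => .inl (.inl ⟨⟨i, k⟩, y⟩)
  | .inr y => .inr (.inl (.inl ⟨i, y⟩))

section

variable (P : ((Σ i, (c i).1) ⊕ A) ⊕ Z ≃ ((Σ i, (c i).2) ⊕ B) ⊕ Z)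
    (K : ∀ i, WiringDiagram (d i) (c i))

theorem plugTotal_eq_totalEnd {s s'} (h : plug ((Equiv.sumAssoc _ _ _).symm.trans
      (P.trans (Equiv.sumAssoc _ _ _))) K (regroup _ _ _ _ s) = (plugEnd c d (B ⊕ Z)).symm
        (.inl ((Equiv.sumAssoc _ _ _) (P s')))) : plugTotal P K s = totalEnd d (P s') := by
  refine (congrArg (regroup _ _ _ _).symm h).trans ?_
  rcases P s' with (y | b) | z <;> rfl

theorem plugTotal_eq_totalEndK {s i t} (h : plug ((Equiv.sumAssoc _ _ _).symm.trans
      (P.trans (Equiv.sumAssoc _ _ _))) K (regroup _ _ _ _ s) = (plugEnd c d (B ⊕ Z)).symm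
        (.inr ⟨i, t⟩)) : plugTotal P K s = totalEndK d B Z i t := by
  refine (congrArg (regroup _ _ _ _).symm h).trans ?_
  rcases t with y | b <;> rfl

theorem plugTotal_inl_inl (i k a) : plugTotal P K (.inl (.inl ⟨⟨i, k⟩, a⟩)) =
    totalEndK d B Z i ((K i).p (.inl ⟨k, a⟩)) := plugTotal_eq_totalEndK P K rfl

theorem plugTotal_inl_inr (a) : plugTotal P K (.inl (.inr a)) =
    totalEnd d (P (.inl (.inr a))) := plugTotal_eq_totalEnd P K rfl

theorem plugTotal_inr_inl_inl (a) : plugTotal P K (.inr (.inl (.inl a))) =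
    totalEnd d (P (.inl (.inl a))) := plugTotal_eq_totalEnd P K rfl

theorem plugTotal_inr_inl_inr (i a) : plugTotal P K (.inr (.inl (.inr ⟨i, a⟩))) =
    totalEndK d B Z i ((K i).p (.inr a)) := plugTotal_eq_totalEndK P K rfl

theorem plugTotal_inr_inr (z) : plugTotal P K (.inr (.inr z)) =
    totalEnd d (P (.inr z)) := plugTotal_eq_totalEnd P K rfl

end

/-- The points `Z` inside `P` are glued first and the circles afterwards. The circle points of `glue
P` are unglued for the first stage but glued in the second one, hence the shape of the two
inclusions: only `A` and `B` stay free in both. -/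
theorem isStage_plugTotal [Finite ι] [Finite A] [Finite B] [Finite Z]
    (P : ((Σ i, (c i).1) ⊕ A) ⊕ Z ≃ ((Σ i, (c i).2) ⊕ B) ⊕ Z)
    (K : ∀ i, WiringDiagram (d i) (c i)) :
    IsStage (plugTotal P K) (plug (glue P) K) P (Equiv.refl _) (Equiv.refl _) (Equiv.refl _)
      (Sum.elim (fun x => .inr (.inl x)) (fun a => .inl (.inr a)))
      (Sum.elim (fun y => .inr (.inr y)) (fun b => .inl (.inr b))) where
  inner s := by
    have h : ∀ t : ((Σ i, (c i).2) ⊕ B) ⊕ Z, totalEnd d t = Sum.elim (fun y => Sum.map (Equiv.refl _) (Equiv.refl _ ∘ .inl)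
        (Sum.elim (fun y => .inr (.inr y)) (fun b => .inl (.inr b)) y))
        (fun z => .inr (.inr z)) t := by
      rintro ((y | b) | z) <;> rfl
    rcases s with (x | a) | z
    · exact (plugTotal_inr_inl_inl P K x).trans (h _)
    · exact (plugTotal_inl_inr P K a).trans (h _)
    · exact (plugTotal_inr_inr P K z).trans (h _)
  glued x := by
    rcases x with x | x
    · refine (plug_inr_inl (glue P) K x).trans ?_
      rcases glue P (.inl x) with y | y <;> rfl
    · refine (plug_inl_inr (glue P) K x).trans ?_
      rcases glue P (.inr x) with y | y <;> rfl
  outer s := by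
    have h : ∀ i t, totalEndK d B Z i t = Sum.map (Equiv.refl _) (Equiv.refl _ ∘ .inl)
        ((plugEnd c d B).symm (.inr ⟨i, t⟩)) := by
      rintro i (⟨k, y⟩ | y) <;> rfl
    rcases s with ((⟨⟨i, k⟩, a⟩ | a) | (a | ⟨i, a⟩))
    · exact .inr ((plugTotal_inl_inl P K i k a).trans (h _ _))
    · exact .inl ⟨.inr a, rfl⟩
    · exact .inl ⟨.inl a, rfl⟩
    · exact .inr ((plugTotal_inr_inl_inr P K i a).trans (h _ _))

end PlugGlue

/-! ### The strands of a partial composite, case by case -/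

section CompAt

variable {ι κ : Type} {c : ι → Profile L} {c₀ : Profile L} {i : ι} {d : κ → Profile L}

/-- Singling out the index `i`. -/
noncomputable def optionNe (i : ι) : Option {j : ι // j ≠ i} ≃ ι :=
  Equiv.ofBijective (fun
    | none => i
    | some j => j.1) <| by
    constructor
    · rintro (_ | j) (_ | j') h
      · rfl
      · exact absurd h.symm j'.2
      · exact absurd h j.2
      · exact congrArg some (Subtype.ext h)
    · intro j
      by_cases hj : j = i
      · exact ⟨none, hj.symm⟩
      · exact ⟨some ⟨j, hj⟩, rfl⟩

/-- Where the ending points of `D` go in `D ∘ᵢ D'`. -/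
def compEnd (d : κ → Profile L) : (Σ o, (c (optionNe i o)).2) ⊕ c₀.1 →
    ((Σ t, (compColour c i d t).2) ⊕ c₀.1) ⊕ ((c i).1 ⊕ (c i).2)
  | .inl ⟨none, b⟩ => .inr (.inr b)
  | .inl ⟨some j, b⟩ => .inl (.inl ⟨.inl j, b⟩)
  | .inr b => .inl (.inr b)

/-- Where the ending points of `D'` go in `D ∘ᵢ D'`. -/
def compEnd' (c₀ : Profile L) : (Σ k, (d k).2) ⊕ (c i).1 →
    ((Σ t, (compColour c i d t).2) ⊕ c₀.1) ⊕ ((c i).1 ⊕ (c i).2)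
  | .inl ⟨k, b⟩ => .inl (.inl ⟨.inr k, b⟩)
  | .inr b => .inr (.inl b)

variable (D : WiringDiagram c c₀) (D' : WiringDiagram d (c i))

/-- Indexing the circles of `D` by `Option` lets the circle `i` be separated from the others by
pattern matching instead of by a decision. -/
theorem compStrands_eq_compEnd {s s'}
    (h : sortPoints c i d Prod.fst c₀.2 (c i).2 s =
      .inl (reindexPoints c Prod.fst c₀.2 (optionNe i) s')) :
    compStrands D i D' s = compEnd d ((D.reindex (optionNe i)).p s') := by
  have h1 : compStrands D i D' s = ((Equiv.refl _).sumCongr (Equiv.sumComm _ _))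
      ((sortPoints c i d Prod.snd c₀.1 (c i).1).symm
        (.inl (D.p (reindexPoints c Prod.fst c₀.2 (optionNe i) s')))) := by
    simp only [compStrands, Equiv.trans_apply, h]
    rfl
  rw [h1, p_reindexPoints]
  -- The inverse of `sortPoints` comes from bijectivity alone, so it is evaluated by exhibiting a
  -- preimage `t'`.
  have h2 : ∀ t t', sortPoints c i d Prod.snd c₀.1 (c i).1 t' =
      .inl (reindexPoints c Prod.snd c₀.1 (optionNe i) t) →
      ((Equiv.refl _).sumCongr (Equiv.sumComm _ _)) t' = compEnd d t →
      ((Equiv.refl _).sumCongr (Equiv.sumComm _ _))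
      ((sortPoints c i d Prod.snd c₀.1 (c i).1).symm
        (.inl (reindexPoints c Prod.snd c₀.1 (optionNe i) t))) = compEnd d t := by
    intro t t' ht ht'
    rw [← ht, Equiv.symm_apply_apply, ht']
  rcases (D.reindex (optionNe i)).p s' with ⟨_ | j, b⟩ | b
  · exact h2 _ (.inr (.inl b)) rfl rfl
  · exact h2 _ (.inl (.inl ⟨.inl j, b⟩)) rfl rfl
  · exact h2 _ (.inl (.inr b)) rfl rfl

theorem compStrands_eq_compEnd' {s s'}
    (h : sortPoints c i d Prod.fst c₀.2 (c i).2 s = .inr s') :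
    compStrands D i D' s = compEnd' c₀ (D'.p s') := by
  have h1 : compStrands D i D' s = ((Equiv.refl _).sumCongr (Equiv.sumComm _ _))
      ((sortPoints c i d Prod.snd c₀.1 (c i).1).symm (.inr (D'.p s'))) := by
    simp only [compStrands, Equiv.trans_apply, h]
    rfl
  rw [h1]
  have h2 : ∀ t t', sortPoints c i d Prod.snd c₀.1 (c i).1 t' = .inr t →
      ((Equiv.refl _).sumCongr (Equiv.sumComm _ _)) t' = compEnd' (i := i) c₀ t →
      ((Equiv.refl _).sumCongr (Equiv.sumComm _ _))
      ((sortPoints c i d Prod.snd c₀.1 (c i).1).symm (.inr t)) = compEnd' (i := i) c₀ t := by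
    intro t t' ht ht'
    rw [← ht, Equiv.symm_apply_apply, ht']
  rcases D'.p s' with ⟨k, b⟩ | b
  · exact h2 _ (.inl (.inl ⟨.inr k, b⟩)) rfl rfl
  · exact h2 _ (.inr (.inr b)) rfl rfl

theorem compStrands_inl_inl_inl (j a) : compStrands D i D' (.inl (.inl ⟨.inl j, a⟩)) =
    compEnd d ((D.reindex (optionNe i)).p (.inl ⟨some j, a⟩)) :=
  compStrands_eq_compEnd D D' rfl

theorem compStrands_inl_inl_inr (k a) : compStrands D i D' (.inl (.inl ⟨.inr k, a⟩)) =
    compEnd' c₀ (D'.p (.inl ⟨k, a⟩)) :=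
  compStrands_eq_compEnd' D D' rfl

theorem compStrands_inl_inr (a) : compStrands D i D' (.inl (.inr a)) =
    compEnd d ((D.reindex (optionNe i)).p (.inr a)) :=
  compStrands_eq_compEnd D D' rfl

theorem compStrands_inr_inl (a) : compStrands D i D' (.inr (.inl a)) =
    compEnd d ((D.reindex (optionNe i)).p (.inl ⟨none, a⟩)) :=
  compStrands_eq_compEnd D D' rfl

theorem compStrands_inr_inr (a) : compStrands D i D' (.inr (.inr a)) =
    compEnd' c₀ (D'.p (.inr a)) :=
  compStrands_eq_compEnd' D D' rfl

end CompAt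

end WiringDiagram

namespace WiringDiagram

variable {L : Type}

/-- Colours of index types that are assembled by cases agree along `e` only propositionally, which
forces a cast in the statement. The maps `f` and `g` are renamings of points, defined by cases, that
keep every label; once the colours are identified they can only be `reindexPoints`. -/
theorem exists_eq_reindex {ι ι' : Type} {c : ι → Profile L} {c' : ι' → Profile L} {c₀ : Profile L}
    (D : WiringDiagram c c₀) (D' : WiringDiagram c' c₀) (e : ι ≃ ι')
    (hc : c = fun i => c' (e i))
    (f : (Σ i, (c i).1) ⊕ c₀.2 → (Σ i, (c' i).1) ⊕ c₀.2)
    (g : (Σ i, (c i).2) ⊕ c₀.1 → (Σ i, (c' i).2) ⊕ c₀.1)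
    (hf : ∀ i a, ∃ h, f (.inl ⟨i, a⟩) = .inl ⟨e i, a, h⟩) (hf' : ∀ a, f (.inr a) = .inr a)
    (hg : ∀ i a, ∃ h, g (.inl ⟨i, a⟩) = .inl ⟨e i, a, h⟩) (hg' : ∀ a, g (.inr a) = .inr a)
    (hD : ∀ s, D'.p (f s) = g (D.p s)) (hl : D.l = D'.l) :
    D = cast (congrArg (fun c => WiringDiagram c c₀) hc.symm) (D'.reindex e) := by
  subst hc
  refine eq_reindex (fun s => ?_) hl
  have h1 : ∀ s, reindexPoints c' Prod.fst c₀.2 e s = f s := by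
    rintro (⟨i, a⟩ | a)
    · exact (hf i a).choose_spec.symm
    · exact (hf' a).symm
  have h2 : ∀ s, reindexPoints c' Prod.snd c₀.1 e s = g s := by
    rintro (⟨i, a⟩ | a)
    · exact (hg i a).choose_spec.symm
    · exact (hg' a).symm
  rw [h1, h2, hD]

/-! ### Associativity of partial and simultaneous composition -/

section MultiCompAt

variable {ι κ : Type} {c : ι → Profile L} {c₀ : Profile L} {i : ι} {d : κ → Profile L}
  {τ : {j : ι // j ≠ i} ⊕ κ → Type} {m : ∀ t, τ t → Profile L}

/-- The input circles of the diagrams at the input circles of `D`, when first diagrams are inserted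
in those of `D'`, and then the result is inserted in the `i`-th input circle of `D`. -/
def NestIndex (τ : {j : ι // j ≠ i} ⊕ κ → Type) : Option {j : ι // j ≠ i} → Type
  | none => Σ k, τ (.inr k)
  | some j => τ (.inl j)

instance [Finite κ] [∀ t, Finite (τ t)] (o) : Finite (NestIndex τ o) := by
  rcases o with _ | j
  · exact inferInstanceAs (Finite (Σ k, τ (.inr k)))
  · exact inferInstanceAs (Finite (τ (.inl j)))

/-- The colours of the circles with nested index. -/
def nestColour (m : ∀ t, τ t → Profile L) : ∀ o, NestIndex τ o → Profile L
  | none => fun k => m (.inr k.1) k.2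
  | some j => m (.inl j)

/-- Flat and nested indices. -/
def nestEquiv (τ : {j : ι // j ≠ i} ⊕ κ → Type) : (Σ o, NestIndex τ o) ≃ Σ t, τ t where
  toFun
    | ⟨none, ⟨k, a⟩⟩ => ⟨.inr k, a⟩
    | ⟨some j, a⟩ => ⟨.inl j, a⟩
  invFun
    | ⟨.inr k, a⟩ => ⟨none, ⟨k, a⟩⟩
    | ⟨.inl j, a⟩ => ⟨some j, a⟩
  left_inv := by rintro ⟨_ | j, a⟩ <;> rfl
  right_inv := by rintro ⟨j | k, a⟩ <;> rfl

/-- The corresponding bijection of points. -/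
def nestPoints (m : ∀ t, τ t → Profile L) (q : Profile L → Finset L) (A : Type) :
    (Σ t : Σ o, NestIndex τ o, q (nestColour m t.1 t.2)) ⊕ A ≃ (Σ t : Σ t, τ t, q (m t.1 t.2)) ⊕ A where
  toFun
    | .inl ⟨⟨none, ⟨k, l⟩⟩, a⟩ => .inl ⟨⟨.inr k, l⟩, a⟩
    | .inl ⟨⟨some j, l⟩, a⟩ => .inl ⟨⟨.inl j, l⟩, a⟩
    | .inr a => .inr a
  invFun
    | .inl ⟨⟨.inr k, l⟩, a⟩ => .inl ⟨⟨none, ⟨k, l⟩⟩, a⟩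
    | .inl ⟨⟨.inl j, l⟩, a⟩ => .inl ⟨⟨some j, l⟩, a⟩
    | .inr a => .inr a
  left_inv := by rintro (⟨⟨_ | j, l⟩, a⟩ | a) <;> rfl
  right_inv := by rintro (⟨⟨j | k, l⟩, a⟩ | a) <;> rfl

/-- The points that get glued. -/
noncomputable def nestGlued (c : ι → Profile L) (i : ι) (d : κ → Profile L) :
    ((Σ o, (c (optionNe i o)).1) ⊕ (Σ o, (c (optionNe i o)).2)) ⊕ ((Σ k, (d k).1) ⊕ (Σ k, (d k).2)) ≃
    ((Σ t, (compColour c i d t).1) ⊕ (Σ t, (compColour c i d t).2)) ⊕ ((c i).1 ⊕ (c i).2) where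
  toFun
    | .inl (.inl ⟨none, a⟩) => .inr (.inl a)
    | .inl (.inl ⟨some j, a⟩) => .inl (.inl ⟨.inl j, a⟩)
    | .inl (.inr ⟨none, a⟩) => .inr (.inr a)
    | .inl (.inr ⟨some j, a⟩) => .inl (.inr ⟨.inl j, a⟩)
    | .inr (.inl ⟨k, a⟩) => .inl (.inl ⟨.inr k, a⟩)
    | .inr (.inr ⟨k, a⟩) => .inl (.inr ⟨.inr k, a⟩)
  invFun
    | .inr (.inl a) => .inl (.inl ⟨none, a⟩)
    | .inl (.inl ⟨.inl j, a⟩) => .inl (.inl ⟨some j, a⟩)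
    | .inr (.inr a) => .inl (.inr ⟨none, a⟩)
    | .inl (.inr ⟨.inl j, a⟩) => .inl (.inr ⟨some j, a⟩)
    | .inl (.inl ⟨.inr k, a⟩) => .inr (.inl ⟨k, a⟩)
    | .inl (.inr ⟨.inr k, a⟩) => .inr (.inr ⟨k, a⟩)
  left_inv := by rintro ((⟨_ | j, a⟩ | ⟨_ | j, a⟩) | (⟨k, a⟩ | ⟨k, a⟩)) <;> rfl
  right_inv := by rintro ((⟨j | k, a⟩ | ⟨j | k, a⟩) | (a | a)) <;> rfl

/-- The diagrams at the input circles of `D`. -/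
noncomputable def nestDiagram [Finite κ] [∀ t, Finite (τ t)] (D' : WiringDiagram d (c i))
    (K : ∀ t, WiringDiagram (m t) (compColour c i d t)) :
    ∀ o, WiringDiagram (nestColour m o) (c (optionNe i o))
  | none => D'.multi fun k => K (.inr k)
  | some j => K (.inl j)

/-- The beginning points of the inner diagram, among those of the outer one. -/
def nestBegin (m : ∀ t, τ t → Profile L) (c : ι → Profile L) (i : ι) (A : Type) :
    (Σ t : Σ k, τ (Sum.inr k), (m (Sum.inr t.1) t.2).1) ⊕ (c i).2 →
      ((Σ t : Σ o, NestIndex τ o, (nestColour m t.1 t.2).1) ⊕ A) ⊕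
        ((Σ o, (c (optionNe i o)).1) ⊕ (Σ o, (c (optionNe i o)).2))
  | .inl ⟨t, a⟩ => .inl (.inl ⟨⟨none, t⟩, a⟩)
  | .inr a => .inr (.inr ⟨none, a⟩)

/-- The ending points of the inner diagram, among those of the outer one. -/
def nestEnd (m : ∀ t, τ t → Profile L) (c : ι → Profile L) (i : ι) (A : Type) :
    (Σ t : Σ k, τ (Sum.inr k), (m (Sum.inr t.1) t.2).2) ⊕ (c i).1 →
      ((Σ t : Σ o, NestIndex τ o, (nestColour m t.1 t.2).2) ⊕ A) ⊕
        ((Σ o, (c (optionNe i o)).1) ⊕ (Σ o, (c (optionNe i o)).2))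
  | .inl ⟨t, a⟩ => .inl (.inl ⟨⟨none, t⟩, a⟩)
  | .inr a => .inr (.inl ⟨none, a⟩)

/-- The ending points of the inner diagram, among all points. -/
noncomputable def nestInner (m : ∀ t, τ t → Profile L) (c : ι → Profile L) (c₀ : Profile L) (i : ι)
    (d : κ → Profile L) :
    ((Σ t : Σ k, τ (Sum.inr k), (m (Sum.inr t.1) t.2).2) ⊕ (c i).1) ⊕
      ((Σ k, (d k).1) ⊕ (Σ k, (d k).2)) →
    ((Σ t : Σ t, τ t, (m t.1 t.2).2) ⊕ c₀.1) ⊕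
      (((Σ t, (compColour c i d t).1) ⊕ (Σ t, (compColour c i d t).2)) ⊕ ((c i).1 ⊕ (c i).2)) :=
  Sum.elim (fun y => (nestEnd m c i c₀.1 y).map (nestPoints m Prod.snd c₀.1)
    (nestGlued c i d ∘ Sum.inl)) (fun z => Sum.inr (nestGlued c i d (Sum.inr z)))

/-- The ending points of the outer diagram, among all points. -/
noncomputable def nestOuter (m : ∀ t, τ t → Profile L) (c : ι → Profile L) (c₀ : Profile L) (i : ι)
    (d : κ → Profile L) :
    ((Σ t : Σ o, NestIndex τ o, (nestColour m t.1 t.2).2) ⊕ c₀.1) ⊕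
        ((Σ o, (c (optionNe i o)).1) ⊕ (Σ o, (c (optionNe i o)).2)) →
    ((Σ t : Σ t, τ t, (m t.1 t.2).2) ⊕ c₀.1) ⊕
      (((Σ t, (compColour c i d t).1) ⊕ (Σ t, (compColour c i d t).2)) ⊕ ((c i).1 ⊕ (c i).2)) :=
  Sum.map (nestPoints m Prod.snd c₀.1) (nestGlued c i d ∘ Sum.inl)

theorem totalEndK_inr (c₀ : Profile L) (k) (t : (Σ l, (m (Sum.inr k) l).2) ⊕ (d k).1) :
    totalEndK (c := compColour c i d) m c₀.1 ((c i).1 ⊕ (c i).2) (Sum.inr k) t =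
      nestInner m c c₀ i d ((plugEnd d (fun k => m (Sum.inr k)) (c i).1).symm (Sum.inr ⟨k, t⟩)) := by
  rcases t with ⟨l, y⟩ | y <;> rfl

theorem totalEnd_compEnd' (m : ∀ t, τ t → Profile L) (c₀ : Profile L)
    (t : (Σ k, (d k).2) ⊕ (c i).1) :
    totalEnd m (compEnd' c₀ t) =
      nestInner m c c₀ i d ((plugEnd d (fun k => m (Sum.inr k)) (c i).1).symm (Sum.inl t)) := by
  rcases t with ⟨l, y⟩ | y <;> rfl

theorem plugEnd_symm_none (m : ∀ t, τ t → Profile L) (c₀ : Profile L)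
    (t : (Σ x : Σ k, τ (Sum.inr k), (m (Sum.inr x.1) x.2).2) ⊕ (c i).1) :
    (plugEnd (fun o => c (optionNe i o)) (nestColour m) c₀.1).symm (Sum.inr ⟨none, t⟩) =
      nestEnd m c i c₀.1 t := by
  rcases t with y | y <;> rfl

theorem totalEndK_inl (c₀ : Profile L) (j) (t : (Σ l, (m (Sum.inl j) l).2) ⊕ (c j).1) :
    totalEndK (c := compColour c i d) m c₀.1 ((c i).1 ⊕ (c i).2) (Sum.inl j) t =
      nestOuter m c c₀ i d ((plugEnd (fun o => c (optionNe i o)) (nestColour m) c₀.1).symm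
        (Sum.inr ⟨some j, t⟩)) := by
  rcases t with ⟨l, y⟩ | y <;> rfl

theorem totalEnd_compEnd (m : ∀ t, τ t → Profile L) (c₀ : Profile L)
    (t : (Σ o, (c (optionNe i o)).2) ⊕ c₀.1) :
    totalEnd m (compEnd d t) =
      nestOuter m c c₀ i d ((plugEnd (fun o => c (optionNe i o)) (nestColour m) c₀.1).symm
        (Sum.inl t)) := by
  rcases t with ⟨_ | j, y⟩ | y <;> rfl

/-- The strands of `plugTotal` glued in the other order: first `D'` to the diagrams at its own input
circles, then the result, with the remaining diagrams, to all circles of `D`. -/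
theorem isStage_nest [Finite ι] [Finite κ] [∀ t, Finite (τ t)] (D : WiringDiagram c c₀)
    (D' : WiringDiagram d (c i)) (K : ∀ t, WiringDiagram (m t) (compColour c i d t)) :
    IsStage (plugTotal (compStrands D i D') K) (plug (D.reindex (optionNe i)).p (nestDiagram D' K))
      (plug D'.p fun k => K (Sum.inr k)) (nestPoints m Prod.fst c₀.2) (nestPoints m Prod.snd c₀.1)
      (nestGlued c i d) (nestBegin m c i c₀.2) (nestEnd m c i c₀.1) where
  inner := by
    rintro ((⟨⟨k, l⟩, a⟩ | a) | (⟨k, a⟩ | ⟨k, a⟩))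
    · exact (plugTotal_inl_inl _ K (Sum.inr k) l a).trans (totalEndK_inr c₀ k _)
    · exact (plugTotal_inr_inr _ K (Sum.inr a)).trans
        ((congrArg _ (compStrands_inr_inr D D' a)).trans (totalEnd_compEnd' m c₀ _))
    · exact (plugTotal_inr_inl_inl _ K ⟨Sum.inr k, a⟩).trans
        ((congrArg _ (compStrands_inl_inl_inr D D' k a)).trans (totalEnd_compEnd' m c₀ _))
    · exact (plugTotal_inr_inl_inr _ K (Sum.inr k) a).trans (totalEndK_inr c₀ k _)
  glued := by
    rintro (x | x)
    · exact plugEnd_symm_none m c₀ _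
    · exact plugEnd_symm_none m c₀ _
  outer := by
    rintro ((⟨⟨_ | j, l⟩, a⟩ | a) | (⟨_ | j, a⟩ | ⟨_ | j, a⟩))
    · exact Or.inl ⟨Sum.inl ⟨l, a⟩, rfl⟩
    · exact Or.inr ((plugTotal_inl_inl _ K (Sum.inl j) l a).trans (totalEndK_inl c₀ j _))
    · exact Or.inr ((plugTotal_inl_inr _ K a).trans
        ((congrArg _ (compStrands_inl_inr D D' a)).trans (totalEnd_compEnd m c₀ _)))
    · exact Or.inr ((plugTotal_inr_inr _ K (Sum.inl a)).trans
        ((congrArg _ (compStrands_inr_inl D D' a)).trans (totalEnd_compEnd m c₀ _)))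
    · exact Or.inr ((plugTotal_inr_inl_inl _ K ⟨Sum.inl j, a⟩).trans
        ((congrArg _ (compStrands_inl_inl_inl D D' j a)).trans (totalEnd_compEnd m c₀ _)))
    · exact Or.inl ⟨Sum.inr a, rfl⟩
    · exact Or.inr ((plugTotal_inr_inl_inr _ K (Sum.inl j) a).trans (totalEndK_inl c₀ j _))

theorem nestColour_eq (m : ∀ t, τ t → Profile L) :
    (fun t : Σ o, NestIndex τ o => nestColour m t.1 t.2) =
      fun t => m (nestEquiv τ t).1 (nestEquiv τ t).2 := by
  funext ⟨o, k⟩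
  rcases o with _ | j <;> rfl

/-- By `isStage_plugTotal` and `isStage_nest` both sides result from gluing the same strands, so the
matchings coincide. This is the associativity law on which everything else rests. -/
theorem multi_nestDiagram [Finite ι] [Finite κ] [∀ t, Finite (τ t)] (D : WiringDiagram c c₀)
    (D' : WiringDiagram d (c i)) (K : ∀ t, WiringDiagram (m t) (compColour c i d t)) :
    (D.reindex (optionNe i)).multi (nestDiagram D' K) =
      cast (congrArg (fun c => WiringDiagram c c₀) (nestColour_eq m).symm)
        (((D.compAt i D').multi K).reindex (nestEquiv τ)) := by
  have h1 := isStage_plugTotal (compStrands D i D') K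
  have h2 := isStage_nest D D' K
  refine exists_eq_reindex _ _ (nestEquiv τ) (nestColour_eq m) (nestPoints m Prod.fst c₀.2)
    (nestPoints m Prod.snd c₀.1) ?_ (fun _ => rfl) ?_ (fun _ => rfl) (fun s => ?_) ?_
  · rintro ⟨_ | j, k⟩ a
    · exact ⟨a.2, rfl⟩
    · exact ⟨a.2, rfl⟩
  · rintro ⟨_ | j, k⟩ a
    · exact ⟨a.2, rfl⟩
    · exact ⟨a.2, rfl⟩
  · exact (h1.glue_eq _).symm.trans (h2.glue_eq s)
  -- Both sides count the circles already present in `D`, `D'` and the `K t` once. The two stagings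
  -- show that the circles created by gluing have the same total, although they are distributed
  -- differently.
  · have h3 := h1.card_glueLoop.symm.trans h2.card_glueLoop
    have := Fintype.ofFinite {j : ι // j ≠ i}
    have := Fintype.ofFinite κ
    have h4 : (∑ᶠ o, (nestDiagram D' K o).l) = (D'.multi fun k => K (.inr k)).l +
        ∑ j, (K (.inl j)).l := by
      rw [finsum_eq_sum_of_fintype, Fintype.sum_option]
      rfl
    have h5 : (∑ᶠ t, (K t).l) = (∑ j, (K (.inl j)).l) + ∑ k, (K (.inr k)).l := by
      rw [finsum_eq_sum_of_fintype, Fintype.sum_sum_type]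
    have h6 : (∑ᶠ k, (K (.inr k)).l) = ∑ k, (K (.inr k)).l := finsum_eq_sum_of_fintype _
    change D.l + (∑ᶠ o, (nestDiagram D' K o).l) +
      Nat.card (GlueLoop (plug (D.reindex (optionNe i)).p (nestDiagram D' K))) =
      (D.l + D'.l + Nat.card (GlueLoop (compStrands D i D'))) + (∑ᶠ t, (K t).l) +
      Nat.card (GlueLoop (plug (glue (compStrands D i D')) K))
    have h7 : (D'.multi fun k => K (.inr k)).l = D'.l + (∑ᶠ k, (K (.inr k)).l) +
      Nat.card (GlueLoop (plug D'.p fun k => K (.inr k))) := rfl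
    rw [h4, h5, h7, h6]
    omega

end MultiCompAt

end WiringDiagram

/-! ## Decorated wiring diagrams -/

namespace WiringDiagram

variable {L : Type}

/-- A wiring diagram with numbered input circles that are decorated by elements of `E`. -/
structure Decorated (E : Profile L → Type u) (c₀ : Profile L) : Type u where
  r : ℕ
  c : Fin r → Profile L
  D : WiringDiagram c c₀
  x : ∀ i, E (c i)

/-- Renumbering of the input circles. -/
def Decorated.reindex {E : Profile L → Type u} {c₀ : Profile L} (P : Decorated E c₀) {r : ℕ}
    (e : Fin r ≃ Fin P.r) : Decorated E c₀ where
  r := r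
  c i := P.c (e i)
  D := P.D.reindex e
  x i := P.x (e i)

theorem Decorated.reindex_refl {E : Profile L → Type u} {c₀ : Profile L} (P : Decorated E c₀) :
    P.reindex (Equiv.refl _) = P := by
  obtain ⟨r, c, D, x⟩ := P
  exact congrArg (fun D => (⟨r, c, D, x⟩ : Decorated E c₀)) (WiringDiagram.reindex_refl D)

theorem Decorated.reindex_reindex {E : Profile L → Type u} {c₀ : Profile L} (P : Decorated E c₀)
    {r s : ℕ} (e : Fin r ≃ Fin P.r) (f : Fin s ≃ Fin r) :
    (P.reindex e).reindex f = P.reindex (f.trans e) := by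
  obtain ⟨r, c, D, x⟩ := P
  exact congrArg (fun D => (⟨s, _, D, fun i => x (e (f i))⟩ : Decorated E c₀))
    (WiringDiagram.reindex_reindex D e f)

/-- Decorated diagrams that differ by a renumbering of the input circles. -/
def decoratedSetoid (E : Profile L → Type u) (c₀ : Profile L) : Setoid (Decorated E c₀) where
  r P Q := ∃ (r : ℕ) (e : Fin r ≃ Fin Q.r), P = Q.reindex e
  iseqv :=
    { refl := fun P => ⟨_, Equiv.refl _, P.reindex_refl.symm⟩
      symm := by
        rintro _ Q ⟨r, e, rfl⟩
        refine ⟨_, e.symm, ?_⟩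
        rw [Decorated.reindex_reindex, Equiv.symm_trans_self, Decorated.reindex_refl]
      trans := by
        rintro _ _ R ⟨r, e, rfl⟩ ⟨s, f, rfl⟩
        exact ⟨_, e.trans f, R.reindex_reindex f e⟩ }

/-- Decorated diagrams up to renumbering of the input circles. -/
def DecClass (E : Profile L → Type u) (c₀ : Profile L) : Type u :=
  Quotient (decoratedSetoid E c₀)

variable {E : Profile L → Type u} {c₀ : Profile L} {ι ι' : Type} {c : ι → Profile L}

/-- The class of a decorated diagram whose input circles are indexed by a finite type. -/
noncomputable def node [Finite ι] (D : WiringDiagram c c₀) (x : ∀ i, E (c i)) : DecClass E c₀ :=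
  Quotient.mk (decoratedSetoid E c₀)
    ⟨Nat.card ι, _, D.reindex (Finite.equivFin ι).symm, fun i => x ((Finite.equivFin ι).symm i)⟩

/-- The numbering of a finite index type is immaterial, so `node` may be used with any of them and
not only with initial segments. -/
theorem mk_reindex {r s : ℕ} (D : WiringDiagram c c₀) (x : ∀ i, E (c i))
    (e : Fin r ≃ ι) (f : Fin s ≃ ι) :
    (Quotient.mk (decoratedSetoid E c₀) ⟨r, _, D.reindex e, fun i => x (e i)⟩) =
      Quotient.mk (decoratedSetoid E c₀) ⟨s, _, D.reindex f, fun i => x (f i)⟩ := by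
  obtain ⟨g, rfl⟩ : ∃ g : Fin r ≃ Fin s, e = g.trans f := ⟨e.trans f.symm, by ext; simp⟩
  refine Quotient.sound ⟨r, g, ?_⟩
  exact congrArg (fun D => (⟨r, _, D, fun i => x (f (g i))⟩ : Decorated E c₀))
    (WiringDiagram.reindex_reindex D f g).symm

theorem node_reindex [Finite ι] [Finite ι'] (D : WiringDiagram c c₀) (x : ∀ i, E (c i))
    (e : ι' ≃ ι) : node (D.reindex e) (fun i => x (e i)) = node D x := by
  refine Eq.trans ?_ (mk_reindex D x ((Finite.equivFin ι').symm.trans e) _)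
  exact congrArg (fun D => Quotient.mk (decoratedSetoid E c₀)
    ⟨Nat.card ι', _, D, fun i => x (e ((Finite.equivFin ι').symm i))⟩)
    (WiringDiagram.reindex_reindex D e (Finite.equivFin ι').symm)

theorem node_fin {r : ℕ} {c : Fin r → Profile L} (D : WiringDiagram c c₀) (x : ∀ i, E (c i)) :
    node D x = Quotient.mk (decoratedSetoid E c₀) ⟨r, c, D, x⟩ := by
  refine (mk_reindex D x _ (Equiv.refl _)).trans ?_
  exact congrArg (fun D => Quotient.mk (decoratedSetoid E c₀) ⟨r, c, D, x⟩)
    (WiringDiagram.reindex_refl D)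

theorem exists_eq_node (q : DecClass E c₀) :
    ∃ (r : ℕ) (c : Fin r → Profile L) (D : WiringDiagram c c₀) (x : ∀ i, E (c i)), q = node D x := by
  induction q using Quotient.ind with | _ P =>
  obtain ⟨r, c, D, x⟩ := P
  exact ⟨r, c, D, x, (node_fin D x).symm⟩

theorem exists_eq_nodes {c : ι → Profile L} (q : ∀ i, DecClass E (c i)) :
    ∃ P : ∀ i, Decorated E (c i), q = fun i => node (P i).D (P i).x := by
  refine ⟨fun i => (q i).out, funext fun i => ?_⟩
  rw [node_fin]
  exact (Quotient.out_eq (q i)).symm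

theorem node_eq_of_cast [Finite ι] [Finite ι'] {c' : ι' → Profile L} {D : WiringDiagram c c₀}
    {D' : WiringDiagram c' c₀} {x : ∀ i, E (c i)} {x' : ∀ i, E (c' i)} (e : ι ≃ ι')
    (hc : c = fun i => c' (e i))
    (hD : D = cast (congrArg (fun c => WiringDiagram c c₀) hc.symm) (D'.reindex e))
    (hx : ∀ i, HEq (x i) (x' (e i))) : node D x = node D' x' := by
  subst hc
  obtain rfl : x = fun i => x' (e i) := funext fun i => eq_of_heq (hx i)
  rw [hD]
  exact node_reindex D' x' e

section Graft

variable {κ : ι → Type} {d : ∀ i, κ i → Profile L}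

/-- Insertion of decorated diagrams into the input circles of `D`. -/
noncomputable def graft [Finite ι] (D : WiringDiagram c c₀) (q : ∀ i, DecClass E (c i)) :
    DecClass E c₀ :=
  node (D.multi fun i => (q i).out.D) (fun t => (q t.1).out.x t.2)

theorem node_multi_congr [Finite ι] (D : WiringDiagram c c₀) {P Q : ∀ i, Decorated E (c i)}
    (h : ∀ i, (decoratedSetoid E (c i)) (P i) (Q i)) :
    node (D.multi fun i => (P i).D) (fun t => (P t.1).x t.2) =
      node (D.multi fun i => (Q i).D) (fun t => (Q t.1).x t.2) := by
  choose r e he using h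
  obtain rfl : P = fun i => (Q i).reindex (e i) := funext he
  refine Eq.trans ?_ (node_reindex (D.multi fun i => (Q i).D) (fun t => (Q t.1).x t.2)
    (Equiv.sigmaCongrRight e))
  exact congrArg (fun D => node D _) (multi_reindex_right D (fun i => (Q i).D) e)

/-- `graft` works with representatives chosen by `Quotient.out`; `node_multi_congr` shows that any
others, here numberings of the `K i`, serve as well. -/
theorem graft_node [Finite ι] [∀ i, Finite (κ i)] (D : WiringDiagram c c₀)
    (K : ∀ i, WiringDiagram (d i) (c i)) (x : ∀ i k, E (d i k)) :
    (graft D fun i => node (K i) (x i)) = node (D.multi K) fun t => x t.1 t.2 := by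
  have h1 := node_multi_congr D (P := fun i => (node (K i) (x i)).out)
    (Q := fun i => ⟨Nat.card (κ i), _, (K i).reindex (Finite.equivFin _).symm,
      fun k => x i ((Finite.equivFin _).symm k)⟩) fun i => Quotient.exact (Quotient.out_eq _)
  refine h1.trans (Eq.trans ?_ (node_reindex (D.multi K) (fun t => x t.1 t.2)
    (Equiv.sigmaCongrRight fun i => (Finite.equivFin (κ i)).symm)))
  exact congrArg (fun D => node D _) (multi_reindex_right D K fun i => (Finite.equivFin (κ i)).symm)

theorem graft_reindex [Finite ι] [Finite ι'] (D : WiringDiagram c c₀) (q : ∀ i, DecClass E (c i))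
    (e : ι' ≃ ι) : (graft (D.reindex e) fun i => q (e i)) = graft D q := by
  obtain ⟨P, rfl⟩ := exists_eq_nodes q
  rw [graft_node, graft_node]
  refine Eq.trans ?_ (node_reindex (D.multi fun i => (P i).D) (fun t => (P t.1).x t.2)
    (Equiv.sigmaCongrLeft (β := fun i => Fin (P i).r) e))
  exact congrArg (fun D => node D _) (multi_reindex_left D (fun i => (P i).D) e)

/-- The identity diagram decorated by `x`. -/
noncomputable def leaf (x : E c₀) : DecClass E c₀ := node (ident c₀) fun _ => x

/-- Relabelling input circles becomes grafting of label-permuting diagrams, so invariance under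
labels can later be derived from facts about grafting. The trivial relabelling gives `graft_leaf`.
-/
theorem node_conj [Finite ι] (D : WiringDiagram c c₀)
    (θ : ∀ i, Equiv.Perm (c i).1 × Equiv.Perm (c i).2) (x : ∀ i, E (c i)) :
    node (D.conj θ) x = graft D fun i => node (permDiag (θ i)) fun _ => x i := by
  rw [graft_node, multi_permDiag]
  exact (node_reindex (D.conj θ) x (Equiv.sigmaUnique ι fun _ => Fin 1)).symm

theorem graft_leaf [Finite ι] (D : WiringDiagram c c₀) (x : ∀ i, E (c i)) :
    (graft D fun i => leaf (x i)) = node D x := by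
  have h := node_conj D (fun _ => 1) x
  rw [conj_one] at h
  simp only [permDiag_one] at h
  exact h.symm

theorem node_conjOut [Finite ι] {S : Profile L} (D : WiringDiagram c S)
    (θ : Equiv.Perm S.1 × Equiv.Perm S.2) (x : ∀ i, E (c i)) :
    node (D.conjOut θ) x = graft (permDiag θ) fun _ => node D x := by
  rw [graft_node, permDiag_multi]
  exact (node_reindex (D.conjOut θ) x (forgetFin ι)).symm

theorem graft_ident (q : DecClass E c₀) : (graft (ident c₀) fun _ => q) = q := by
  obtain ⟨r, c, D, x, rfl⟩ := exists_eq_node q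
  rw [← permDiag_one, ← node_conjOut, conjOut_one]

theorem graft_permDiag_permDiag {S : Profile L} (θ θ' : Equiv.Perm S.1 × Equiv.Perm S.2) (x : E S) :
    (graft (permDiag θ) fun _ => node (permDiag θ') fun _ => x) =
      node (permDiag (θ * θ')) fun _ => x := by
  rw [← node_conjOut]
  refine congrArg (fun D => node D _) (WiringDiagram.ext (Equiv.ext ?_) rfl)
  rintro (a | a) <;> rfl

/-- The decorations of the nested diagram. -/
def nestDecoration {κ : Type} {i : ι} {τ : {j : ι // j ≠ i} ⊕ κ → Type} {m : ∀ t, τ t → Profile L}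
    (x : ∀ t k, E (m t k)) : ∀ o k, E (nestColour m o k)
  | none => fun k => x (.inr k.1) k.2
  | some j => fun k => x (.inl j) k

theorem insertInput_self {i : ι} (a : E (c i)) (x : ∀ j : {j // j ≠ i}, E (c j)) :
    insertInput i a x i = a := by
  simp [insertInput]

theorem insertInput_of_ne {i : ι} (a : E (c i)) (x : ∀ j : {j // j ≠ i}, E (c j)) {j : ι}
    (h : j ≠ i) : insertInput i a x j = x ⟨j, h⟩ := by
  simp [insertInput, h]

theorem eq_insertInput {i : ι} {a : E (c i)} {x : ∀ j : {j // j ≠ i}, E (c j)} {y : ∀ j, E (c j)}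
    (h : y i = a) (h' : ∀ j : {j // j ≠ i}, y j = x j) : y = insertInput i a x := by
  funext j
  by_cases hj : j = i
  · subst hj
    rw [insertInput_self, h]
  · rw [insertInput_of_ne a x hj, ← h']

/-- This is `multi_nestDiagram` with decorations carried along. It is the composition axiom that
makes decorated diagrams an algebra over the operad. -/
theorem graft_insertInput [Finite ι] {κ : Type} [Finite κ] {i : ι} {d : κ → Profile L}
    (D : WiringDiagram c c₀) (D' : WiringDiagram d (c i)) (q : ∀ t, DecClass E (compColour c i d t)) :
    graft D (insertInput i (graft D' fun k => q (.inr k)) fun j => q (.inl j)) =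
      graft (D.compAt i D') q := by
  obtain ⟨P, rfl⟩ := exists_eq_nodes q
  rw [graft_node (D.compAt i D'), ← graft_reindex D _ (optionNe i)]
  have h : (fun o => insertInput (E := DecClass E) i
      (graft D' fun k => node (P (.inr k)).D (P (.inr k)).x)
      (fun j => node (P (.inl j)).D (P (.inl j)).x) (optionNe i o)) =
      fun o => node (nestDiagram D' (fun t => (P t).D) o) (nestDecoration (fun t => (P t).x) o) := by
    funext o
    rcases o with _ | j
    · refine (insertInput_self _ _).trans ?_
      exact graft_node D' (fun k => (P (.inr k)).D) fun k => (P (.inr k)).x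
    · exact insertInput_of_ne _ _ j.2
  refine (congrArg (graft (D.reindex (optionNe i))) h).trans ((graft_node _ _ _).trans ?_)
  refine node_eq_of_cast (nestEquiv _) (nestColour_eq _) (multi_nestDiagram D D' _) ?_
  rintro ⟨_ | j, k⟩ <;> rfl

end Graft

end WiringDiagram

/-! ## Algebras in sets over the operad of wiring diagrams -/

open WiringDiagram

/-- An algebra in sets over the operad of wiring diagrams. -/
structure SetAlgebra {L : Type} (A : Profile L → Type u) where
  act : ∀ {r : ℕ} {c : Fin r → Profile L} {c₀ : Profile L}, WiringDiagram c c₀ →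
    (∀ i, A (c i)) → A c₀
  act_ident : ∀ (c₀ : Profile L) (x : A c₀), act (WiringDiagram.ident c₀) (fun _ => x) = x
  act_comp : ∀ {r s : ℕ} {c : Fin r → Profile L} {c₀ : Profile L} (D : WiringDiagram c c₀)
    (i : Fin r) {d : Fin s → Profile L} (D' : WiringDiagram d (c i))
    (x : ∀ j : {j // j ≠ i}, A (c j)) (y : ∀ m, A (d m)),
    act (D.comp i D') (fun m => WiringDiagram.compInputs x y (WiringDiagram.slot i s m)) =
      act D (insertInput i (act D' y) x)
  act_perm : ∀ {r : ℕ} {c : Fin r → Profile L} {c₀ : Profile L} (D : WiringDiagram c c₀)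
    (σ : Equiv.Perm (Fin r)) (x : ∀ j, A (c j)), act (D.reindex σ) (fun j => x (σ j)) = act D x

namespace SetAlgebra

variable {L : Type} {A : Profile L → Type u} (𝒜 : SetAlgebra A) {c₀ : Profile L}

/-- Evaluation of decorated diagrams. -/
def eval (q : DecClass A c₀) : A c₀ :=
  Quotient.lift (s := decoratedSetoid A c₀) (fun P => 𝒜.act P.D P.x) (by
    rintro _ ⟨r, c, D, x⟩ ⟨r', e, rfl⟩
    -- The axiom `act_perm` concerns permutations of a fixed `Fin r`; a renumbering between two
    -- initial segments is one, as their lengths agree.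
    obtain rfl : r' = r := by simpa using Fintype.card_congr e
    exact 𝒜.act_perm D e x) q

theorem eval_node {r : ℕ} {c : Fin r → Profile L} (D : WiringDiagram c c₀) (x : ∀ i, A (c i)) :
    𝒜.eval (node D x) = 𝒜.act D x := by
  rw [node_fin]
  rfl

theorem eval_leaf (x : A c₀) : 𝒜.eval (leaf x) = x :=
  (𝒜.eval_node _ _).trans (𝒜.act_ident c₀ x)

/-- The axioms know only composition at one circle, so the inputs are opened one at a time, by
induction on the number of inputs that are not leaves. When all inputs are leaves, the claim is the
unit law. -/
theorem eval_graft_fin {r : ℕ} {c : Fin r → Profile L} (D : WiringDiagram c c₀)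
    (q : ∀ i, DecClass A (c i)) : 𝒜.eval (graft D q) = 𝒜.act D fun i => 𝒜.eval (q i) := by
  classical
  induction hn : Fintype.card {i // ¬ ∃ x, q i = leaf x} using Nat.strong_induction_on
    generalizing r with | _ n ih =>
  by_cases hq : ∀ i, ∃ x, q i = leaf x
  · choose x hx using hq
    obtain rfl : q = fun i => leaf (x i) := funext hx
    simp only [graft_leaf, eval_node, eval_leaf]
  · push Not at hq
    obtain ⟨i, hi⟩ := hq
    obtain ⟨s, d, D', y, hy⟩ := exists_eq_node (q i)
    -- The diagram of the `i`-th input is absorbed into `D`; its decorations remain as inputs, and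
    -- these are leaves.
    let q' : ∀ t, DecClass A (compColour c i d t) :=
      compInputs (fun j : {j // j ≠ i} => q j) fun k => leaf (y k)
    have h1 : graft D q = graft (D.comp i D') fun m => q' (slot i s m) := by
      have h2 := graft_insertInput D D' q'
      rw [← graft_reindex (D.compAt i D') q' (slot i s)] at h2
      refine Eq.trans (congrArg (graft D) (eq_insertInput ?_ fun j => rfl)) h2
      rw [hy]
      exact (graft_leaf D' y).symm
    have h3 : Fintype.card {m // ¬ ∃ x, q' (slot i s m) = leaf x} < n := by
      have key : ∀ t, (¬ ∃ x, q' t = leaf x) → ∃ j, t = .inl j ∧ ¬ ∃ x, q j.1 = leaf x := by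
        rintro (j | k) ht
        · exact ⟨j, rfl, ht⟩
        · exact absurd ⟨y k, rfl⟩ ht
      choose f hf hf' using key
      subst hn
      -- Inputs of the new diagram that are not leaves stem from such inputs of the old one, and the
      -- index `i` no longer occurs.
      refine Fintype.card_lt_of_injective_of_notMem
        (fun m => ⟨(f (slot i s m.1) m.2).1, hf' _ m.2⟩) (b := ⟨i, fun ⟨x, hx⟩ => hi x hx⟩) ?_ ?_
      · rintro ⟨m, hm⟩ ⟨m', hm'⟩ h
        have h0 := Subtype.ext_iff.1 h
        have h4 : f (slot i s m) hm = f (slot i s m') hm' := Subtype.ext h0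
        refine Subtype.ext ((slot i s).injective ?_)
        exact (hf _ hm).trans ((congrArg Sum.inl h4).trans (hf _ hm').symm)
      · rintro ⟨⟨m, hm⟩, h⟩
        exact (f (slot i s m) hm).2 (congrArg Subtype.val h)
    rw [h1, ih _ h3 (D.comp i D') (fun m => q' (slot i s m)) rfl]
    have h5 : ∀ t, 𝒜.eval (q' t) = compInputs (fun j : {j // j ≠ i} => 𝒜.eval (q j)) y t := by
      rintro (j | k)
      · rfl
      · exact 𝒜.eval_leaf _
    simp only [h5]
    rw [𝒜.act_comp]
    refine congrArg (𝒜.act D) (eq_insertInput (y := fun j => 𝒜.eval (q j)) ?_ fun j => rfl).symm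
    rw [hy, eval_node]

variable {ι : Type} [Finite ι] {c : ι → Profile L}

theorem eval_graft (D : WiringDiagram c c₀) (q : ∀ i, DecClass A (c i)) :
    𝒜.eval (graft D q) = 𝒜.eval (node D fun i => 𝒜.eval (q i)) := by
  rw [← graft_reindex D q (Finite.equivFin ι).symm, eval_graft_fin, ← eval_node]
  exact congrArg 𝒜.eval (node_reindex D (fun i => 𝒜.eval (q i)) (Finite.equivFin ι).symm)

end SetAlgebra

/-! ### The free algebra in sets and associativity of grafting -/

namespace WiringDiagram

variable {L : Type} {E : Profile L → Type u} {c₀ : Profile L}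

/-- The free algebra in sets. -/
noncomputable def freeSetAlgebra (E : Profile L → Type u) : SetAlgebra (DecClass E) where
  act := graft
  act_ident _ := graft_ident
  act_comp D i _ D' x y :=
    (graft_reindex (D.compAt i D') (compInputs x y) (slot i _)).trans
      (graft_insertInput D D' (compInputs x y)).symm
  act_perm D σ x := graft_reindex D x σ

theorem eval_freeSetAlgebra {ι : Type} [Finite ι] {c : ι → Profile L} (D : WiringDiagram c c₀)
    (q : ∀ i, DecClass E (c i)) : (freeSetAlgebra E).eval (node D q) = graft D q := by
  rw [← node_reindex D q (Finite.equivFin ι).symm, SetAlgebra.eval_node]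
  exact graft_reindex D q (Finite.equivFin ι).symm

/-- In the free algebra evaluation is grafting, so `eval_graft` reads as associativity of
simultaneous composition. No second gluing argument is needed. -/
theorem graft_multi {ι : Type} [Finite ι] {c : ι → Profile L} {κ : ι → Type} [∀ i, Finite (κ i)]
    {d : ∀ i, κ i → Profile L} (D : WiringDiagram c c₀) (K : ∀ i, WiringDiagram (d i) (c i))
    (q : ∀ i k, DecClass E (d i k)) :
    (graft (D.multi K) fun t => q t.1 t.2) = graft D fun i => graft (K i) (q i) := by
  have h := (freeSetAlgebra E).eval_graft D fun i => node (K i) (q i)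
  rw [graft_node, eval_freeSetAlgebra, eval_freeSetAlgebra] at h
  simpa only [eval_freeSetAlgebra] using h

end WiringDiagram

/-! ## Graphs and wiring diagrams -/

namespace WiringDiagram

variable {L ι ι' : Type} {c : ι → Profile L} {c₀ : Profile L}

/-- The bijection of points induced by a renumbering of the circles and permutations of labels. -/
def labelPoints (c : ι → Profile L) (q : Profile L → Finset L) (A : Type) (s : ι' ≃ ι)
    (σ : ∀ i, Equiv.Perm (q (c i))) : (Σ i, q (c (s i))) ⊕ A ≃ (Σ i, q (c i)) ⊕ A :=
  (reindexPoints c q A s).trans ((Equiv.sigmaCongrRight σ).sumCongr (Equiv.refl _))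

/-- The inverses hidden in `conj` and `reindex` are moved to the other side, so that the two
diagrams are compared by pushing points forward. -/
theorem eq_conj_reindex_iff {D : WiringDiagram c c₀} {s : ι' ≃ ι}
    {θ : ∀ i, Equiv.Perm (c i).1 × Equiv.Perm (c i).2} {D' : WiringDiagram (fun i => c (s i)) c₀} :
    D' = (D.conj θ).reindex s ↔
      (∀ y, D.p (labelPoints c Prod.fst c₀.2 s (fun i => (θ i).1) y) =
        labelPoints c Prod.snd c₀.1 s (fun i => (θ i).2) (D'.p y)) ∧ D'.l = D.l := by
  have key : ∀ y z, (D.conj θ).p (reindexPoints c Prod.fst c₀.2 s y) = reindexPoints c Prod.snd c₀.1 s z ↔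
      D.p (labelPoints c Prod.fst c₀.2 s (fun i => (θ i).1) y) =
        labelPoints c Prod.snd c₀.1 s (fun i => (θ i).2) z := fun y z =>
    Equiv.symm_apply_eq ((Equiv.sigmaCongrRight fun i => (θ i).2).sumCongr (Equiv.refl _))
  constructor
  · rintro rfl
    exact ⟨fun y => (key y _).1 (p_reindexPoints (D.conj θ) s y), rfl⟩
  · rintro ⟨h, hl⟩
    exact eq_reindex (D := D.conj θ) (fun y => (key y _).2 (h y)) hl

end WiringDiagram

/-- The orbits of a fixed point free involution have two elements, and a representative of each
orbit tells them apart. Thus the flags of free loops are known, together with their matching, from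
half their number. -/
theorem exists_equiv_prod_bool {O : Type} [Finite O] (o : O → O) (oo : ∀ x, o (o x) = x)
    (o_ne : ∀ x, o x ≠ x) : ∃ e : Fin (Nat.card O / 2) × Bool ≃ O, ∀ x, e (x.1, !x.2) = o (e x) := by
  let Q := Quot fun x y => y = o x
  have hQ : ∀ x y, (Quot.mk _ x : Q) = Quot.mk _ y → y = x ∨ y = o x := by
    intro x y h
    -- The pair `{x, o x}` is constant along the relation, so it detects equality in the quotient by
    -- the equivalence that the relation generates.
    have h1 := congrArg (Quot.lift (fun x => ({x, o x} : Set O)) (by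
      rintro x _ rfl
      rw [oo, Set.pair_comm])) h
    have h2 : y ∈ ({x, o x} : Set O) := by
      rw [show ({x, o x} : Set O) = {y, o y} from h1]
      exact Set.mem_insert _ _
    exact h2
  have hmk : ∀ x, (Quot.mk _ (o x) : Q) = Quot.mk _ x := fun x => (Quot.sound (r := fun x y => y = o x) rfl).symm
  let f : Q × Bool → O := fun x => bif x.2 then x.1.out else o x.1.out
  have hout : ∀ q : Q, (Quot.mk _ q.out : Q) = q := fun q => Quot.out_eq q
  have hf : ∀ x, (Quot.mk _ (f x) : Q) = x.1 := by
    rintro ⟨q, _ | _⟩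
    · exact (hmk _).trans (hout q)
    · exact hout q
  have hbij : Function.Bijective f := by
    constructor
    · rintro ⟨q, ε⟩ ⟨q', ε'⟩ h
      obtain rfl : q = q' := (hf (q, ε)).symm.trans ((congrArg (Quot.mk _) h).trans (hf (q', ε')))
      rcases ε with _ | _ <;> rcases ε' with _ | _
      · rfl
      · exact absurd h (o_ne _)
      · exact absurd h.symm (o_ne _)
      · rfl
    · intro x
      rcases hQ _ _ (hout (Quot.mk _ x)) with h | h
      · exact ⟨(Quot.mk _ x, true), h.symm⟩
      · exact ⟨(Quot.mk _ x, false), h.symm⟩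
  have hcard : Nat.card O / 2 = Nat.card Q := by
    rw [← Nat.card_congr (Equiv.ofBijective f hbij), Nat.card_prod]
    simp
  refine ⟨((finCongr hcard).trans (Finite.equivFin Q).symm).prodCongr (Equiv.refl _) |>.trans
    (Equiv.ofBijective f hbij), ?_⟩
  rintro ⟨i, _ | _⟩
  · exact (oo _).symm
  · rfl

namespace FlagGraph

variable {L V V' F F' : Type} {b : Profile L}

section OtherEnd

variable {c : V → Profile L} (G : FlagGraph c b F) {ε ε' : ℤˣ} (hε : ε' = -ε)

theorem otherEnd_inl_of_eq {f : G.VFlag ε} (h : G.ι f.1 = f.1) :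
    G.otherEnd hε (.inl f) = .inr ⟨f.1, h, f.2.2⟩ := dif_pos h

theorem otherEnd_inl_of_ne {f : G.VFlag ε} (h : ¬ G.ι f.1 = f.1) :
    ∃ h', G.otherEnd hε (.inl f) = .inl ⟨G.ι f.1, h'⟩ := ⟨_, dif_neg h⟩

theorem otherEnd_inr_of_eq {f : G.BFlag ε'} (h : G.cell f.1 = none) :
    ∃ h', G.otherEnd hε (.inr f) = .inr ⟨(G.π ⟨f.1, h, f.2.1⟩).1, h'⟩ := ⟨_, dif_pos h⟩

theorem otherEnd_inr_of_ne {f : G.BFlag ε'} (h : ¬ G.cell f.1 = none) :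
    G.otherEnd hε (.inr f) = .inl ⟨f.1, h, f.2.2⟩ := dif_neg h

variable {G hε}

theorem otherEnd_inl_eq_inl {f : G.VFlag ε} {g} (h : G.otherEnd hε (.inl f) = .inl g) :
    G.ι f.1 ≠ f.1 ∧ g.1 = G.ι f.1 := by
  by_cases hf : G.ι f.1 = f.1
  · rw [G.otherEnd_inl_of_eq hε hf] at h
    exact absurd h Sum.inr_ne_inl
  · obtain ⟨_, h'⟩ := G.otherEnd_inl_of_ne hε hf
    exact ⟨hf, congrArg Subtype.val (Sum.inl_injective (h.symm.trans h'))⟩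

theorem otherEnd_inr_eq_inr {f : G.BFlag ε'} {g} (h : G.otherEnd hε (.inr f) = .inr g) :
    ∃ hf : G.cell f.1 = none, g.1 = (G.π ⟨f.1, hf, f.2.1⟩).1 := by
  by_cases hf : G.cell f.1 = none
  · obtain ⟨_, h'⟩ := G.otherEnd_inr_of_eq hε hf
    exact ⟨hf, congrArg Subtype.val (Sum.inr_injective (h.symm.trans h'))⟩
  · rw [G.otherEnd_inr_of_ne hε hf] at h
    exact absurd h Sum.inl_ne_inr

theorem otherEnd_inr_eq_inl {f : G.BFlag ε'} {g} (h : G.otherEnd hε (.inr f) = .inl g) :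
    G.cell f.1 ≠ none ∧ g.1 = f.1 := by
  by_cases hf : G.cell f.1 = none
  · obtain ⟨_, h'⟩ := G.otherEnd_inr_of_eq hε hf
    exact absurd (h'.symm.trans h) Sum.inr_ne_inl
  · rw [G.otherEnd_inr_of_ne hε hf] at h
    exact ⟨hf, (congrArg Subtype.val (Sum.inl_injective h)).symm⟩

end OtherEnd

section Diagram

/-- The wiring diagram of a graph. -/
noncomputable def toDiagram {c : V → Profile L} (G : FlagGraph c b F) :
    WiringDiagram (fun v => (c v).swap) b.swap where
  p := ((G.vertexLabel Prod.snd G.lam_out).sumCongr (G.boundaryLabel G.beta_in)).symm.trans <|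
    G.edge.trans <| (G.vertexLabel Prod.fst G.lam_in).sumCongr (G.boundaryLabel G.beta_out)
  l := Nat.card G.LoopFlag / 2

variable {c : V → Profile L} (G : FlagGraph c b F)

theorem toDiagram_p (x : G.VFlag (-1) ⊕ G.BFlag 1) :
    G.toDiagram.p (x.map (G.vertexLabel Prod.snd G.lam_out) (G.boundaryLabel G.beta_in)) =
      (G.edge x).map (G.vertexLabel Prod.fst G.lam_in) (G.boundaryLabel G.beta_out) := by
  have h := ((G.vertexLabel Prod.snd G.lam_out).sumCongr
    (G.boundaryLabel G.beta_in)).symm_apply_apply x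
  exact congrArg (fun x => (G.edge x).map (G.vertexLabel Prod.fst G.lam_in)
    (G.boundaryLabel G.beta_out)) h

theorem cell_eq_vertexLabel {ε : ℤˣ} (q : Profile L → Finset L) (h) (f : G.VFlag ε) :
    G.cell f.1 = some (G.vertexLabel q h f).1 := (Option.some_get _).symm

end Diagram

end FlagGraph

/-- The permutations of outgoing and of incoming labels. -/
def LabelGroup.perms {L : Type} {b : Profile L} (g : LabelGroup b) :
    Equiv.Perm b.swap.1 × Equiv.Perm b.swap.2 :=
  (g.2.unop⁻¹, g.1)

/-- The action on labels of flags of sign `ε`. -/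
noncomputable def actSign {L : Type} {b : Profile L} (ε : ℤˣ) (g : LabelGroup b) : Equiv.Perm L :=
  if ε = 1 then actIn g else actOut g

/-! ### Isomorphic graphs have the same diagram up to numbering and labels -/

namespace FlagGraph

variable {L V V' F F' : Type} {b : Profile L}

/-- An isomorphism of graphs that renumbers the vertices along `s` and changes the labels of the
flags at the vertices by `θ`. -/
structure IsIso {c' : V' → Profile L} {s : V ≃ V'} (G : FlagGraph (fun v => c' (s v)) b F)
    (G' : FlagGraph c' b F') (φ : F ≃ F') (θ : ∀ v', LabelGroup (c' v')) : Prop where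
  cell : ∀ f, G'.cell (φ f) = (G.cell f).map s
  ι : ∀ f, G'.ι (φ f) = φ (G.ι f)
  π : ∀ f h h', (G'.π ⟨φ f, h'⟩).1 = φ (G.π ⟨f, h⟩).1
  δ : ∀ f h h', G'.δ ⟨φ f, h'⟩ = G.δ ⟨f, h⟩
  beta : ∀ f h h', G'.beta ⟨φ f, h'⟩ = G.beta ⟨f, h⟩
  lam : ∀ f h h' v', G'.cell (φ f) = some v' →
    G'.lam ⟨φ f, h'⟩ = actSign (G.δ ⟨f, Or.inl h⟩) (θ v') (G.lam ⟨f, h⟩)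

variable {c' : V' → Profile L} {s : V ≃ V'} {G : FlagGraph (fun v => c' (s v)) b F}
  {G' : FlagGraph c' b F'} {θ : ∀ v', LabelGroup (c' v')}

namespace IsIso

variable {φ : F ≃ F'} (h : IsIso G G' φ θ)

theorem cell_eq_none_iff (h : IsIso G G' φ θ) (f : F) : G'.cell (φ f) = none ↔ G.cell f = none := by
  rw [h.cell, Option.map_eq_none_iff]

theorem ι_eq_iff (h : IsIso G G' φ θ) (f : F) : G'.ι (φ f) = φ f ↔ G.ι f = f := by
  rw [h.ι, φ.apply_eq_iff_eq]

/-- The induced map of flags at vertices. -/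
def vflag (ε : ℤˣ) (f : G.VFlag ε) : G'.VFlag ε :=
  ⟨φ f.1, fun hf => f.2.1 ((h.cell_eq_none_iff _).1 hf), (h.δ _ _ _).trans f.2.2⟩

/-- The induced map of boundary flags. -/
def bflag (ε : ℤˣ) (f : G.BFlag ε) : G'.BFlag ε :=
  ⟨φ f.1, (h.ι_eq_iff _).2 f.2.1, (h.δ _ _ _).trans f.2.2⟩

/-- The induced bijection of flags of free loops. -/
def loopFlag : G.LoopFlag ≃ G'.LoopFlag :=
  φ.subtypeEquiv fun f => by rw [h.cell_eq_none_iff, ne_eq, ne_eq, h.ι_eq_iff]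

theorem otherEnd {ε ε' : ℤˣ} (hε : ε' = -ε) (x : G.VFlag ε ⊕ G.BFlag ε') :
    G'.otherEnd hε (x.map (h.vflag ε) (h.bflag ε')) =
      (G.otherEnd hε x).map (h.vflag ε') (h.bflag ε) := by
  rcases x with f | f
  · by_cases hf : G.ι f.1 = f.1
    · rw [G.otherEnd_inl_of_eq hε hf]
      exact G'.otherEnd_inl_of_eq hε (f := h.vflag ε f) ((h.ι_eq_iff _).2 hf)
    · obtain ⟨h1, h2⟩ := G.otherEnd_inl_of_ne hε hf
      obtain ⟨h3, h4⟩ := G'.otherEnd_inl_of_ne hε (f := h.vflag ε f)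
        (fun h' => hf ((h.ι_eq_iff _).1 h'))
      rw [h2]
      refine h4.trans (congrArg Sum.inl (Subtype.ext (h.ι _)))
  · by_cases hf : G.cell f.1 = none
    · obtain ⟨h1, h2⟩ := G.otherEnd_inr_of_eq hε hf
      obtain ⟨h3, h4⟩ := G'.otherEnd_inr_of_eq hε (f := h.bflag ε' f)
        ((h.cell_eq_none_iff _).2 hf)
      rw [h2]
      refine h4.trans (congrArg Sum.inr (Subtype.ext (h.π _ _ _)))
    · rw [G.otherEnd_inr_of_ne hε hf]
      exact G'.otherEnd_inr_of_ne hε (f := h.bflag ε' f) (fun h' => hf ((h.cell_eq_none_iff _).1 h'))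

theorem vertexLabel_vflag {ε : ℤˣ} {q : Profile L → Finset L} (hG hG')
    (σ : ∀ v', Equiv.Perm (q (c' v')))
    (hσ : ∀ v' (a : q (c' v')), actSign ε (θ v') a = σ v' a) (f : G.VFlag ε) :
    G'.vertexLabel q hG' (h.vflag ε f) =
      Equiv.sigmaCongrRight σ (Equiv.sigmaCongrLeft (β := fun v' => (q (c' v') : Type)) s
        (G.vertexLabel q hG f)) := by
  have h1 := h.cell f.1
  rw [cell_eq_vertexLabel G q hG f] at h1
  refine sigma_label_ext ?_ ?_
  · exact Option.some_injective _ ((cell_eq_vertexLabel G' q hG' (h.vflag ε f)).symm.trans h1)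
  · refine (h.lam f.1 f.2.1 (h.vflag ε f).2.1 _ h1).trans ?_
    rw [f.2.2]
    exact hσ _ (G.vertexLabel q hG f).2

theorem boundaryLabel_bflag {ε : ℤˣ} {S : Finset L} (hG : Set.BijOn G.beta _ (S : Set L)) (hG')
    (f : G.BFlag ε) : G'.boundaryLabel hG' (h.bflag ε f) = G.boundaryLabel hG f :=
  Subtype.ext (h.beta _ _ _)

/-- An isomorphism commutes with passing to the other end of an edge, keeps boundary labels and
changes labels at the vertices by `θ`; reading edges on labels gives the claim. -/
theorem toDiagram (h : IsIso G G' φ θ) :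
    G.toDiagram = (G'.toDiagram.conj fun v' => (θ v').perms).reindex s := by
  refine (eq_conj_reindex_iff (c := fun v' => (c' v').swap)).2
    ⟨fun y => ?_, congrArg (· / 2) (Nat.card_congr h.loopFlag)⟩
  obtain ⟨x, rfl⟩ := ((G.vertexLabel Prod.snd G.lam_out).sumCongr
    (G.boundaryLabel G.beta_in)).surjective y
  have h1 : ∀ x : G.VFlag (-1) ⊕ G.BFlag 1,
      labelPoints (fun v' => (c' v').swap) Prod.fst b.1 s (fun v' => (θ v').perms.1)
        (x.map (G.vertexLabel Prod.snd G.lam_out) (G.boundaryLabel G.beta_in)) =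
      (x.map (h.vflag (-1)) (h.bflag 1)).map (G'.vertexLabel Prod.snd G'.lam_out)
        (G'.boundaryLabel G'.beta_in) := by
    rintro (f | f)
    · refine congrArg Sum.inl (h.vertexLabel_vflag _ _ (fun v' => (θ v').perms.1) ?_ f).symm
      intro v' a
      exact extendPerm_coe _ _
    · exact congrArg Sum.inr (h.boundaryLabel_bflag G.beta_in _ f).symm
  have h2 : ∀ x : G.VFlag 1 ⊕ G.BFlag (-1),
      labelPoints (fun v' => (c' v').swap) Prod.snd b.2 s (fun v' => (θ v').perms.2)
        (x.map (G.vertexLabel Prod.fst G.lam_in) (G.boundaryLabel G.beta_out)) =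
      (x.map (h.vflag 1) (h.bflag (-1))).map (G'.vertexLabel Prod.fst G'.lam_in)
        (G'.boundaryLabel G'.beta_out) := by
    rintro (f | f)
    · refine congrArg Sum.inl (h.vertexLabel_vflag _ _ (fun v' => (θ v').perms.2) ?_ f).symm
      intro v' a
      exact extendPerm_coe _ _
    · exact congrArg Sum.inr (h.boundaryLabel_bflag G.beta_out _ f).symm
  refine (congrArg G'.toDiagram.p (h1 x)).trans ((G'.toDiagram_p _).trans ?_)
  refine Eq.trans ?_ (congrArg _ (G.toDiagram_p x)).symm
  refine Eq.trans ?_ (h2 _).symm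
  exact congrArg _ (h.otherEnd (by simp) x)

end IsIso

end FlagGraph

/-! ### Graphs with the same diagram are isomorphic -/

namespace FlagGraph

variable {L V V' F F' : Type} {b : Profile L}

/-- The boundary flags in the exceptional cell. -/
def XFlag {c : V → Profile L} (G : FlagGraph c b F) (ε : ℤˣ) : Type :=
  {f : G.BFlag ε // G.cell f.1 = none}

section FlagSum

variable {c : V → Profile L} (G : FlagGraph c b F)

theorem exists_vFlag {f : F} (h : G.cell f ≠ none) : ∃ ε, ∃ f' : G.VFlag ε, f'.1 = f :=
  ⟨_, ⟨f, h, rfl⟩, rfl⟩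

theorem exists_bFlag {f : F} (h : G.ι f = f) : ∃ ε, ∃ f' : G.BFlag ε, f'.1 = f :=
  ⟨_, ⟨f, h, rfl⟩, rfl⟩

/-- Sorting the flags of a graph. -/
noncomputable def flagSum : (G.VFlag (-1) ⊕ G.VFlag 1) ⊕ ((G.XFlag (-1) ⊕ G.XFlag 1) ⊕ G.LoopFlag) ≃
    F :=
  Equiv.ofBijective
    (Sum.elim (Sum.elim Subtype.val Subtype.val)
      (Sum.elim (Sum.elim (fun f => f.1.1) fun f => f.1.1) Subtype.val)) <| by
    constructor
    · rintro ((⟨f, hf, hf'⟩ | ⟨f, hf, hf'⟩) | ((⟨⟨f, hf, hf'⟩, hf''⟩ | ⟨⟨f, hf, hf'⟩, hf''⟩) |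
          ⟨f, hf, hf'⟩))
        ((⟨g, hg, hg'⟩ | ⟨g, hg, hg'⟩) | ((⟨⟨g, hg, hg'⟩, hg''⟩ | ⟨⟨g, hg, hg'⟩, hg''⟩) |
          ⟨g, hg, hg'⟩)) h <;> obtain rfl : f = g := h <;>
        first
        | rfl
        | exact absurd (hf'.symm.trans hg') (by decide)
        | exact absurd ‹G.cell f = none› ‹G.cell f ≠ none›
        | exact absurd ‹G.ι f = f› ‹G.ι f ≠ f›
    · intro f
      by_cases hf : G.cell f = none
      · by_cases hf' : G.ι f = f
        · rcases Int.units_eq_one_or (G.δ ⟨f, Or.inr hf'⟩) with h | h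
          · exact ⟨.inr (.inl (.inr ⟨⟨f, hf', h⟩, hf⟩)), rfl⟩
          · exact ⟨.inr (.inl (.inl ⟨⟨f, hf', h⟩, hf⟩)), rfl⟩
        · exact ⟨.inr (.inr ⟨f, hf, hf'⟩), rfl⟩
      · rcases Int.units_eq_one_or (G.δ ⟨f, Or.inl hf⟩) with h | h
        · exact ⟨.inl (.inr ⟨f, hf, h⟩), rfl⟩
        · exact ⟨.inl (.inl ⟨f, hf, h⟩), rfl⟩

end FlagSum

variable {c' : V' → Profile L} {s : V ≃ V'} {G : FlagGraph (fun v => c' (s v)) b F}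
  {G' : FlagGraph c' b F'} {θ : ∀ v', LabelGroup (c' v')}

/-- The families of flags at vertices and of boundary flags overlap: an edge from a vertex to the
boundary is a single flag belonging to both. The bijection is assembled over the disjoint pieces of
`flagSum`, which use only the exceptional boundary flags, and `hE` makes the two given bijections
agree on the overlap. -/
theorem exists_isIso_of_equivs (ψV : ∀ ε, G.VFlag ε ≃ G'.VFlag ε)
    (ψB : ∀ ε, G.BFlag ε ≃ G'.BFlag ε) (ψL : G.LoopFlag ≃ G'.LoopFlag)
    (hE : ∀ (ε ε' : ℤˣ) (hε : ε' = -ε) (x : G.VFlag ε ⊕ G.BFlag ε'),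
      G'.otherEnd hε (x.map (ψV ε) (ψB ε')) = (G.otherEnd hε x).map (ψV ε') (ψB ε))
    (hL : ∀ f, G'.loopMate (ψL f) = ψL (G.loopMate f))
    (hcell : ∀ ε f, G'.cell (ψV ε f).1 = (G.cell f.1).map s)
    (hlam : ∀ ε f v', G'.cell (ψV ε f).1 = some v' →
      G'.lam ⟨(ψV ε f).1, (ψV ε f).2.1⟩ = actSign ε (θ v') (G.lam ⟨f.1, f.2.1⟩))
    (hbeta : ∀ ε f, G'.beta ⟨(ψB ε f).1, (ψB ε f).2.1⟩ = G.beta ⟨f.1, f.2.1⟩) :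
    ∃ φ : F ≃ F', IsIso G G' φ θ := by
  -- A boundary flag is exceptional exactly when the other end of its edge is again on the boundary,
  -- and `hE` preserves this.
  have hBcell : ∀ ε (f : G.BFlag ε), G.cell f.1 = none ↔ G'.cell (ψB ε f).1 = none := by
    intro ε f
    have h := hE (-ε) ε (neg_neg ε).symm (.inr f)
    by_cases hf : G.cell f.1 = none
    · obtain ⟨h1, h2⟩ := G.otherEnd_inr_of_eq (neg_neg ε).symm hf
      rw [h2] at h
      exact iff_of_true hf (otherEnd_inr_eq_inr h).1
    · rw [G.otherEnd_inr_of_ne _ hf] at h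
      exact iff_of_false hf (otherEnd_inr_eq_inl h).1
  let ψX : ∀ ε, G.XFlag ε ≃ G'.XFlag ε := fun ε => (ψB ε).subtypeEquiv (hBcell ε)
  let φ : F ≃ F' := G.flagSum.symm.trans <|
    (((ψV _).sumCongr (ψV _)).sumCongr (((ψX _).sumCongr (ψX _)).sumCongr ψL)).trans G'.flagSum
  have hφV : ∀ ε (f : G.VFlag ε), φ f.1 = (ψV ε f).1 := by
    intro ε f
    rcases Int.units_eq_one_or ε with rfl | rfl
    · exact congrArg (fun x => G'.flagSum ((((ψV _).sumCongr (ψV _)).sumCongr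
        (((ψX _).sumCongr (ψX _)).sumCongr ψL)) x)) (G.flagSum.symm_apply_apply (.inl (.inr f)))
    · exact congrArg (fun x => G'.flagSum ((((ψV _).sumCongr (ψV _)).sumCongr
        (((ψX _).sumCongr (ψX _)).sumCongr ψL)) x)) (G.flagSum.symm_apply_apply (.inl (.inl f)))
  have hφL : ∀ f : G.LoopFlag, φ f.1 = (ψL f).1 := fun f =>
    congrArg (fun x => G'.flagSum ((((ψV _).sumCongr (ψV _)).sumCongr
        (((ψX _).sumCongr (ψX _)).sumCongr ψL)) x)) (G.flagSum.symm_apply_apply (.inr (.inr f)))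
  have hφB : ∀ ε (f : G.BFlag ε), φ f.1 = (ψB ε f).1 := by
    intro ε f
    by_cases hf : G.cell f.1 = none
    · rcases Int.units_eq_one_or ε with rfl | rfl
      · exact congrArg (fun x => G'.flagSum ((((ψV _).sumCongr (ψV _)).sumCongr
          (((ψX _).sumCongr (ψX _)).sumCongr ψL)) x))
          (G.flagSum.symm_apply_apply (.inr (.inl (.inr ⟨f, hf⟩))))
      · exact congrArg (fun x => G'.flagSum ((((ψV _).sumCongr (ψV _)).sumCongr
          (((ψX _).sumCongr (ψX _)).sumCongr ψL)) x))
          (G.flagSum.symm_apply_apply (.inr (.inl (.inl ⟨f, hf⟩))))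
    -- For a boundary flag at a vertex, `otherEnd` returns the flag itself, now regarded as a flag
    -- at that vertex; so `ψB` and `ψV` agree on it.
    · have h := hE (-ε) ε (neg_neg ε).symm (.inr f)
      rw [G.otherEnd_inr_of_ne _ hf] at h
      exact (hφV ε ⟨f.1, hf, f.2.2⟩).trans (otherEnd_inr_eq_inl h).2
  refine ⟨φ, ⟨?_, ?_, ?_, ?_, ?_, ?_⟩⟩
  · intro f
    by_cases hf : G.cell f = none
    · rw [hf]
      by_cases hf' : G.ι f = f
      · obtain ⟨ε, f, rfl⟩ := G.exists_bFlag hf'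
        rw [hφB]
        exact (hBcell ε f).1 hf
      · exact (congrArg G'.cell (hφL ⟨f, hf, hf'⟩)).trans (ψL ⟨f, hf, hf'⟩).2.1
    · obtain ⟨ε, f, rfl⟩ := G.exists_vFlag hf
      rw [hφV, hcell]
  · intro f
    by_cases hf' : G.ι f = f
    · rw [hf']
      obtain ⟨ε, f, rfl⟩ := G.exists_bFlag hf'
      rw [hφB]
      exact (ψB ε f).2.1
    · by_cases hf : G.cell f = none
      · refine (congrArg G'.ι (hφL ⟨f, hf, hf'⟩)).trans ?_
        exact (congrArg Subtype.val (hL ⟨f, hf, hf'⟩)).trans (hφL _).symm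
      · obtain ⟨ε, f, rfl⟩ := G.exists_vFlag hf
        obtain ⟨h1, h2⟩ := G.otherEnd_inl_of_ne (ε := ε) rfl hf'
        have h := hE ε (-ε) rfl (.inl f)
        rw [h2] at h
        rw [hφV]
        exact (otherEnd_inl_eq_inl h).2.symm.trans (hφV _ ⟨_, h1⟩).symm
  · intro f h h'
    obtain ⟨ε, f, rfl⟩ := G.exists_bFlag h.2
    have hf := h.1
    obtain ⟨h1, h2⟩ := G.otherEnd_inr_of_eq (neg_neg ε).symm hf
    have h3 := hE (-ε) ε (neg_neg ε).symm (.inr f)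
    rw [h2] at h3
    obtain ⟨h4, h5⟩ := otherEnd_inr_eq_inr h3
    refine Eq.trans ?_ (h5.symm.trans (hφB _ ⟨_, h1⟩).symm)
    exact congrArg (fun x => (G'.π x).1) (Subtype.ext (hφB ε f))
  · intro f h h'
    by_cases hf : G.cell f = none
    · obtain ⟨ε, f, rfl⟩ := G.exists_bFlag (h.resolve_left (not_not.2 hf))
      refine Eq.trans ?_ ((ψB ε f).2.2.trans f.2.2.symm)
      exact congrArg G'.δ (Subtype.ext (hφB ε f))
    · obtain ⟨ε, f, rfl⟩ := G.exists_vFlag hf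
      refine Eq.trans ?_ ((ψV ε f).2.2.trans f.2.2.symm)
      exact congrArg G'.δ (Subtype.ext (hφV ε f))
  · intro f h h'
    obtain ⟨ε, f, rfl⟩ := G.exists_bFlag h
    refine Eq.trans ?_ (hbeta ε f)
    exact congrArg G'.beta (Subtype.ext (hφB ε f))
  · intro f h h' v' hv
    obtain ⟨ε, f, rfl⟩ := G.exists_vFlag h
    rw [f.2.2]
    refine Eq.trans ?_ (hlam ε f v' (by rw [← hφV, hv]))
    exact congrArg G'.lam (Subtype.ext (hφV ε f))

theorem exists_vFlag_equiv {ε : ℤˣ} (q : Profile L → Finset L) (hG hG')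
    (σ : ∀ v', Equiv.Perm (q (c' v')))
    (hσ : ∀ v' (a : q (c' v')), actSign ε (θ v') a = σ v' a) :
    ∃ ψ : G.VFlag ε ≃ G'.VFlag ε,
      (∀ f, G'.vertexLabel q hG' (ψ f) =
        Equiv.sigmaCongrRight σ (Equiv.sigmaCongrLeft (β := fun v' => (q (c' v') : Type)) s
          (G.vertexLabel q hG f))) ∧
      (∀ f, G'.cell (ψ f).1 = (G.cell f.1).map s) ∧
      ∀ f v', G'.cell (ψ f).1 = some v' →
        G'.lam ⟨(ψ f).1, (ψ f).2.1⟩ = actSign ε (θ v') (G.lam ⟨f.1, f.2.1⟩) := by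
  let ψ : G.VFlag ε ≃ G'.VFlag ε := (G.vertexLabel q hG).trans <|
    ((Equiv.sigmaCongrLeft (β := fun v' => (q (c' v') : Type)) s).trans
      (Equiv.sigmaCongrRight σ)).trans (G'.vertexLabel q hG').symm
  have hψ : ∀ f, G'.vertexLabel q hG' (ψ f) = Equiv.sigmaCongrRight σ
      (Equiv.sigmaCongrLeft (β := fun v' => (q (c' v') : Type)) s (G.vertexLabel q hG f)) :=
    fun f => (G'.vertexLabel q hG').apply_symm_apply _
  have hcell : ∀ f, G'.cell (ψ f).1 = some (s (G.vertexLabel q hG f).1) := fun f => by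
    rw [cell_eq_vertexLabel G' q hG', hψ]
    rfl
  refine ⟨ψ, hψ, fun f => ?_, fun f v' hv => ?_⟩
  · rw [hcell, cell_eq_vertexLabel G q hG f]
    rfl
  · obtain rfl := Option.some_injective _ ((hcell f).symm.trans hv)
    refine Eq.trans ?_ (hσ _ (G.vertexLabel q hG f).2).symm
    exact congrArg (fun t : Σ v', q (c' v') => (t.2 : L)) (hψ f)

theorem exists_bFlag_equiv {ε : ℤˣ} {S : Finset L} (hG : Set.BijOn G.beta _ (S : Set L))
    (hG' : Set.BijOn G'.beta _ (S : Set L)) :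
    ∃ ψ : G.BFlag ε ≃ G'.BFlag ε,
      (∀ f, G'.boundaryLabel hG' (ψ f) = G.boundaryLabel hG f) ∧
      ∀ f, G'.beta ⟨(ψ f).1, (ψ f).2.1⟩ = G.beta ⟨f.1, f.2.1⟩ := by
  have h : ∀ f, G'.boundaryLabel hG' ((G'.boundaryLabel hG').symm (G.boundaryLabel hG f)) =
    G.boundaryLabel hG f := fun f => (G'.boundaryLabel hG').apply_symm_apply _
  exact ⟨(G.boundaryLabel hG).trans (G'.boundaryLabel hG').symm, h, fun f =>
    congrArg Subtype.val (h f)⟩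

theorem exists_loopFlag_equiv {c : V → Profile L} {c' : V' → Profile L} {G : FlagGraph c b F}
    {G' : FlagGraph c' b F'} [Finite F] [Finite F']
    (h : Nat.card G.LoopFlag / 2 = Nat.card G'.LoopFlag / 2) :
    ∃ ψ : G.LoopFlag ≃ G'.LoopFlag, ∀ f, G'.loopMate (ψ f) = ψ (G.loopMate f) := by
  obtain ⟨e, he⟩ := exists_equiv_prod_bool _ G.loopMate_loopMate G.loopMate_ne
  obtain ⟨e', he'⟩ := exists_equiv_prod_bool _ G'.loopMate_loopMate G'.loopMate_ne
  refine ⟨e.symm.trans (((finCongr h).prodCongr (Equiv.refl _)).trans e'), fun f => ?_⟩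
  obtain ⟨x, rfl⟩ := e.surjective f
  rw [← he]
  simp only [Equiv.trans_apply, Equiv.symm_apply_apply]
  exact (he' _).symm

/-- Flags at vertices and on the boundary are determined by their labels, so the relabelled labels
dictate the bijections; equality of matchings makes them compatible with edges. The flags of free
loops may be matched in any way that respects pairs, which needs only that there are equally many
loops. -/
theorem exists_isIso [Finite F] [Finite F']
    (h : G.toDiagram = (G'.toDiagram.conj fun v' => (θ v').perms).reindex s) :
    ∃ φ : F ≃ F', IsIso G G' φ θ := by
  obtain ⟨hp, hl⟩ := (eq_conj_reindex_iff (c := fun v' => (c' v').swap)).1 h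
  obtain ⟨vN, hN, hN₁, hN₂⟩ := exists_vFlag_equiv (ε := -1) Prod.snd G.lam_out G'.lam_out
    (fun v' => (θ v').perms.1) fun v' a => extendPerm_coe _ _
  obtain ⟨vP, hP, hP₁, hP₂⟩ := exists_vFlag_equiv (ε := 1) Prod.fst G.lam_in G'.lam_in
    (fun v' => (θ v').perms.2) fun v' a => extendPerm_coe _ _
  obtain ⟨bN, hbN, hbN₁⟩ := exists_bFlag_equiv G.beta_out G'.beta_out
  obtain ⟨bP, hbP, hbP₁⟩ := exists_bFlag_equiv G.beta_in G'.beta_in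
  obtain ⟨ψL, hL⟩ := exists_loopFlag_equiv hl
  have hE : ∀ x, G'.edge (x.map vN bP) = (G.edge x).map vP bN := by
    intro x
    refine ((G'.vertexLabel Prod.fst G'.lam_in).sumCongr
      (G'.boundaryLabel G'.beta_out)).injective ?_
    refine (G'.toDiagram_p _).symm.trans ?_
    have h1 : ∀ x : G.VFlag (-1) ⊕ G.BFlag 1, (x.map vN bP).map
        (G'.vertexLabel Prod.snd G'.lam_out) (G'.boundaryLabel G'.beta_in) =
        labelPoints (fun v' => (c' v').swap) Prod.fst b.1 s (fun v' => (θ v').perms.1)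
          (x.map (G.vertexLabel Prod.snd G.lam_out) (G.boundaryLabel G.beta_in)) := by
      rintro (f | f)
      · exact congrArg Sum.inl (hN f)
      · exact congrArg Sum.inr (hbP f)
    have h2 : ∀ x : G.VFlag 1 ⊕ G.BFlag (-1), (x.map vP bN).map
        (G'.vertexLabel Prod.fst G'.lam_in) (G'.boundaryLabel G'.beta_out) =
        labelPoints (fun v' => (c' v').swap) Prod.snd b.2 s (fun v' => (θ v').perms.2)
          (x.map (G.vertexLabel Prod.fst G.lam_in) (G.boundaryLabel G.beta_out)) := by
      rintro (f | f)
      · exact congrArg Sum.inl (hP f)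
      · exact congrArg Sum.inr (hbN f)
    refine (congrArg G'.toDiagram.p (h1 x)).trans ((hp _).trans ?_)
    exact (congrArg _ (G.toDiagram_p x)).trans (h2 _).symm
  have hE' : ∀ x, G'.edge.symm (x.map vP bN) = (G.edge.symm x).map vN bP := by
    intro x
    obtain ⟨y, rfl⟩ := G.edge.surjective x
    rw [← hE, Equiv.symm_apply_apply, Equiv.symm_apply_apply]
  -- The bijections for the two signs are packed into one family over `ε`, with its values at `1`
  -- and `-1` recorded along the dependence of the types on `ε`.
  have hV : ∀ ε : ℤˣ, ∃ ψ : G.VFlag ε ≃ G'.VFlag ε,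
      (∀ h : ε = 1, ψ = h ▸ vP) ∧ (∀ h : ε = -1, ψ = h ▸ vN) := by
    intro ε
    rcases Int.units_eq_one_or ε with rfl | rfl
    · exact ⟨vP, fun _ => rfl, fun h => absurd h (by decide)⟩
    · exact ⟨vN, fun h => absurd h (by decide), fun _ => rfl⟩
  have hB : ∀ ε : ℤˣ, ∃ ψ : G.BFlag ε ≃ G'.BFlag ε,
      (∀ h : ε = 1, ψ = h ▸ bP) ∧ (∀ h : ε = -1, ψ = h ▸ bN) := by
    intro ε
    rcases Int.units_eq_one_or ε with rfl | rfl
    · exact ⟨bP, fun _ => rfl, fun h => absurd h (by decide)⟩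
    · exact ⟨bN, fun h => absurd h (by decide), fun _ => rfl⟩
  choose ψV hψP hψN using hV
  choose ψB hψBP hψBN using hB
  have e1 : ψV 1 = vP := hψP 1 rfl
  have e2 : ψV (-1) = vN := hψN (-1) rfl
  have e3 : ψB 1 = bP := hψBP 1 rfl
  have e4 : ψB (-1) = bN := hψBN (-1) rfl
  refine exists_isIso_of_equivs ψV ψB ψL ?_ hL ?_ ?_ ?_
  · intro ε ε' hε x
    rcases Int.units_eq_one_or ε with rfl | rfl
    · subst hε
      rw [e1, e2, e3, e4]
      exact hE' x
    · obtain rfl : ε' = 1 := hε.trans (by decide)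
      rw [e1, e2, e3, e4]
      exact hE x
  · intro ε
    rcases Int.units_eq_one_or ε with rfl | rfl
    · rwa [e1]
    · rwa [e2]
  · intro ε
    rcases Int.units_eq_one_or ε with rfl | rfl
    · rwa [e1]
    · rwa [e2]
  · intro ε
    rcases Int.units_eq_one_or ε with rfl | rfl
    · rwa [e3]
    · rwa [e4]

end FlagGraph

/-! ## The wiring diagrams of the standard constructions on graphs -/

theorem actSign_one {L : Type} {b : Profile L} (ε : ℤˣ) : actSign ε (1 : LabelGroup b) = 1 := by
  rw [actSign]
  split_ifs
  · exact actIn_one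
  · exact actOut_one

theorem LabelGroup.perms_one {L : Type} {b : Profile L} : (1 : LabelGroup b).perms = 1 :=
  Prod.ext inv_one rfl

theorem LabelGroup.perms_mul {L : Type} {b : Profile L} (g h : LabelGroup b) :
    (g * h).perms = g.perms * h.perms :=
  Prod.ext (mul_inv_rev _ _) rfl

theorem card_div_two {O : Type} [Finite O] (o : O → O) (oo : ∀ x, o (o x) = x)
    (o_ne : ∀ x, o x ≠ x) : 2 * (Nat.card O / 2) = Nat.card O := by
  obtain ⟨e, -⟩ := exists_equiv_prod_bool o oo o_ne
  have h := Nat.card_congr e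
  rw [Nat.card_prod] at h
  simp only [Nat.card_eq_fintype_card, Fintype.card_fin, Fintype.card_bool] at h ⊢
  omega

namespace FlagGraph

variable {L V F F' : Type} {b : Profile L} {c : V → Profile L}

theorem isIso_transport (G : FlagGraph c b F) (e : F ≃ F') :
    IsIso (s := Equiv.refl V) G (G.transport e) e 1 where
  cell f := by
    change G.cell (e.symm (e f)) = _
    simp
  ι f := by
    change e (G.ι (e.symm (e f))) = _
    simp
  π f h h' := congrArg (fun x => e (G.π x).1) (Subtype.ext (e.symm_apply_apply f))
  δ f h h' := congrArg G.δ (Subtype.ext (e.symm_apply_apply f))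
  beta f h h' := congrArg G.beta (Subtype.ext (e.symm_apply_apply f))
  lam f h h' v' hv' := by
    rw [Pi.one_apply, actSign_one]
    exact congrArg G.lam (Subtype.ext (e.symm_apply_apply f))

theorem conj_perms_one_reindex (D : WiringDiagram (fun v => (c v).swap) b) :
    (D.conj fun v => (1 : LabelGroup (c v)).perms).reindex (Equiv.refl V) = D := by
  have h : (fun v => (1 : LabelGroup (c v)).perms) = fun _ => 1 :=
    funext fun v => LabelGroup.perms_one
  rw [h, conj_one, reindex_refl]

theorem toDiagram_transport (G : FlagGraph c b F) (e : F ≃ F') :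
    (G.transport e).toDiagram = G.toDiagram :=
  ((G.isIso_transport e).toDiagram.trans (conj_perms_one_reindex _)).symm

/-- Points are named by the new labels. On the incoming side, where strands begin, the old label is
recovered by `g.1.symm`; on the outgoing side, where strands end, the old label is carried to the
new one by `g.2.unop⁻¹`, the right action turned into a left one. -/
theorem toDiagram_relabel (G : FlagGraph c b F) (g : LabelGroup b) :
    (G.relabel g).toDiagram = G.toDiagram.conjOut g.perms := by
  refine WiringDiagram.ext (Equiv.ext fun y => ?_) rfl
  obtain ⟨x, rfl⟩ := ((G.vertexLabel Prod.snd G.lam_out).sumCongr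
    ((G.relabel g).boundaryLabel (G.relabel g).beta_in)).surjective y
  have h1 : ∀ f : G.BFlag 1, (g.1.symm ((G.relabel g).boundaryLabel (G.relabel g).beta_in f)) =
      G.boundaryLabel G.beta_in f := by
    intro f
    refine (Equiv.symm_apply_eq _).2 (Subtype.ext ?_)
    refine (if_pos f.2.2).trans ?_
    exact extendPerm_coe g.1 (G.boundaryLabel G.beta_in f)
  have h2 : ∀ f : G.BFlag (-1), (G.relabel g).boundaryLabel (G.relabel g).beta_out f =
      (g.2.unop⁻¹) (G.boundaryLabel G.beta_out f) := by
    intro f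
    refine Subtype.ext ?_
    refine (if_neg fun h => absurd (h.symm.trans f.2.2) (by decide)).trans ?_
    exact extendPerm_coe g.2.unop⁻¹ (G.boundaryLabel G.beta_out f)
  have h3 : ((Equiv.refl _).sumCongr g.1.symm) (x.map (G.vertexLabel Prod.snd G.lam_out)
        ((G.relabel g).boundaryLabel (G.relabel g).beta_in)) =
      x.map (G.vertexLabel Prod.snd G.lam_out) (G.boundaryLabel G.beta_in) := by
    rcases x with f | f
    · rfl
    · exact congrArg Sum.inr (h1 f)
  refine ((G.relabel g).toDiagram_p x).trans ?_
  refine Eq.trans ?_ (congrArg (fun y => ((Equiv.refl _).sumCongr (g.2.unop⁻¹)) (G.toDiagram.p y))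
    h3).symm
  refine Eq.trans ?_ (congrArg ((Equiv.refl _).sumCongr (g.2.unop⁻¹)) (G.toDiagram_p x)).symm
  have h4 : ∀ y : G.VFlag 1 ⊕ G.BFlag (-1), y.map (G.vertexLabel Prod.fst G.lam_in)
      ((G.relabel g).boundaryLabel (G.relabel g).beta_out) =
      ((Equiv.refl _).sumCongr (g.2.unop⁻¹)) (y.map (G.vertexLabel Prod.fst G.lam_in)
        (G.boundaryLabel G.beta_out)) := by
    rintro (f | f)
    · rfl
    · exact congrArg Sum.inr (h2 f)
  have h5 : (G.relabel g).edge x = G.edge x := by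
    rcases x with f | f <;> rfl
  exact (congrArg (Sum.map _ _) h5).trans (h4 (G.edge x))

section OfEdges

variable {VN VP BN BP O : Type} (lN : VN ≃ Σ v, (c v).2) (lP : VP ≃ Σ v, (c v).1) (mN : BN ≃ b.2)
  (mP : BP ≃ b.1) (e : VN ⊕ BP ≃ VP ⊕ BN) (o : O → O) (oo : ∀ x, o (o x) = x)
  (o_ne : ∀ x, o x ≠ x)

theorem toDiagram_ofEdges_l :
    (ofEdges lN lP mN mP e o oo o_ne).toDiagram.l = Nat.card O / 2 := by
  refine congrArg (· / 2) (Nat.card_congr (Equiv.ofBijective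
    (fun x : O => (⟨.inr (.inr x), rfl, fun h => o_ne x (Sum.inr_injective (Sum.inr_injective h))⟩ :
      (ofEdges lN lP mN mP e o oo o_ne).LoopFlag)) ⟨fun x y h => ?_, ?_⟩)).symm
  · exact Sum.inr_injective (Sum.inr_injective (congrArg Subtype.val h))
  · rintro ⟨(a | a) | f | x, h, h'⟩
    · exact absurd h (Option.some_ne_none _)
    · exact absurd h (Option.some_ne_none _)
    · exact absurd rfl h'
    · exact ⟨x, rfl⟩

theorem toDiagram_ofEdges_p (x : VN ⊕ BP) :
    (ofEdges lN lP mN mP e o oo o_ne).toDiagram.p (x.map lN mP) = (e x).map lP mN := by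
  let G := ofEdges lN lP mN mP e o oo o_ne
  let vN : VN → G.VFlag (-1) := fun a => ⟨.inl (.inl a), Option.some_ne_none _, rfl⟩
  let vP : VP → G.VFlag 1 := fun a => ⟨.inl (.inr a), Option.some_ne_none _, rfl⟩
  have hvN : ∀ a, G.vertexLabel Prod.snd G.lam_out (vN a) = lN a := fun a => rfl
  have hvP : ∀ a, G.vertexLabel Prod.fst G.lam_in (vP a) = lP a := fun a => rfl
  have key : ∀ (s : G.VFlag (-1) ⊕ G.BFlag 1) (t : G.VFlag 1 ⊕ G.BFlag (-1)),
      G.edge s = t → s.map (G.vertexLabel Prod.snd G.lam_out) (G.boundaryLabel G.beta_in) =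
        x.map lN mP →
      t.map (G.vertexLabel Prod.fst G.lam_in) (G.boundaryLabel G.beta_out) = (e x).map lP mN →
      G.toDiagram.p (x.map lN mP) = (e x).map lP mN := by
    rintro s _ rfl hs ht
    rw [← hs, ← ht]
    exact G.toDiagram_p s
  -- There are four kinds of edges: from vertex to vertex, with two flags; between a vertex and the
  -- boundary, in either direction, with one flag serving as both ends; and free edges, with two
  -- exceptional flags. In each case `key` asks only for both ends and their labels.
  rcases x with a | x
  · rcases he : e (.inl a) with a' | y
    · rw [← he]
      have hι : G.ι (.inl (.inl a)) = .inl (.inr a') :=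
        congrArg (Sum.elim (γ := EdgeFlag e O) (fun a' => .inl (.inr a')) (fun _ => .inl (.inl a))) he
      refine key (.inl (vN a)) (.inl (vP a')) ?_ rfl (by rw [he]; rfl)
      obtain ⟨h1, h2⟩ := G.otherEnd_inl_of_ne (ε' := 1) (by simp) (f := vN a)
        (fun h => by cases hι.symm.trans h)
      exact h2.trans (congrArg Sum.inl (Subtype.ext hι))
    · rw [← he]
      have hι : G.ι (.inl (.inl a)) = .inl (.inl a) :=
        congrArg (Sum.elim (γ := EdgeFlag e O) (fun a' => .inl (.inr a')) (fun _ => .inl (.inl a))) he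
      refine key (.inl (vN a)) (.inr ⟨_, hι, rfl⟩) (G.otherEnd_inl_of_eq (by simp) hι) rfl ?_
      rw [he]
      refine congrArg Sum.inr (Subtype.ext ?_)
      exact congrArg (Sum.elim (fun a' => ((lP a').2.1 : L)) (fun y => (mN y).1)) he
  · rcases he : e (.inr x) with a' | y
    · rw [← he]
      have he' : e.symm (.inl a') = .inr x := by rw [← he, Equiv.symm_apply_apply]
      have hι : G.ι (.inl (.inr a')) = .inl (.inr a') :=
        congrArg (Sum.elim (γ := EdgeFlag e O) (fun a' => .inl (.inl a')) (fun _ => .inl (.inr a'))) he'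
      let f : G.BFlag 1 := ⟨.inl (.inr a'), hι, rfl⟩
      have hf : ¬ G.cell f.1 = none := (vP a').2.1
      refine key (.inr f) (.inl (vP a'))
        (G.otherEnd_inr_of_ne (ε := -1) (ε' := 1) (by simp) hf) ?_ (by rw [he]; rfl)
      refine congrArg Sum.inr (Subtype.ext ?_)
      exact congrArg (Sum.elim (fun a' => ((lN a').2.1 : L)) (fun y => (mP y).1)) he'
    · rw [← he]
      refine key (.inr ⟨.inr (.inl (⟨(x, y), he⟩, true)), rfl, rfl⟩)
        (.inr ⟨.inr (.inl (⟨(x, y), he⟩, false)), rfl, rfl⟩) ?_ rfl (by rw [he]; rfl)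
      obtain ⟨h1, h2⟩ := G.otherEnd_inr_of_eq (ε := -1) (ε' := 1) (by simp)
        (f := ⟨.inr (.inl (⟨(x, y), he⟩, true)), rfl, rfl⟩) rfl
      exact h2

end OfEdges

/-! ### Graph substitution is simultaneous composition -/

section Subst

variable {W K : V → Type} {d : ∀ v, W v → Profile L}

/-- The beginnings of edges, sorted for graph substitution. -/
noncomputable def substBegin (G : FlagGraph c b F) (H : ∀ v, FlagGraph (d v) (c v) (K v)) :
    ((Σ v, (H v).VFlag (-1)) ⊕ G.BFlag 1) ⊕ (G.VFlag (-1) ⊕ G.VFlag 1) ≃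
      (G.VFlag (-1) ⊕ G.BFlag 1) ⊕ (Σ v, (H v).VFlag (-1) ⊕ (H v).BFlag 1) :=
  (shuffle _ _ _ _).trans <| (Equiv.refl _).sumCongr <|
    ((Equiv.refl _).sumCongr (G.legIn H)).trans (Equiv.sigmaSumDistrib _ _).symm

/-- The ends of edges, sorted for graph substitution. -/
noncomputable def substEnd (G : FlagGraph c b F) (H : ∀ v, FlagGraph (d v) (c v) (K v)) :
    ((Σ v, (H v).VFlag 1) ⊕ G.BFlag (-1)) ⊕ (G.VFlag (-1) ⊕ G.VFlag 1) ≃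
      (G.VFlag 1 ⊕ G.BFlag (-1)) ⊕ (Σ v, (H v).VFlag 1 ⊕ (H v).BFlag (-1)) :=
  ((Equiv.refl _).sumCongr (Equiv.sumComm _ _)).trans <|
    (shuffle _ _ _ _).trans <| (Equiv.refl _).sumCongr <|
      ((Equiv.refl _).sumCongr (G.legOut H)).trans (Equiv.sigmaSumDistrib _ _).symm

theorem substBegin_inr_inr (G : FlagGraph c b F) (H : ∀ v, FlagGraph (d v) (c v) (K v))
    (f : G.VFlag 1) : G.substBegin H (.inr (.inr f)) =
      .inr ((Equiv.sigmaSumDistrib _ _).symm (.inr (G.legIn H f))) := rfl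

theorem substEnd_inr_inl (G : FlagGraph c b F) (H : ∀ v, FlagGraph (d v) (c v) (K v))
    (f : G.VFlag (-1)) : G.substEnd H (.inr (.inl f)) =
      .inr ((Equiv.sigmaSumDistrib _ _).symm (.inr (G.legOut H f))) := rfl

theorem substStrands_eq_iff (G : FlagGraph c b F) (H : ∀ v, FlagGraph (d v) (c v) (K v)) {s t} :
    G.substStrands H s = t ↔ (G.edge.sumCongr (Equiv.sigmaCongrRight fun v => (H v).edge))
      (G.substBegin H s) = G.substEnd H t :=
  Equiv.symm_apply_eq (G.substEnd H)

/-- The two gluing problems have the same strands and differ in the names of the points: flags of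
`G` and of the `H v` on one side, labels on the other. A flag of `G` and the leg of `H v` glued to
it carry the same label, so renaming is consistent. -/
theorem plug_toDiagram (G : FlagGraph c b F) (H : ∀ v, FlagGraph (d v) (c v) (K v)) (s) :
    plug G.toDiagram.p (fun v => (H v).toDiagram)
      (s.map (((Equiv.sigmaCongrRight fun v => (H v).vertexLabel Prod.snd (H v).lam_out).trans
          (Equiv.sigmaAssoc fun v w => ((d v w).2 : Type)).symm).sumCongr
            (G.boundaryLabel G.beta_in))
        ((G.vertexLabel Prod.snd G.lam_out).sumCongr (G.vertexLabel Prod.fst G.lam_in))) =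
      (G.substStrands H s).map
        (((Equiv.sigmaCongrRight fun v => (H v).vertexLabel Prod.fst (H v).lam_in).trans
          (Equiv.sigmaAssoc fun v w => ((d v w).1 : Type)).symm).sumCongr
            (G.boundaryLabel G.beta_out))
        ((G.vertexLabel Prod.snd G.lam_out).sumCongr (G.vertexLabel Prod.fst G.lam_in)) := by
  have hG : ∀ s x, G.substBegin H s = .inl x →
      (plugEnd (fun v => (c v).swap) (fun v w => (d v w).swap) b.2).symm (.inl (G.toDiagram.p
        (x.map (G.vertexLabel Prod.snd G.lam_out) (G.boundaryLabel G.beta_in)))) =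
      (G.substStrands H s).map
        (((Equiv.sigmaCongrRight fun v => (H v).vertexLabel Prod.fst (H v).lam_in).trans
          (Equiv.sigmaAssoc fun v w => ((d v w).1 : Type)).symm).sumCongr
            (G.boundaryLabel G.beta_out))
        ((G.vertexLabel Prod.snd G.lam_out).sumCongr (G.vertexLabel Prod.fst G.lam_in)) := by
    intro s x hs
    rw [toDiagram_p]
    rcases he : G.edge x with f | f
    · rw [(G.substStrands_eq_iff H (t := .inr (.inr f))).2 (by rw [hs]; exact congrArg Sum.inl he)]
      rfl
    · rw [(G.substStrands_eq_iff H (t := .inl (.inr f))).2 (by rw [hs]; exact congrArg Sum.inl he)]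
      rfl
  have hH : ∀ s v x, G.substBegin H s = .inr ⟨v, x⟩ →
      (plugEnd (fun v => (c v).swap) (fun v w => (d v w).swap) b.2).symm
        (.inr ⟨v, (H v).toDiagram.p (x.map ((H v).vertexLabel Prod.snd (H v).lam_out)
          ((H v).boundaryLabel (H v).beta_in))⟩) =
      (G.substStrands H s).map
        (((Equiv.sigmaCongrRight fun v => (H v).vertexLabel Prod.fst (H v).lam_in).trans
          (Equiv.sigmaAssoc fun v w => ((d v w).1 : Type)).symm).sumCongr
            (G.boundaryLabel G.beta_out))
        ((G.vertexLabel Prod.snd G.lam_out).sumCongr (G.vertexLabel Prod.fst G.lam_in)) := by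
    intro s v x hs
    rw [toDiagram_p]
    have he' : ∀ y, (H v).edge x = y →
        (G.edge.sumCongr (Equiv.sigmaCongrRight fun v => (H v).edge)) (.inr ⟨v, x⟩) =
          .inr ⟨v, y⟩ := by
      rintro _ rfl
      rfl
    rcases he : (H v).edge x with f | f
    · rw [(G.substStrands_eq_iff H (t := .inl (.inl ⟨v, f⟩))).2 (by rw [hs]; exact he' _ he)]
      rfl
    -- A strand that ends at a leg of `H v` is continued at the flag of `G` identified with this
    -- leg.
    · have h1 : G.substEnd H (.inr (.inl ((G.legOut H).symm ⟨v, f⟩))) = .inr ⟨v, .inr f⟩ :=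
        (G.substEnd_inr_inl H _).trans (by rw [Equiv.apply_symm_apply]; rfl)
      rw [(G.substStrands_eq_iff H (t := .inr (.inl ((G.legOut H).symm ⟨v, f⟩)))).2
        (by rw [hs, h1]; exact he' _ he)]
      have h2 : G.vertexLabel Prod.snd G.lam_out ((G.legOut H).symm ⟨v, f⟩) =
          ⟨v, (H v).boundaryLabel (H v).beta_out f⟩ :=
        (G.vertexLabel Prod.snd G.lam_out).apply_symm_apply _
      exact congrArg (fun y => Sum.inr (Sum.inl y)) h2.symm
  rcases s with (⟨v, f⟩ | f) | (f | f)
  · exact hH _ v (.inl f) rfl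
  · exact hG _ (.inr f) rfl
  · exact hG _ (.inl f) rfl
  · obtain ⟨⟨v, g⟩, rfl⟩ := (G.legIn H).symm.surjective f
    have h1 : G.substBegin H (.inr (.inr ((G.legIn H).symm ⟨v, g⟩))) = .inr ⟨v, .inr g⟩ :=
        (G.substBegin_inr_inr H _).trans (by rw [Equiv.apply_symm_apply]; rfl)
    refine Eq.trans ?_ (hH _ v (.inr g) h1)
    have h2 : G.vertexLabel Prod.fst G.lam_in ((G.legIn H).symm ⟨v, g⟩) =
        ⟨v, (H v).boundaryLabel (H v).beta_in g⟩ :=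
      (G.vertexLabel Prod.fst G.lam_in).apply_symm_apply _
    exact congrArg (fun y => plug G.toDiagram.p (fun v => (H v).toDiagram) (.inr (.inr y))) h2

/-- The edges of `subst` are defined by gluing, so `plug_toDiagram` and the invariance of gluing
under renaming settle the matching; what remains is the count of loops. -/
theorem toDiagram_subst {U : Type} [Finite V] [Finite F] [∀ v, Finite (W v)] [∀ v, Finite (K v)]
    (G : FlagGraph c b F) (H : ∀ v, FlagGraph (d v) (c v) (K v)) (q : U ≃ Σ v, W v) :
    (G.subst H q).toDiagram = (G.toDiagram.multi fun v => (H v).toDiagram).reindex q := by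
  refine eq_reindex (e := q) (D := G.toDiagram.multi fun v => (H v).toDiagram) (fun s => ?_) ?_
  · obtain ⟨x, rfl⟩ := ((((Equiv.sigmaCongrRight fun v => (H v).vertexLabel Prod.snd
      (H v).lam_out).trans <| (Equiv.sigmaAssoc fun v w => ((d v w).2 : Type)).symm.trans
        (Equiv.sigmaCongrLeft (β := fun t : Σ v, W v => ((d t.1 t.2).2 : Type)) q).symm)).sumCongr
          (G.boundaryLabel G.beta_in)).surjective s
    have h1 : ∀ x, reindexPoints (fun t : Σ v, W v => (d t.1 t.2).swap) Prod.fst b.1 q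
        (Sum.map ((Equiv.sigmaCongrRight fun v => (H v).vertexLabel Prod.snd
      (H v).lam_out).trans <| (Equiv.sigmaAssoc fun v w => ((d v w).2 : Type)).symm.trans
        (Equiv.sigmaCongrLeft (β := fun t : Σ v, W v => ((d t.1 t.2).2 : Type)) q).symm)
          (G.boundaryLabel G.beta_in) x) =
        (((Equiv.sigmaCongrRight fun v => (H v).vertexLabel Prod.snd (H v).lam_out).trans
          (Equiv.sigmaAssoc fun v w => ((d v w).2 : Type)).symm).sumCongr
            (G.boundaryLabel G.beta_in)) x := by
      rintro (y | y)
      · exact congrArg Sum.inl (Equiv.apply_symm_apply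
          (Equiv.sigmaCongrLeft (β := fun t : Σ v, W v => ((d t.1 t.2).2 : Type)) q) _)
      · rfl
    have h2 : ∀ x, reindexPoints (fun t : Σ v, W v => (d t.1 t.2).swap) Prod.snd b.2 q
        (Sum.map ((Equiv.sigmaCongrRight fun v => (H v).vertexLabel Prod.fst
      (H v).lam_in).trans <| (Equiv.sigmaAssoc fun v w => ((d v w).1 : Type)).symm.trans
        (Equiv.sigmaCongrLeft (β := fun t : Σ v, W v => ((d t.1 t.2).1 : Type)) q).symm)
          (G.boundaryLabel G.beta_out) x) =
        (((Equiv.sigmaCongrRight fun v => (H v).vertexLabel Prod.fst (H v).lam_in).trans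
          (Equiv.sigmaAssoc fun v w => ((d v w).1 : Type)).symm).sumCongr
            (G.boundaryLabel G.beta_out)) x := by
      rintro (y | y)
      · exact congrArg Sum.inl (Equiv.apply_symm_apply
          (Equiv.sigmaCongrLeft (β := fun t : Σ v, W v => ((d t.1 t.2).1 : Type)) q) _)
      · rfl
    refine (congrArg (G.toDiagram.multi fun v => (H v).toDiagram).p (h1 x)).trans ?_
    refine (glue_transport _ _ _ (G.plug_toDiagram H) x).trans ?_
    refine (h2 _).symm.trans ?_
    exact congrArg (reindexPoints (fun t : Σ v, W v => (d t.1 t.2).swap) Prod.snd b.2 q)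
      (toDiagram_ofEdges_p _ _ _ _ _ _ _ _ x).symm
  · refine (toDiagram_ofEdges_l _ _ _ _ _ _ _ _).trans ?_
    have h1 := card_glueLoop_transport _ _ _ (G.plug_toDiagram H)
    -- Loops are counted by halving numbers of flags. Each of these numbers is even, so the halves
    -- of the summands add up to the half of the sum.
    have hG := card_div_two _ G.loopMate_loopMate G.loopMate_ne
    have hH := fun v => card_div_two _ (H v).loopMate_loopMate (H v).loopMate_ne
    have := Fintype.ofFinite V
    change _ = Nat.card G.LoopFlag / 2 + (∑ᶠ v, Nat.card (H v).LoopFlag / 2) +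
      Nat.card (GlueLoop (plug G.toDiagram.p fun v => (H v).toDiagram))
    rw [h1, finsum_eq_sum_of_fintype, Nat.card_sum, Nat.card_sum, Nat.card_prod, Nat.card_sigma]
    have h2 : ∑ v, Nat.card (H v).LoopFlag = 2 * ∑ v, Nat.card (H v).LoopFlag / 2 := by
      rw [Finset.mul_sum]
      exact Finset.sum_congr rfl fun v _ => (hH v).symm
    rw [h2]
    simp only [Nat.card_eq_fintype_card (α := Bool), Fintype.card_bool]
    omega

end Subst

theorem toDiagram_corolla (b : Profile L) : (corolla b).toDiagram = ident b.swap := by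
  refine WiringDiagram.ext (Equiv.ext fun y => ?_)
    ((toDiagram_ofEdges_l _ _ _ _ _ _ _ _).trans (by simp; rfl))
  obtain ⟨x, rfl⟩ := ((Equiv.uniqueSigma fun _ : Fin 1 => (b.2 : Type)).symm.sumCongr
    (Equiv.refl b.1)).surjective y
  refine (toDiagram_ofEdges_p _ _ _ _ _ _ _ _ x).trans ?_
  rcases x with a | a <;> rfl

end FlagGraph

/-! ## Graphs and wiring diagrams: the bijection and compositions -/

/-- The isomorphism of graphs with numbered vertices and flags. -/
def FlagGraph.IsIso.toIso {L : Type} {b : Profile L} {r r' n n' : ℕ} {c' : Fin r' → Profile L}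
    {s : Fin r ≃ Fin r'} {G : FlagGraph (fun v => c' (s v)) b (Fin n)}
    {G' : FlagGraph c' b (Fin n')} {φ : Fin n ≃ Fin n'} {θ : ∀ v', LabelGroup (c' v')}
    (h : FlagGraph.IsIso G G' φ θ) : OGraph.Iso ⟨r, _, n, G⟩ ⟨r', c', n', G'⟩ where
  s := s
  nbh _ := rfl
  φ := φ
  θ := θ
  cell := h.cell
  ι := h.ι
  π := h.π
  δ := h.δ
  beta := h.beta
  lam_in f hf hf' v' hv hδ := (h.lam f hf hf' v' hv).trans (by
    have hδ' : G.δ ⟨f, Or.inl hf⟩ = 1 := hδ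
    rw [hδ']
    rfl)
  lam_out f hf hf' v' hv hδ := (h.lam f hf hf' v' hv).trans (by
    have hδ' : G.δ ⟨f, Or.inl hf⟩ = -1 := hδ
    rw [hδ']
    rfl)

namespace OGraph

variable {L : Type} {b : Profile L}

theorem toWiringDiagram_ofFlagGraph {F : Type} [Finite F] {r : ℕ} {c : Fin r → Profile L}
    (G : FlagGraph c b F) : (ofFlagGraph G).toWiringDiagram = G.toDiagram :=
  G.toDiagram_transport _

theorem toWiringDiagram_subst (G : OGraph b) (H : ∀ v, OGraph (G.c v)) :
    (G.subst H).toWiringDiagram =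
      (G.toWiringDiagram.multi fun v => (H v).toWiringDiagram).reindex finSigmaFinEquiv.symm :=
  (toWiringDiagram_ofFlagGraph _).trans (G.graph.toDiagram_subst _ _)

theorem toWiringDiagram_corolla (b : Profile L) :
    (corolla b).toWiringDiagram = ident b.swap :=
  (toWiringDiagram_ofFlagGraph _).trans (FlagGraph.toDiagram_corolla b)

theorem toWiringDiagram_relabel (g : LabelGroup b) (G : OGraph b) :
    (G.relabel g).toWiringDiagram = G.toWiringDiagram.conjOut g.perms :=
  G.graph.toDiagram_relabel g

/-- The relation that an isomorphism imposes on decorated graphs, carried over to diagrams: the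
permutation of the vertices disappears in the class and only the relabelling is left. -/
theorem Iso.node_eq {G G' : OGraph b} (e : G.Iso G') {E : Profile L → Type u}
    (y : ∀ v', E (G'.c v').swap) :
    node G.toWiringDiagram (fun v => cast (congrArg (fun b => E b.swap) (e.nbh v).symm) (y (e.s v))) =
      node (G'.toWiringDiagram.conj fun v' => (e.θ v').perms) y := by
  obtain ⟨r, c, n, G⟩ := G
  obtain ⟨r', c', n', G'⟩ := G'
  obtain ⟨s, nbh, φ, θ, h1, h2, h3, h4, h5, h6, h7⟩ := e
  change Fin r ≃ Fin r' at s
  change ∀ v, c v = c' (s v) at nbh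
  obtain rfl : c = fun v => c' (s v) := funext nbh
  have h : FlagGraph.IsIso G G' φ θ := ⟨h1, h2, h3, h4, h5, fun f hf hf' v' hv => by
    rcases Int.units_eq_one_or (G.δ ⟨f, Or.inl hf⟩) with hδ | hδ
    · rw [hδ]
      exact h6 f hf hf' v' hv hδ
    · rw [hδ]
      exact h7 f hf hf' v' hv hδ⟩
  refine Eq.trans ?_ (node_reindex (G'.toDiagram.conj fun v' => (θ v').perms) y s)
  exact congrArg (fun D => node D fun v => y (s v)) h.toDiagram

theorem _root_.monotone_equiv_fin_eq_refl {r : ℕ} (s : Fin r ≃ Fin r) (hs : Monotone s) :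
    s = Equiv.refl _ := by
  let o : Fin r ≃o Fin r := ⟨s, (hs.strictMono_of_injective s.injective).le_iff_le⟩
  have h : o = OrderIso.refl _ := Subsingleton.elim _ _
  exact congrArg (fun o : Fin r ≃o Fin r => o.toEquiv) h

/-- A monotone bijection of initial segments is the identity, so a strict isomorphism preserves the
colours and, by `IsIso.toDiagram` with trivial `θ`, the diagram. The converse is `exists_isIso`. -/
theorem strictIso_iff {G G' : OGraph b} : StrictIso G G' ↔
    (⟨G.r, _, G.toWiringDiagram⟩ : Σ (r : ℕ) (c : Fin r → Profile L), WiringDiagram c b.swap) =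
      ⟨G'.r, _, G'.toWiringDiagram⟩ := by
  obtain ⟨r, c, n, G⟩ := G
  obtain ⟨r', c', n', G'⟩ := G'
  constructor
  · rintro ⟨⟨s, nbh, φ, θ, h1, h2, h3, h4, h5, h6, h7⟩, hs, hθ⟩
    obtain rfl : r = r' := by simpa using Fintype.card_congr s
    obtain rfl : s = Equiv.refl _ := monotone_equiv_fin_eq_refl s hs
    obtain rfl : c = c' := funext nbh
    obtain rfl : θ = fun _ => 1 := funext hθ
    have h : FlagGraph.IsIso (s := Equiv.refl (Fin r)) G G' φ fun _ => 1 :=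
      ⟨h1, h2, h3, h4, h5, fun f hf hf' v' hv => by
        rcases Int.units_eq_one_or (G.δ ⟨f, Or.inl hf⟩) with hδ | hδ
        · rw [hδ]
          exact h6 f hf hf' v' hv hδ
        · rw [hδ]
          exact h7 f hf hf' v' hv hδ⟩
    have h' := h.toDiagram.trans (FlagGraph.conj_perms_one_reindex _)
    exact congrArg (fun D => (⟨r, _, D⟩ :
      Σ (r : ℕ) (c : Fin r → Profile L), WiringDiagram c b.swap)) h'
  · intro h
    obtain rfl : r = r' := congrArg Sigma.fst h
    have h1 := eq_of_heq (Sigma.mk.inj h).2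
    obtain rfl : c = c' := funext fun v =>
      Prod.swap_injective (congrFun (congrArg Sigma.fst h1) v)
    have h2 : G.toDiagram = G'.toDiagram := eq_of_heq (Sigma.mk.inj h1).2
    obtain ⟨φ, hφ⟩ := FlagGraph.exists_isIso (s := Equiv.refl (Fin r)) (G := G) (G' := G')
      (θ := fun _ => 1) (h2.trans (FlagGraph.conj_perms_one_reindex _).symm)
    exact ⟨hφ.toIso, monotone_id, fun _ => rfl⟩

end OGraph

/-! ### Partial composition is substitution at one vertex -/

namespace WiringDiagram

variable {L : Type}

theorem toWiringDiagram_toGraph {r : ℕ} {c : Fin r → Profile L} {c₀ : Profile L}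
    (D : WiringDiagram c c₀) : D.toGraph.toWiringDiagram = D := by
  refine (OGraph.toWiringDiagram_ofFlagGraph _).trans (WiringDiagram.ext (Equiv.ext fun y => ?_) ?_)
  · refine (congrArg _ ?_).trans ((FlagGraph.toDiagram_ofEdges_p _ _ _ _ _ _ _ _ y).trans ?_)
    · rcases y with y | y <;> rfl
    · rcases D.p y with y | y <;> rfl
  · refine (FlagGraph.toDiagram_ofEdges_l _ _ _ _ _ _ _ _).trans ?_
    simp

/-- A circle decorated by its own number cannot be renumbered without changing the decoration. Thus
an equality of numbered diagrams, awkward because of the dependence on colours, can be proved among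
classes, where grafting laws are available. -/
theorem eq_of_node_val_eq {c₀ : Profile L} {r r' : ℕ} {c : Fin r → Profile L}
    {c' : Fin r' → Profile L} {D : WiringDiagram c c₀} {D' : WiringDiagram c' c₀}
    (h : node (E := fun _ => ℕ) D (fun m => m.1) = node (E := fun _ => ℕ) D' (fun m => m.1)) :
    (⟨r, c, D⟩ : Σ (r : ℕ) (c : Fin r → Profile L), WiringDiagram c c₀) = ⟨r', c', D'⟩ := by
  rw [node_fin, node_fin] at h
  obtain ⟨r₁, e, he⟩ := Quotient.exact h
  obtain ⟨rfl, h1⟩ := Decorated.mk.inj he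
  obtain rfl : r = r' := by simpa using Fintype.card_congr e
  have hx := h1.2.2
  have he' : e = Equiv.refl _ := Equiv.ext fun m => Fin.ext (congrFun (eq_of_heq hx) m).symm
  subst he'
  have h2 := he.trans (Decorated.reindex_refl _)
  exact congrArg (fun P : Decorated (fun _ => ℕ) c₀ =>
    (⟨P.r, P.c, P.D⟩ : Σ (r : ℕ) (c : Fin r → Profile L), WiringDiagram c c₀)) h2

/-- The number of vertices that precede those replacing vertex `v`, if vertex `i` is replaced by `s`
vertices and every other one by a single vertex. The subtraction is used only for `v > i`, so it
does not truncate. -/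
theorem sum_range_ite_eq (i s v : ℕ) :
    ∑ j ∈ Finset.range v, (if j = i then s else 1) = if v ≤ i then v else v - 1 + s := by
  induction v with
  | zero => simp
  | succ v ih =>
    rw [Finset.sum_range_succ, ih]
    split_ifs <;> omega

/-- Circle `w` of `D'` gets the number `i + w`; a circle of `D` keeps its number before `i` and is
shifted by `s - 1` after it. The numbers travel through `graft_insertInput` as decorations.
Lexicographic numbering gives the same values in `node_substAt_val`. -/
theorem node_comp_val {r s : ℕ} {c : Fin r → Profile L} {c₀ : Profile L} (D : WiringDiagram c c₀)
    (i : Fin r) {d : Fin s → Profile L} (D' : WiringDiagram d (c i)) :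
    node (E := fun _ => ℕ) (D.comp i D') (fun m => m.1) =
      graft D (insertInput i (node D' fun w => i.1 + w.1)
        fun j => leaf (if j.1.1 ≤ i.1 then j.1.1 else j.1.1 - 1 + s)) := by
  let k : {j // j ≠ i} ⊕ Fin s → ℕ := fun t => ((slot i s).symm t).1
  have h1 : node (E := fun _ => ℕ) (D.comp i D') (fun m => m.1) = node (D.compAt i D') k := by
    rw [← node_reindex (E := fun _ => ℕ) (D.compAt i D') k (slot i s)]
    refine congrArg (node (D.comp i D')) (funext fun m => ?_)
    exact congrArg Fin.val ((slot i s).symm_apply_apply m).symm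
  have h2 : node (E := fun _ => ℕ) (D.compAt i D') k =
      graft (D.compAt i D') fun t => leaf (E := fun _ => ℕ) (k t) :=
    (graft_leaf (E := fun _ => ℕ) (D.compAt i D') k).symm
  rw [h1, h2, ← graft_insertInput D D' fun t => leaf (E := fun _ => ℕ) (k t)]
  refine congrArg (graft D) (congrArg₂ (insertInput i) (graft_leaf D' _) (funext fun j => ?_))
  refine congrArg leaf ?_
  have hj : j.1.1 ≠ i.1 := Fin.val_ne_of_ne j.2
  by_cases h : j.1.1 < i.1
  · rw [if_pos h.le]
    exact congrArg Fin.val (dif_pos h)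
  · rw [if_neg (by omega)]
    exact congrArg Fin.val (dif_neg h)

theorem node_substAt_val {r s : ℕ} {c : Fin r → Profile L} {c₀ : Profile L}
    (D : WiringDiagram c c₀) (i : Fin r) {d : Fin s → Profile L} (D' : WiringDiagram d (c i)) :
    node (E := fun _ => ℕ) (D.toGraph.substAt i D'.toGraph).toWiringDiagram (fun m => m.1) =
      graft D (insertInput i (node D' fun w => i.1 + w.1)
        fun j => leaf (if j.1.1 ≤ i.1 then j.1.1 else j.1.1 - 1 + s)) := by
  let H : ∀ v : Fin r, OGraph (c v).swap :=
    Function.update (fun w => OGraph.corolla (c w).swap) i D'.toGraph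
  have hHi : H i = D'.toGraph := Function.update_self i _ _
  have hHj : ∀ v, v ≠ i → H v = OGraph.corolla (c v).swap := fun v h => Function.update_of_ne h _ _
  have hr : ∀ v, (H v).r = if v.1 = i.1 then s else 1 := by
    intro v
    by_cases h : v = i
    · subst h
      rw [if_pos rfl]
      exact congrArg OGraph.r hHi
    · rw [if_neg fun h' => h (Fin.ext h')]
      exact congrArg OGraph.r (hHj v h)
  -- In the lexicographic numbering the offset of `H v` is the number of vertices of the graphs
  -- before it.
  have hN : ∀ v w, (finSigmaFinEquiv (n := fun v => (H v).r) ⟨v, w⟩ : ℕ) =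
      (if v.1 ≤ i.1 then v.1 else v.1 - 1 + s) + w.1 := by
    intro v w
    rw [finSigmaFinEquiv_apply]
    congr 1
    simp only [hr]
    rw [← sum_range_ite_eq, Finset.sum_range]
    rfl
  have h1 : node (E := fun _ => ℕ) (D.toGraph.substAt i D'.toGraph).toWiringDiagram (fun m => m.1) =
      graft D fun v => node (H v).toWiringDiagram fun w =>
        (if v.1 ≤ i.1 then v.1 else v.1 - 1 + s) + w.1 := by
    rw [graft_node]
    have h2 := OGraph.toWiringDiagram_subst D.toGraph H
    rw [toWiringDiagram_toGraph] at h2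
    refine (congrArg (fun D => node (E := fun _ => ℕ) D fun m => m.1) h2).trans ?_
    refine Eq.trans ?_ (node_reindex (D.multi fun v => (H v).toWiringDiagram) _
      finSigmaFinEquiv.symm)
    refine congrArg (node _) (funext fun m => ?_)
    rw [← hN]
    exact congrArg Fin.val (finSigmaFinEquiv.apply_symm_apply m).symm
  rw [h1]
  refine congrArg (graft D) (eq_insertInput ?_ fun j => ?_)
  · refine (congrArg (fun K : OGraph (c i).swap => node (E := fun _ => ℕ) K.toWiringDiagram fun w =>
      (if i.1 ≤ i.1 then i.1 else i.1 - 1 + s) + w.1) hHi).trans ?_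
    rw [toWiringDiagram_toGraph, if_pos le_rfl]
    rfl
  · refine (congrArg (fun K : OGraph (c j).swap => node (E := fun _ => ℕ) K.toWiringDiagram fun w =>
      (if j.1.1 ≤ i.1 then j.1.1 else j.1.1 - 1 + s) + w.1) (hHj j j.2)).trans ?_
    rw [OGraph.toWiringDiagram_corolla]
    refine congrArg (node _) (funext fun w => ?_)
    obtain rfl := Subsingleton.elim (α := Fin 1) w 0
    rfl

end WiringDiagram

theorem OGraph.strictIso_comp {L : Type} {r s : ℕ} {c : Fin r → Profile L} {c₀ : Profile L}
    (D : WiringDiagram c c₀) (i : Fin r) {d : Fin s → Profile L} (D' : WiringDiagram d (c i)) :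
    OGraph.StrictIso (D.comp i D').toGraph (D.toGraph.substAt i D'.toGraph) := by
  refine OGraph.strictIso_iff.2 (eq_of_node_val_eq ?_)
  rw [toWiringDiagram_toGraph]
  exact (node_comp_val D i D').trans (node_substAt_val D i D').symm

theorem OGraph.exists_equiv_wiringDiagram (L : Type) :
    ∃ Φ : ∀ b : Profile L, Quot (OGraph.StrictIso (b := b)) ≃
        Σ (r : ℕ) (c : Fin r → Profile L), WiringDiagram c b.swap,
      (∀ b (G : OGraph b), Φ b (Quot.mk _ G) = ⟨G.r, _, G.toWiringDiagram⟩) ∧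
      (∀ (b : Profile L) (r : ℕ) (c : Fin r → Profile L) (D : WiringDiagram c b.swap),
        (Φ b).symm ⟨r, c, D⟩ = Quot.mk _ D.toGraph) := by
  have h : ∀ (b : Profile L) (r : ℕ) (c : Fin r → Profile L) (D : WiringDiagram c b.swap),
      (⟨D.toGraph.r, _, D.toGraph.toWiringDiagram⟩ :
        Σ (r : ℕ) (c : Fin r → Profile L), WiringDiagram c b.swap) = ⟨r, c, D⟩ := fun b r c D =>
    congrArg (fun D => (⟨r, c, D⟩ : Σ (r : ℕ) (c : Fin r → Profile L), WiringDiagram c b.swap))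
      (toWiringDiagram_toGraph D)
  refine ⟨fun b => ⟨Quot.lift (fun G => ⟨G.r, _, G.toWiringDiagram⟩) fun G G' hG =>
    OGraph.strictIso_iff.1 hG, fun D => Quot.mk _ D.2.2.toGraph, ?_, ?_⟩, fun _ _ => rfl,
    fun _ _ _ _ => rfl⟩
  · rintro ⟨G⟩
    exact Quot.sound (OGraph.strictIso_iff.2 (h b _ _ G.toWiringDiagram))
  · rintro ⟨r, c, D⟩
    exact h b r c D

/-! ## Functions that are linear in each variable -/

section Multilinear

variable (k : Type u) [Field k] {ι ι' : Type} {M : ι → Type u} [∀ i, AddCommGroup (M i)]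
  [∀ i, Module k (M i)] {N N' : Type u} [AddCommGroup N] [Module k N] [AddCommGroup N'] [Module k N']

open Classical in
/-- The function `f` is linear in each variable. -/
def IsMultilin (f : (∀ i, M i) → N) : Prop :=
  ∀ i x, ∃ ℓ : M i →ₗ[k] N, ∀ v, f (Function.update x i v) = ℓ v

theorem MultilinearMap.isMultilin (f : MultilinearMap k M N) : IsMultilin k f := by
  classical
  intro i x
  refine ⟨f.toLinearMap x i, fun v => ?_⟩
  rw [MultilinearMap.toLinearMap_apply]

variable {k}

namespace IsMultilin

/-- The multilinear map. -/
def toMultilinearMap {f : (∀ i, M i) → N} (h : IsMultilin k f) : MultilinearMap k M N where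
  toFun := f
  map_update_add' {inst} x i v w := by
    obtain ⟨ℓ, hℓ⟩ := h i x
    have h' : ∀ v, f (Function.update x i v) = ℓ v := fun v =>
      Eq.trans (congrArg f (by congr!)) (hℓ v)
    rw [h', h', h', map_add]
  map_update_smul' {inst} x i a v := by
    obtain ⟨ℓ, hℓ⟩ := h i x
    have h' : ∀ v, f (Function.update x i v) = ℓ v := fun v =>
      Eq.trans (congrArg f (by congr!)) (hℓ v)
    rw [h', h', map_smul]

theorem linear_comp {f : (∀ i, M i) → N} (h : IsMultilin k f) (g : N →ₗ[k] N') :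
    IsMultilin k fun x => g (f x) := by
  intro i x
  obtain ⟨ℓ, hℓ⟩ := h i x
  exact ⟨g.comp ℓ, fun v => congrArg g (hℓ v)⟩

/-- Serves to regard a multilinear function as a function of one block of its variables, the others
being frozen in `F`. -/
theorem comp_update {f : (∀ i, M i) → N} (h : IsMultilin k f) {M' : ι' → Type u}
    [∀ i, AddCommGroup (M' i)] [∀ i, Module k (M' i)] (e : ι' → ι)
    (F : (∀ i', M' i') → ∀ i, M i) (g : ∀ i', M' i' →ₗ[k] M (e i'))
    (h₁ : ∀ x i' v, F (open Classical in Function.update x i' v) (e i') = g i' v)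
    (h₂ : ∀ x i' v i, i ≠ e i' → F (open Classical in Function.update x i' v) i = F x i) :
    IsMultilin k fun x => f (F x) := by
  classical
  intro i' x
  obtain ⟨ℓ, hℓ⟩ := h (e i') (F x)
  refine ⟨ℓ.comp (g i'), fun v => Eq.trans (congrArg f (funext fun i => ?_)) (hℓ (g i' v))⟩
  by_cases hi : i = e i'
  · subst hi
    rw [Function.update_self]
    exact h₁ x i' v
  · rw [Function.update_of_ne hi]
    exact h₂ x i' v i hi

theorem comp_equiv (e : ι' ≃ ι) {f : (∀ i, M (e i)) → N} (h : IsMultilin k f) :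
    IsMultilin k fun x : ∀ i, M i => f fun i => x (e i) := by
  classical
  intro i x
  obtain ⟨j, rfl⟩ := e.surjective i
  obtain ⟨ℓ, hℓ⟩ := h j fun i => x (e i)
  refine ⟨ℓ, fun v => Eq.trans (congrArg f (funext fun i => ?_)) (hℓ v)⟩
  by_cases hi : i = j
  · subst hi
    rw [Function.update_self, Function.update_self]
  · rw [Function.update_of_ne hi, Function.update_of_ne (e.injective.ne hi)]

variable [Finite ι] {A : ι → Type u}

theorem ext_of_span {f f' : (∀ i, M i) → N} (h : IsMultilin k f) (h' : IsMultilin k f')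
    (g : ∀ i, A i → M i) (hg : ∀ i, Submodule.span k (Set.range (g i)) = ⊤)
    (H : ∀ q : ∀ i, A i, f (fun i => g i (q i)) = f' fun i => g i (q i)) (x) : f x = f' x := by
  classical
  have := Fintype.ofFinite ι
  -- The variables are freed one at a time: `t` is the set of those not required to be generators.
  suffices key : ∀ (t : Finset ι) (x : ∀ i, M i), (∀ i ∉ t, x i ∈ Set.range (g i)) → f x = f' x from
    key Finset.univ x fun i hi => absurd (Finset.mem_univ i) hi
  intro t
  induction t using Finset.induction_on with
  | empty =>
    intro x hx
    choose q hq using fun i => hx i (Finset.notMem_empty i)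
    rw [← funext hq]
    exact H q
  | insert i t hi ih =>
    intro x hx
    obtain ⟨ℓ, hℓ⟩ := h i x
    obtain ⟨ℓ', hℓ'⟩ := h' i x
    have e : ℓ = ℓ' := by
      refine LinearMap.ext_on_range (hg i) fun a => ?_
      rw [← hℓ, ← hℓ']
      refine ih _ fun j hj => ?_
      by_cases hji : j = i
      · subst hji
        rw [Function.update_self]
        exact ⟨a, rfl⟩
      · rw [Function.update_of_ne hji]
        exact hx j fun hj' => (Finset.mem_insert.1 hj').elim hji hj
    have h1 := hℓ (x i)
    have h2 := hℓ' (x i)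
    rw [Function.update_eq_self] at h1 h2
    rw [h1, h2, e]

end IsMultilin

/-- A function on generators extends multilinearly if it extends linearly in each variable while the
others are generators. One extends it freely to formal combinations of generators and restricts
along linear sections of the projections onto the `M i`; the hypothesis shows that replacing a
generator by its section does not change the value. -/
theorem exists_multilinearMap_of_span [Finite ι] {A : ι → Type u} (g : ∀ i, A i → M i)
    (hg : ∀ i, Submodule.span k (Set.range (g i)) = ⊤) (f : (∀ i, A i) → N)
    (hf : ∀ i (q : ∀ i, A i), ∃ h : M i →ₗ[k] N,
      ∀ a, f (open Classical in Function.update q i a) = h (g i a)) :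
    ∃ F : MultilinearMap k M N, ∀ q : ∀ i, A i, F (fun i => g i (q i)) = f q := by
  classical
  have := Fintype.ofFinite ι
  let p : ∀ i, (A i →₀ k) →ₗ[k] M i := fun i => Finsupp.linearCombination k (g i)
  have hp : ∀ i, LinearMap.range (p i) = ⊤ := fun i =>
    (Finsupp.range_linearCombination k).trans (hg i)
  -- Linear sections exist because `k` is a field.
  choose s hs using fun i => (p i).exists_rightInverse_of_surjective (hp i)
  let F₀ : MultilinearMap k (fun i => A i →₀ k) N :=
    ((Finsupp.linearCombination k f).comp
      (PiTensorProduct.ofFinsuppEquiv' (R := k) (κ := A)).toLinearMap).compMultilinearMap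
        (PiTensorProduct.tprod k)
  have hF₀ : ∀ q : ∀ i, A i, F₀ (fun i => Finsupp.single (q i) 1) = f q := by
    intro q
    change Finsupp.linearCombination k f (PiTensorProduct.ofFinsuppEquiv' (PiTensorProduct.tprod k
      fun i => Finsupp.single (q i) (1 : k))) = f q
    rw [PiTensorProduct.ofFinsuppEquiv'_tprod_single (fun i => q i) fun _ => (1 : k)]
    simp
  refine ⟨F₀.compLinearMap s, fun q => ?_⟩
  suffices key : ∀ (t : Finset ι) (q : ∀ i, A i),
      F₀ (fun i => if i ∈ t then s i (g i (q i)) else Finsupp.single (q i) 1) = f q by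
    refine Eq.trans ?_ (key Finset.univ q)
    simp [MultilinearMap.compLinearMap_apply]
  intro t
  induction t using Finset.induction_on with
  | empty =>
    intro q
    simpa using hF₀ q
  | insert i t hi ih =>
    intro q
    obtain ⟨h, hh⟩ := hf i q
    let z : ∀ i, A i →₀ k := fun i => if i ∈ t then s i (g i (q i)) else Finsupp.single (q i) 1
    -- In the variable `i`, with the others partly replaced already, `F₀` factors through `p i`. By
    -- the induction hypothesis this can be tested on single generators, where it is the assumption
    -- on `f`.
    have e : F₀.toLinearMap z i = h.comp (p i) := by
      refine Finsupp.lhom_ext' fun a => LinearMap.ext_ring ?_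
      change F₀ (Function.update z i (Finsupp.single a 1)) = h (p i (Finsupp.single a 1))
      have h1 : p i (Finsupp.single a 1) = g i a := by simp [p]
      rw [h1, ← hh a]
      refine Eq.trans (congrArg F₀ (funext fun j => ?_)) ((ih (Function.update q i a)).trans
        (congrArg f (by congr!)))
      by_cases hj : j = i
      · subst hj
        simp [hi]
      · simp [hj, z]
    have h2 := LinearMap.congr_fun e (s i (g i (q i)))
    have h3 : p i (s i (g i (q i))) = g i (q i) := LinearMap.congr_fun (hs i) _
    change F₀ (Function.update z i (s i (g i (q i)))) = h (p i (s i (g i (q i)))) at h2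
    rw [h3, ← hh, Function.update_eq_self] at h2
    refine Eq.trans (congrArg F₀ (funext fun j => ?_)) h2
    by_cases hj : j = i
    · subst hj
      simp
    · simp [hj, z]

end Multilinear

/-! ## The space of decorated graphs in terms of decorated wiring diagrams -/

namespace WiringDiagram

theorem conj_reindex {L ι ι' : Type} {c : ι → Profile L} {c₀ : Profile L} (D : WiringDiagram c c₀)
    (θ : ∀ i, Equiv.Perm (c i).1 × Equiv.Perm (c i).2) (e : ι' ≃ ι) :
    (D.reindex e).conj (fun i => θ (e i)) = (D.conj θ).reindex e := by
  refine eq_conj_reindex_iff.2 ⟨fun y => ?_, rfl⟩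
  obtain ⟨h, -⟩ := eq_conj_reindex_iff (D := D.reindex e) (s := Equiv.refl ι')
    (θ := fun i => θ (e i)) |>.1 (reindex_refl _).symm
  have h1 : ∀ (q : Profile L → Finset L) (A : Type) (σ : ∀ i, Equiv.Perm (q (c i))) (y),
      labelPoints c q A e σ y = reindexPoints c q A e
        (labelPoints (fun i => c (e i)) q A (Equiv.refl ι') (fun i => σ (e i)) y) := by
    rintro q A σ (⟨i, a⟩ | a) <;> rfl
  exact (congrArg D.p (h1 _ _ (fun i => (θ i).1) y)).trans ((p_reindexPoints D e _).trans
    ((congrArg _ (h y)).trans (h1 _ _ (fun i => (θ i).2) _).symm))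

end WiringDiagram

namespace SBimodule

variable {k : Type u} [Field k] {L : Type}

/-- The decorations of input circles. -/
abbrev Dec (E : SBimodule k L) : Profile L → Type u := fun S => E.carrier S.swap

variable (E : SBimodule k L)

theorem ofGraph_eq_of_toDiagram_eq {b : Profile L} {r r' n n' : ℕ} {c' : Fin r' → Profile L}
    {s : Fin r ≃ Fin r'} {G : FlagGraph (fun v => c' (s v)) b (Fin n)}
    {G' : FlagGraph c' b (Fin n')} {θ : ∀ v', LabelGroup (c' v')}
    (h : G.toDiagram = (G'.toDiagram.conj fun v' => (θ v').perms).reindex s)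
    (y : ∀ v', E.carrier (c' v')) :
    E.ofGraph ⟨r, _, n, G⟩ (PiTensorProduct.tprod k fun v => y (s v)) =
      E.ofGraph ⟨r', c', n', G'⟩ (PiTensorProduct.tprod k fun v' => E.ρ _ (θ v') (y v')) := by
  obtain ⟨φ, hφ⟩ := FlagGraph.exists_isIso h
  exact E.ofGraph_iso hφ.toIso y

theorem ofGraph_conj_reindex {c₀ : Profile L} {r r' : ℕ} {c' : Fin r' → Profile L} (s : Fin r ≃ Fin r')
    (D : WiringDiagram c' c₀) (θ : ∀ v', LabelGroup (c' v').swap) (y : ∀ v', E.carrier (c' v').swap) :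
    E.ofGraph ((D.conj fun v' => (θ v').perms).reindex s).toGraph
        (PiTensorProduct.tprod k fun v => y (s v)) =
      E.ofGraph D.toGraph (PiTensorProduct.tprod k fun v' => E.ρ _ (θ v') (y v')) := by
  refine E.ofGraph_eq_of_toDiagram_eq (c' := fun v' => (c' v').swap) (s := s) (θ := θ) ?_ y
  refine (toWiringDiagram_toGraph _).trans ?_
  exact congrArg (fun D : WiringDiagram c' c₀ => (D.conj fun v' => (θ v').perms).reindex s)
    (toWiringDiagram_toGraph D).symm

theorem ofGraph_toGraph {b : Profile L} (G : OGraph b) (x : ∀ v, E.carrier (G.c v)) :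
    E.ofGraph G (PiTensorProduct.tprod k x) =
      E.ofGraph G.toWiringDiagram.toGraph (PiTensorProduct.tprod k x) := by
  have h := E.ofGraph_eq_of_toDiagram_eq (c' := G.c) (s := Equiv.refl _) (θ := fun _ => 1)
    (G := G.graph) (G' := G.toWiringDiagram.toGraph.graph) (by
      refine Eq.trans ?_ (FlagGraph.conj_perms_one_reindex _).symm
      exact (toWiringDiagram_toGraph G.toWiringDiagram).symm) x
  simp only [map_one] at h
  exact h

variable {c₀ : Profile L}

/-- The class of a decorated graph, in terms of its wiring diagram. -/
noncomputable def gen (q : DecClass E.Dec c₀) : E.Free c₀.swap :=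
  Quotient.lift (s := decoratedSetoid E.Dec c₀)
    (fun P => E.ofGraph P.D.toGraph (PiTensorProduct.tprod k P.x)) (by
      rintro _ ⟨r, c, D, x⟩ ⟨r', e, rfl⟩
      have h := E.ofGraph_conj_reindex e D (fun _ => 1) x
      have h1 : (fun v => (1 : LabelGroup (c v).swap).perms) = fun _ => 1 :=
        funext fun v => LabelGroup.perms_one
      rw [h1, conj_one] at h
      simp only [map_one] at h
      exact h) q

theorem gen_node {r : ℕ} {c : Fin r → Profile L} (D : WiringDiagram c c₀)
    (x : ∀ i, E.Dec (c i)) :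
    E.gen (node D x) = E.ofGraph D.toGraph (PiTensorProduct.tprod k x) := by
  rw [node_fin]
  rfl

theorem ofGraph_eq_gen {b : Profile L} (G : OGraph b) (x : ∀ v, E.carrier (G.c v)) :
    E.ofGraph G (PiTensorProduct.tprod k x) =
      E.gen (c₀ := b.swap) (node (E := E.Dec) G.toWiringDiagram x) := by
  rw [gen_node]
  exact E.ofGraph_toGraph G x

theorem gen_leaf {b : Profile L} (x : E.carrier b) :
    E.ofGraph (OGraph.corolla b) (PiTensorProduct.tprod k fun _ => x) =
      E.gen (c₀ := b.swap) (leaf (E := E.Dec) x) := by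
  refine (E.ofGraph_eq_gen (OGraph.corolla b) fun _ => x).trans ?_
  exact congrArg (fun D => E.gen (node (E := E.Dec) D fun _ => x)) (OGraph.toWiringDiagram_corolla b)

theorem hom_ext_gen {M : Type u} [AddCommGroup M] [Module k M] {f g : E.Free c₀.swap →ₗ[k] M}
    (h : ∀ q : DecClass E.Dec c₀, f (E.gen q) = g (E.gen q)) : f = g :=
  free_hom_ext fun G x => by
    rw [ofGraph_eq_gen]
    exact h _

/-- The projection modulo the span kills every generator, hence vanishes by `hom_ext_gen`. -/
theorem span_range_gen (c₀ : Profile L) :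
    Submodule.span k (Set.range (E.gen : DecClass E.Dec c₀ → E.Free c₀.swap)) = ⊤ := by
  rw [← Submodule.ker_mkQ (Submodule.span k (Set.range (E.gen : DecClass E.Dec c₀ → _))),
    LinearMap.ker_eq_top]
  refine E.hom_ext_gen fun q => ?_
  rw [Submodule.mkQ_apply, LinearMap.zero_apply, Submodule.Quotient.mk_eq_zero]
  exact Submodule.subset_span ⟨q, rfl⟩

theorem relabelMap_gen {b : Profile L} (g : LabelGroup b) (q : DecClass E.Dec b.swap) :
    E.relabelMap g (E.gen q) = E.gen (graft (permDiag (S := b.swap) g.perms) fun _ => q) := by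
  obtain ⟨r, c, D, x, rfl⟩ := exists_eq_node q
  rw [← node_conjOut, gen_node]
  refine (E.relabelMap_ofGraph g D.toGraph _).trans
    ((E.ofGraph_eq_gen (OGraph.relabel (b := b) g D.toGraph) x).trans ?_)
  have h := OGraph.toWiringDiagram_relabel g D.toGraph
  rw [toWiringDiagram_toGraph] at h
  exact congrArg (fun D => E.gen (node (E := E.Dec) D x)) h

section Node

variable {ι : Type} [Finite ι] {c : ι → Profile L} (D : WiringDiagram c c₀)

theorem gen_conj (θ : ∀ i, LabelGroup (c i).swap) (x : ∀ i, E.Dec (c i)) :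
    E.gen (node (D.conj fun i => (θ i).perms) x) =
      E.gen (node D fun i => E.ρ _ (θ i) (x i)) := by
  have e := (Finite.equivFin ι).symm
  rw [← node_reindex (E := E.Dec) (D.conj fun i => (θ i).perms) x e,
    ← node_reindex (E := E.Dec) D (fun i => E.ρ _ (θ i) (x i)) e, gen_node, gen_node]
  have h := E.ofGraph_conj_reindex (Equiv.refl _) (D.reindex e) (fun i => θ (e i)) fun i => x (e i)
  rw [reindex_refl] at h
  refine Eq.trans ?_ h
  exact congrArg (fun D : WiringDiagram (fun i => c (e i)) c₀ => E.ofGraph D.toGraph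
    (PiTensorProduct.tprod k fun i => x (e i))) (conj_reindex D (fun i => (θ i).perms) e).symm

theorem isMultilin_gen_node :
    IsMultilin k fun x : ∀ i, E.Dec (c i) => E.gen (node D x) := by
  have e := (Finite.equivFin ι).symm
  have h₀ : IsMultilin k fun x : ∀ i, E.Dec (c (e i)) =>
      E.ofGraph (D.reindex e).toGraph (PiTensorProduct.tprod k x) := MultilinearMap.isMultilin k
    ((E.ofGraph (D.reindex e).toGraph).compMultilinearMap (PiTensorProduct.tprod k))
  have h := IsMultilin.comp_equiv (k := k) (M := fun i => E.Dec (c i)) e h₀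
  refine (congrArg (IsMultilin k) (funext fun x => ?_)).mp h
  rw [← node_reindex (E := E.Dec) D x e, gen_node]

end Node

/-- The label-permuting diagram is the identity diagram relabelled at its input circle, and in the
colimit this relabelling moves onto the decoration. -/
theorem gen_node_permDiag {b : Profile L} (g : LabelGroup b) (x : E.carrier b) :
    E.gen (node (E := E.Dec) (permDiag (S := b.swap) g.perms) fun _ => x) =
      E.gen (leaf (E := E.Dec) (c₀ := b.swap) (E.ρ b g x)) := by
  have h := E.gen_conj (ident b.swap) (fun _ => g) fun _ => x
  rw [node_conj, graft_ident] at h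
  exact h

/-- The universal property of the colimit in terms of diagrams. Permutations of vertices are already
divided out in `DecClass`, so the only relations left to respect are multilinearity and relabelling
at vertices. -/
theorem exists_linearMap_gen {N : Type u} [AddCommGroup N] [Module k N] {S : Profile L}
    (f : DecClass E.Dec S → N)
    (hmul : ∀ {r : ℕ} {c : Fin r → Profile L} (D : WiringDiagram c S),
      IsMultilin k fun x : ∀ i, E.Dec (c i) => f (node D x))
    (hinv : ∀ {r : ℕ} {c : Fin r → Profile L} (D : WiringDiagram c S)
      (θ : ∀ i, LabelGroup (c i).swap) (x : ∀ i, E.Dec (c i)),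
      f (node (D.conj fun i => (θ i).perms) x) = f (node D fun i => E.ρ _ (θ i) (x i))) :
    ∃ h : E.Free S.swap →ₗ[k] N, ∀ q, h (E.gen q) = f q := by
  refine ⟨E.freeDesc (fun G => PiTensorProduct.lift (hmul (c := fun v => (G.c v).swap) G.toWiringDiagram).toMultilinearMap)
    fun G G' e y => ?_, fun q => ?_⟩
  · rw [PiTensorProduct.lift.tprod, PiTensorProduct.lift.tprod]
    refine Eq.trans ?_ (hinv G'.toWiringDiagram e.θ y)
    exact congrArg f (e.node_eq (E := E.Dec) y)
  · obtain ⟨r, c, D, x, rfl⟩ := exists_eq_node q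
    rw [gen_node, freeDesc_ofGraph]
    refine (PiTensorProduct.lift.tprod _).trans ?_
    exact congrArg (fun D => f (node (E := E.Dec) D x)) (toWiringDiagram_toGraph D)

end SBimodule

/-! ## The free algebra -/

namespace WiringDiagram

variable {L J κ : Type} {τ : J → Type} {c : Option J → Profile L} {d : κ → Profile L}
  {d' : ∀ j, τ j → Profile L}

/-- The family with `κ` at `none`. -/
def OptIndex (κ : Type) (τ : J → Type) : Option J → Type
  | none => κ
  | some j => τ j

instance [Finite κ] [∀ j, Finite (τ j)] (o : Option J) : Finite (OptIndex κ τ o) :=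
  match o with
  | none => inferInstanceAs (Finite κ)
  | some j => inferInstanceAs (Finite (τ j))

/-- The family with `d` at `none`. -/
def optColour (d : κ → Profile L) (d' : ∀ j, τ j → Profile L) : ∀ o, OptIndex κ τ o → Profile L
  | none => d
  | some j => d' j

/-- The family with `K` at `none`. -/
def optDiagram (K : WiringDiagram d (c none)) (K' : ∀ j, WiringDiagram (d' j) (c (some j))) :
    ∀ o, WiringDiagram (optColour d d' o) (c o)
  | none => K
  | some j => K' j

/-- The family with `x` at `none`. -/
def optDecoration {E : Profile L → Type u} (x : ∀ u, E (d u)) (x' : ∀ j u, E (d' j u)) :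
    ∀ (o : Option J) (u : OptIndex κ τ o), E (optColour d d' o u)
  | none => x
  | some j => x' j

/-- The family with `a` at `none`. -/
def optInput {A : Profile L → Type u} (a : A (c none)) (a' : ∀ j, A (c (some j))) : ∀ o, A (c o)
  | none => a
  | some j => a' j

/-- The family with `θ` at `none`, and trivial elsewhere. -/
def optPerm (θ : ∀ u, LabelGroup (d u).swap) (d' : ∀ j, τ j → Profile L) :
    ∀ o u, LabelGroup (optColour d d' o u).swap
  | none => θ
  | some _ => fun _ => 1

variable [Finite J] [Finite κ] [∀ j, Finite (τ j)] {c₀ : Profile L}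

theorem graft_optInput {E : Profile L → Type u} (D : WiringDiagram c c₀)
    (K : WiringDiagram d (c none)) (K' : ∀ j, WiringDiagram (d' j) (c (some j)))
    (x : ∀ u, E (d u)) (x' : ∀ j u, E (d' j u)) :
    graft D (optInput (node K x) fun j => node (K' j) (x' j)) =
      node (D.multi (optDiagram K K')) fun t => optDecoration x x' t.1 t.2 := by
  rw [← graft_node]
  refine congrArg (graft D) (funext fun o => ?_)
  rcases o with _ | j <;> rfl

end WiringDiagram

namespace SBimodule

variable {k : Type u} [Field k] {L : Type} (E : SBimodule k L) {c₀ : Profile L}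

section Option

variable {J κ : Type} {τ : J → Type} [Finite J] [Finite κ] [∀ j, Finite (τ j)]
  {c : Option J → Profile L} {d : κ → Profile L}
  {d' : ∀ j, τ j → Profile L} (D : WiringDiagram c c₀) (K : WiringDiagram d (c none))
  (K' : ∀ j, WiringDiagram (d' j) (c (some j))) (x' : ∀ j u, E.Dec (d' j u))

/-- After flattening, the decorations of `K` form one block of the decorations of the composite
diagram, in which the generator is multilinear. -/
theorem isMultilin_gen_graft_optInput :
    IsMultilin k fun x : ∀ u, E.Dec (d u) =>
      E.gen (graft D (optInput (A := DecClass E.Dec) (node K x) fun j => node (K' j) (x' j))) := by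
  classical
  simp only [graft_optInput]
  refine IsMultilin.comp_update (E.isMultilin_gen_node (D.multi (optDiagram K K')))
    (fun u => (⟨none, u⟩ : Σ o, OptIndex κ τ o)) _ (fun u => LinearMap.id) (fun x u v => ?_)
    fun x u v => ?_
  · exact Function.update_self u v x
  · rintro ⟨_ | j, u'⟩ h
    · exact Function.update_of_ne (fun h' : u' = u => h (by rw [h'])) v x
    · rfl

/-- Relabelling the circles of `K` relabels a block of circles of the flattened composite, where
`gen_conj` applies; the other circles are relabelled trivially. -/
theorem gen_graft_optInput_conj (θ : ∀ u, LabelGroup (d u).swap) (x : ∀ u, E.Dec (d u)) :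
    E.gen (graft D (optInput (A := DecClass E.Dec) (node (K.conj fun u => (θ u).perms) x)
      fun j => node (K' j) (x' j))) =
    E.gen (graft D (optInput (A := DecClass E.Dec) (node K fun u => E.ρ _ (θ u) (x u))
      fun j => node (K' j) (x' j))) := by
  rw [graft_optInput D K]
  have h1 := E.gen_conj (ι := Σ o, OptIndex κ τ o) (D.multi (optDiagram K K'))
    (fun t => optPerm θ d' t.1 t.2)
    (fun t => optDecoration (E := E.Dec) x x' t.1 t.2)
  have h2 : (fun t : Σ o, OptIndex κ τ o => E.ρ _ (optPerm θ d' t.1 t.2)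
      (optDecoration (E := E.Dec) x x' t.1 t.2)) =
      fun t : Σ o, OptIndex κ τ o => optDecoration (E := E.Dec) (fun u => E.ρ _ (θ u) (x u)) x' t.1 t.2 := by
    funext ⟨o, u⟩
    rcases o with _ | j
    · rfl
    · exact LinearMap.congr_fun (map_one (E.ρ _)) _
  rw [h2] at h1
  refine Eq.trans (congrArg E.gen ?_) h1
  refine Eq.trans ?_ (node_conj (D.multi (optDiagram K K')) _ _).symm
  -- Associativity lets the label-permuting diagrams be grafted to `K` and the `K' j` before these
  -- are grafted to `D`.
  refine Eq.trans ?_ (graft_multi D (optDiagram K K') fun o u =>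
    node (E := E.Dec) (permDiag (optPerm θ d' o u).perms) fun _ => optDecoration x x' o u).symm
  refine congrArg (graft D) (funext fun o => ?_)
  rcases o with _ | j
  · exact node_conj K (fun u => (θ u).perms) x
  · refine (graft_leaf (E := E.Dec) (K' j) (x' j)).symm.trans ?_
    refine congrArg (graft (K' j)) (funext fun u => ?_)
    change leaf (x' j u) = node (permDiag (1 : LabelGroup (d' j u).swap).perms) fun _ => x' j u
    rw [LabelGroup.perms_one]
    exact congrArg (fun D => node (E := E.Dec) D fun _ => x' j u) (permDiag_one (d' j u)).symm

theorem exists_linearMap_graft_optInput (q : ∀ j, DecClass E.Dec (c (some j))) :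
    ∃ h : E.Free (c none).swap →ₗ[k] E.Free c₀.swap,
      ∀ a, h (E.gen a) = E.gen (graft D (optInput a q)) := by
  obtain ⟨P, rfl⟩ := exists_eq_nodes q
  exact E.exists_linearMap_gen _
    (fun K => E.isMultilin_gen_graft_optInput D K (fun j => (P j).D) fun j => (P j).x)
    (fun K => E.gen_graft_optInput_conj D K (fun j => (P j).D) fun j => (P j).x)

end Option

variable {ι : Type} [Finite ι] {c : ι → Profile L}

theorem exists_linearMap_graft (D : WiringDiagram c c₀) (i : ι) (q : ∀ i, DecClass E.Dec (c i)) :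
    ∃ h : E.Free (c i).swap →ₗ[k] E.Free c₀.swap,
      ∀ a, E.gen (graft D (open Classical in Function.update q i a)) = h (E.gen a) := by
  classical
  obtain ⟨h, hh⟩ := E.exists_linearMap_graft_optInput (D.reindex (optionNe i)) fun j => q j
  refine ⟨h, fun a => Eq.trans (congrArg E.gen ?_) (hh a).symm⟩
  rw [← graft_reindex D _ (optionNe i)]
  refine congrArg (graft _) (funext fun o => ?_)
  rcases o with _ | j
  · exact Function.update_self _ _ _
  · exact Function.update_of_ne j.2 _ _

/-- Grafting is linear in each input, the other inputs being generators, by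
`exists_linearMap_graft`; this is the hypothesis of the extension criterion. -/
theorem exists_freeAct (D : WiringDiagram c c₀) :
    ∃ F : MultilinearMap k (fun i => E.Free (c i).swap) (E.Free c₀.swap),
      ∀ q : ∀ i, DecClass E.Dec (c i), F (fun i => E.gen (q i)) = E.gen (graft D q) :=
  exists_multilinearMap_of_span (fun _ => E.gen) (fun i => E.span_range_gen (c i))
    (fun q => E.gen (graft D q)) fun i q => E.exists_linearMap_graft D i q

/-- The action of wiring diagrams on decorated graphs. -/
noncomputable def freeAct (D : WiringDiagram c c₀) :
    MultilinearMap k (fun i => E.Free (c i).swap) (E.Free c₀.swap) :=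
  (E.exists_freeAct D).choose

theorem freeAct_gen (D : WiringDiagram c c₀) (q : ∀ i, DecClass E.Dec (c i)) :
    E.freeAct D (fun i => E.gen (q i)) = E.gen (graft D q) :=
  (E.exists_freeAct D).choose_spec q

end SBimodule

/-- An algebra over the operad of wiring diagrams whose underlying bimodule is `W`. -/
structure LinAlgebra {k : Type u} [Field k] {L : Type} (W : SBimodule k L) extends
    SetAlgebra W.Dec where
  isMultilin : ∀ {r : ℕ} {c : Fin r → Profile L} {c₀ : Profile L} (D : WiringDiagram c c₀),
    IsMultilin k (fun x : ∀ i, W.Dec (c i) => act D x)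
  act_permDiag : ∀ (b : Profile L) (g : LabelGroup b) (x : W.carrier b),
    act (permDiag (S := b.swap) g.perms) (fun _ => x) = W.ρ b g x

/-! ### From operad algebras to structure maps -/

namespace LinAlgebra

variable {k : Type u} [Field k] {L : Type} {W : SBimodule k L} (𝒜 : LinAlgebra W)

/-- Evaluation is multilinear in the decorations by assumption. A relabelled diagram is a graft of
label-permuting diagrams, so `eval_graft` and `act_permDiag` turn the relabelling into the action
`ρ` on the decorations. -/
theorem exists_str (b : Profile L) :
    ∃ h : W.Free b →ₗ[k] W.carrier b, ∀ q : DecClass W.Dec b.swap, h (W.gen q) = 𝒜.eval q := by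
  refine W.exists_linearMap_gen (S := b.swap) 𝒜.eval (fun D => ?_) fun D θ x => ?_
  · simp only [SetAlgebra.eval_node]
    exact 𝒜.isMultilin D
  · rw [node_conj, SetAlgebra.eval_graft]
    refine congrArg (fun x => 𝒜.eval (node D x)) (funext fun i => ?_)
    exact (𝒜.eval_node _ _).trans (𝒜.act_permDiag _ (θ i) (x i))

/-- The structure map of the wheeled prop defined by an algebra. -/
noncomputable def str (b : Profile L) : W.Free b →ₗ[k] W.carrier b := (𝒜.exists_str b).choose

theorem str_gen {b : Profile L} (q : DecClass W.Dec b.swap) : 𝒜.str b (W.gen q) = 𝒜.eval q :=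
  (𝒜.exists_str b).choose_spec q

/-- The structure map as a morphism of bimodules. -/
noncomputable def strHom : (SBimodule.freeFunctor k L).obj W ⟶ W where
  hom := 𝒜.str
  equivariant b g x := by
    have h : (𝒜.str b).comp (W.relabelMap g) = (W.ρ b g).comp (𝒜.str b) :=
      W.hom_ext_gen (c₀ := b.swap) fun q => by
        rw [LinearMap.comp_apply, LinearMap.comp_apply]
        refine (congrArg (𝒜.str b) (W.relabelMap_gen g q)).trans ((𝒜.str_gen _).trans ?_)
        refine (𝒜.eval_graft _ _).trans ((𝒜.eval_node _ _).trans ?_)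
        refine (𝒜.act_permDiag b g (𝒜.eval q)).trans ?_
        exact congrArg (W.ρ b g) (𝒜.str_gen q).symm
    exact LinearMap.congr_fun h x

end LinAlgebra

namespace WiringDiagram

variable {L : Type} {E E' : Profile L → Type u} {c₀ : Profile L}

/-- Applying `f` to all decorations. -/
def DecClass.map (f : ∀ S, E S → E' S) (q : DecClass E c₀) : DecClass E' c₀ :=
  Quotient.lift (s := decoratedSetoid E c₀)
    (fun P => Quotient.mk (decoratedSetoid E' c₀) ⟨P.r, P.c, P.D, fun i => f _ (P.x i)⟩) (by
      rintro _ ⟨r, c, D, x⟩ ⟨r', e, rfl⟩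
      exact Quotient.sound ⟨r', e, rfl⟩) q

theorem DecClass.map_node (f : ∀ S, E S → E' S) {ι : Type} [Finite ι] {c : ι → Profile L}
    (D : WiringDiagram c c₀) (x : ∀ i, E (c i)) :
    DecClass.map f (node D x) = node D fun i => f _ (x i) := rfl

theorem DecClass.map_graft (f : ∀ S, E S → E' S) {ι : Type} [Finite ι] {c : ι → Profile L}
    (D : WiringDiagram c c₀) (q : ∀ i, DecClass E (c i)) :
    DecClass.map f (graft D q) = graft D fun i => DecClass.map f (q i) := by
  obtain ⟨P, rfl⟩ := exists_eq_nodes q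
  rw [graft_node, map_node]
  simp only [map_node]
  exact (graft_node D (fun i => (P i).D) fun i u => f _ ((P i).x u)).symm

end WiringDiagram

section Multilinear

variable {k : Type u} [Field k]

theorem IsMultilin.of_forall {ι : Type} {M : ι → Type u} [∀ i, AddCommGroup (M i)]
    [∀ i, Module k (M i)] {N : Type u} [AddCommGroup N] [Module k N] {f : (∀ i, M i) → N}
    (h : ∀ (i : ι) (x : ∀ j, M j), ∃ ℓ : M i →ₗ[k] N,
      ∀ y : ∀ j, M j, (∀ j, j ≠ i → y j = x j) → f y = ℓ (y i)) : IsMultilin k f := by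
  classical
  intro i x
  obtain ⟨ℓ, hℓ⟩ := h i x
  refine ⟨ℓ, fun v => (hℓ _ fun j hj => Function.update_of_ne hj _ _).trans ?_⟩
  rw [Function.update_self]

theorem IsMultilin.insertInput {L ι κ : Type} {c : ι → Profile L} {i : ι} {d : κ → Profile L}
    {A : Profile L → Type u} [∀ S, AddCommGroup (A S)] [∀ S, Module k (A S)]
    {N : Type u} [AddCommGroup N] [Module k N] (F : MultilinearMap k (fun j => A (c j)) N)
    (F' : MultilinearMap k (fun m => A (d m)) (A (c i))) :
    IsMultilin k (M := fun t => A (compColour c i d t)) fun z =>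
      F (insertInput (E := A) i (F' fun m => z (.inr m)) fun j => z (.inl j)) := by
  classical
  refine IsMultilin.of_forall fun t z => ?_
  rcases t with j | m
  · refine ⟨F.toLinearMap (_root_.insertInput (E := A) i (F' fun m => z (.inr m))
      fun j => z (.inl j)) j, fun y hy => ?_⟩
    refine congrArg F (eq_insertInput (E := A) ?_ fun j' => ?_).symm
    · refine (Function.update_of_ne j.2.symm _ _).trans ((insertInput_self (E := A) _ _).trans ?_)
      exact congrArg F' (funext fun m => (hy (.inr m) Sum.inr_ne_inl).symm)
    · by_cases h : j' = j
      · subst h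
        exact Function.update_self _ _ _
      · refine (Function.update_of_ne (fun h' => h (Subtype.ext h')) _ _).trans
          ((insertInput_of_ne (E := A) _ _ j'.2).trans ?_)
        exact (hy (.inl j') fun h' => h (Sum.inl_injective h')).symm
  · refine ⟨(F.toLinearMap (_root_.insertInput (E := A) i 0 fun j => z (.inl j)) i).comp
      (F'.toLinearMap (fun m => z (.inr m)) m), fun y hy => ?_⟩
    refine congrArg F (eq_insertInput (E := A) ?_ fun j' => ?_).symm
    · refine (Function.update_self _ _ _).trans (congrArg F' (funext fun m' => ?_))
      by_cases h : m' = m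
      · subst h
        exact Function.update_self _ _ _
      · exact (Function.update_of_ne h _ _).trans
          (hy (.inr m') fun h' => h (Sum.inr_injective h')).symm
    · refine (Function.update_of_ne j'.2 _ _).trans ((insertInput_of_ne (E := A) _ _ j'.2).trans ?_)
      exact (hy (.inl j') Sum.inl_ne_inr).symm

end Multilinear

namespace SBimodule

variable {k : Type u} [Field k] {L : Type} (E : SBimodule k L) {c₀ : Profile L}

theorem ofGraph_subst {b : Profile L} (G : OGraph b) (H : ∀ v, OGraph (G.c v))
    (x : ∀ v w, E.carrier ((H v).c w)) :
    E.ofGraph (G.subst H) (PiTensorProduct.tprod k fun m =>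
        x (finSigmaFinEquiv.symm m).1 (finSigmaFinEquiv.symm m).2) =
      E.gen (c₀ := b.swap) (graft (E := E.Dec) G.toWiringDiagram fun v =>
        node (H v).toWiringDiagram (x v)) := by
  rw [graft_node]
  refine (E.ofGraph_eq_gen (G.subst H) _).trans (congrArg (E.gen (c₀ := b.swap)) ?_)
  refine Eq.trans ?_ (node_reindex (E := E.Dec)
    (G.toWiringDiagram.multi fun v => (H v).toWiringDiagram) (fun t => x t.1 t.2)
    finSigmaFinEquiv.symm)
  exact congrArg (fun D => node (E := E.Dec) (c₀ := b.swap) D fun m =>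
    x (finSigmaFinEquiv.symm m).1 (finSigmaFinEquiv.symm m).2) (G.toWiringDiagram_subst H)

theorem freeAct_reindex {ι ι' : Type} [Finite ι] [Finite ι'] {c : ι → Profile L}
    (D : WiringDiagram c c₀) (e : ι' ≃ ι) (x : ∀ i, E.Free (c i).swap) :
    E.freeAct (D.reindex e) (fun i => x (e i)) = E.freeAct D x := by
  refine IsMultilin.ext_of_span (k := k) (M := fun i => E.Free (c i).swap)
    (IsMultilin.comp_equiv (k := k) (M := fun i => E.Free (c i).swap) e
      (MultilinearMap.isMultilin k (E.freeAct (D.reindex e))))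
    (MultilinearMap.isMultilin k (E.freeAct D)) (fun i => E.gen)
    (fun i => E.span_range_gen (c i)) (fun q => ?_) x
  exact (E.freeAct_gen (D.reindex e) fun i => q (e i)).trans
    ((congrArg E.gen (graft_reindex D q e)).trans (E.freeAct_gen D q).symm)

/-- Both sides are multilinear in all inputs together, so generators suffice, and on them the claim
is `graft_insertInput`. -/
theorem freeAct_compAt {ι κ : Type} [Finite ι] [Finite κ] {c : ι → Profile L}
    (D : WiringDiagram c c₀) (i : ι) {d : κ → Profile L} (D' : WiringDiagram d (c i))
    (z : ∀ t, E.Free (compColour c i d t).swap) :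
    E.freeAct (D.compAt i D') z =
      E.freeAct D (insertInput (E := fun S => E.Free S.swap) i (E.freeAct D' fun m => z (.inr m))
        fun j => z (.inl j)) := by
  refine IsMultilin.ext_of_span (k := k) (M := fun t => E.Free (compColour c i d t).swap)
    (MultilinearMap.isMultilin k (E.freeAct (D.compAt i D')))
    (IsMultilin.insertInput (k := k) (c := c) (d := d) (A := fun S => E.Free S.swap)
      (N := E.Free c₀.swap) (E.freeAct D) (E.freeAct D')) (fun i => E.gen)
    (fun t => E.span_range_gen (compColour c i d t)) (fun q => ?_) z
  refine (E.freeAct_gen (D.compAt i D') q).trans ?_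
  rw [← graft_insertInput, ← freeAct_gen]
  refine congrArg (E.freeAct D) (eq_insertInput (E := fun S => E.Free S.swap) ?_ fun j => ?_)
  · refine (congrArg E.gen (insertInput_self (E := DecClass E.Dec) _ _)).trans ?_
    exact (E.freeAct_gen D' _).symm
  · exact congrArg E.gen (insertInput_of_ne (E := DecClass E.Dec) _ _ j.2)

theorem freeAct_const_eq (D : WiringDiagram (fun _ : Fin 1 => c₀) c₀)
    (f : E.Free c₀.swap →ₗ[k] E.Free c₀.swap)
    (h : ∀ q : DecClass E.Dec c₀, E.gen (graft D fun _ => q) = f (E.gen q)) (x : E.Free c₀.swap) :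
    E.freeAct D (fun _ => x) = f x := by
  have h' : (MultilinearMap.ofSubsingleton k _ _ (0 : Fin 1)).symm (E.freeAct D) = f :=
    E.hom_ext_gen fun q => (E.freeAct_gen D fun _ => q).trans (h q)
  exact LinearMap.congr_fun h' x

/-- The free algebra. -/
noncomputable def freeLinAlgebra : LinAlgebra E.freeBimodule where
  act D x := E.freeAct D x
  act_ident c₀ x := E.freeAct_const_eq (ident c₀) LinearMap.id
    (fun q => congrArg E.gen (graft_ident q)) x
  act_comp D i _ D' x y :=
    (E.freeAct_reindex (D.compAt i D') (slot i _)
      (compInputs (E := fun S => E.Free S.swap) x y)).trans (E.freeAct_compAt D i D' _)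
  act_perm D σ x := E.freeAct_reindex D σ x
  isMultilin D := MultilinearMap.isMultilin k (E.freeAct D)
  act_permDiag b g x := E.freeAct_const_eq (permDiag (S := b.swap) g.perms) (E.relabelMap g)
    (fun q => (E.relabelMap_gen g q).symm) x

theorem freeLinAlgebra_str_gen {r : ℕ} {c : Fin r → Profile L} (D : WiringDiagram c c₀)
    (q : ∀ i, DecClass E.Dec (c i)) :
    E.freeLinAlgebra.str c₀.swap (E.freeBimodule.gen
      (node (E := E.freeBimodule.Dec) D fun i => E.gen (q i))) = E.gen (graft D q) :=
  (E.freeLinAlgebra.str_gen (b := c₀.swap) _).trans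
    ((E.freeLinAlgebra.eval_node D fun i => E.gen (q i)).trans (E.freeAct_gen D q))

/-- Elements of `FFE` are spanned by diagrams decorated with arbitrary elements of `FE`; by
multilinearity these decorations may be taken to be generators too. -/
theorem freeBimodule_hom_ext {M : Type u} [AddCommGroup M] [Module k M]
    {f g : E.freeBimodule.Free c₀.swap →ₗ[k] M}
    (h : ∀ {r : ℕ} {c : Fin r → Profile L} (D : WiringDiagram c c₀) (q : ∀ i, DecClass E.Dec (c i)),
      f (E.freeBimodule.gen (node (E := E.freeBimodule.Dec) D fun i => E.gen (q i))) =
        g (E.freeBimodule.gen (node (E := E.freeBimodule.Dec) D fun i => E.gen (q i)))) : f = g := by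
  refine E.freeBimodule.hom_ext_gen fun q => ?_
  obtain ⟨r, c, D, x, rfl⟩ := exists_eq_node q
  exact IsMultilin.ext_of_span (k := k) (M := fun i => E.freeBimodule.Dec (c i))
    ((E.freeBimodule.isMultilin_gen_node D).linear_comp f)
    ((E.freeBimodule.isMultilin_gen_node D).linear_comp g) (fun i => E.gen)
    (fun i => E.span_range_gen (c i)) (fun q => h D q) x

theorem freeMap_gen {E E' : SBimodule k L} (f : E ⟶ E') (q : DecClass E.Dec c₀) :
    freeMap f c₀.swap (E.gen q) =
      E'.gen (DecClass.map (E := E.Dec) (E' := E'.Dec) (fun S x => f.hom S.swap x) q) := by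
  obtain ⟨r, c, D, x, rfl⟩ := exists_eq_node q
  rw [DecClass.map_node, gen_node, gen_node]
  exact freeMap_ofGraph f D.toGraph x

/-- The unit of the monad. -/
noncomputable def leafMap (b : Profile L) : E.carrier b →ₗ[k] E.Free b :=
  (MultilinearMap.ofSubsingleton k (E.carrier b) (E.Free b) (0 : Fin 1)).symm
    (E.isMultilin_gen_node (ident b.swap)).toMultilinearMap

/-- The unit of the monad as a morphism of bimodules. -/
noncomputable def leafHom : E ⟶ E.freeBimodule where
  hom := E.leafMap
  equivariant b g x := by
    refine (E.gen_node_permDiag g x).symm.trans ?_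
    refine Eq.trans ?_ (E.relabelMap_gen g (leaf (E := E.Dec) (c₀ := b.swap) x)).symm
    exact congrArg E.gen (graft_leaf (E := E.Dec) (permDiag (S := b.swap) g.perms) fun _ => x).symm

end SBimodule

namespace LinAlgebra

variable {k : Type u} [Field k] {L : Type} {W : SBimodule k L} (𝒜 : LinAlgebra W)

theorem str_leaf {b : Profile L} (x : W.carrier b) :
    𝒜.str b (W.gen (c₀ := b.swap) (leaf (E := W.Dec) x)) = x :=
  (𝒜.str_gen _).trans (SetAlgebra.eval_leaf (c₀ := b.swap) 𝒜.toSetAlgebra x)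

/-- On two-level generators: evaluating the inner diagrams and then the outer one equals evaluating
the flattened diagram, by `eval_graft`. For the free algebra this is associativity of the
multiplication, in general the associativity axiom of a wheeled prop. -/
theorem str_str {b : Profile L} (x : W.freeBimodule.Free b) :
    𝒜.str b (SBimodule.freeMap 𝒜.strHom b x) = 𝒜.str b (W.freeLinAlgebra.str b x) := by
  have h : (𝒜.str b).comp (SBimodule.freeMap 𝒜.strHom b) =
      (𝒜.str b).comp (W.freeLinAlgebra.str b) :=
    W.freeBimodule_hom_ext (c₀ := b.swap) fun D q => by
      refine (congrArg (𝒜.str b) (SBimodule.freeMap_gen (c₀ := b.swap) 𝒜.strHom _)).trans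
        ((𝒜.str_gen _).trans ?_)
      refine Eq.trans ?_ (congrArg (𝒜.str b) (W.freeLinAlgebra_str_gen D q)).symm
      refine Eq.trans ?_ ((𝒜.str_gen _).trans (𝒜.eval_graft D q)).symm
      exact congrArg (fun x => 𝒜.eval (node D x)) (funext fun i => 𝒜.str_gen (b := Prod.swap _) (q i))
  exact LinearMap.congr_fun h x

end LinAlgebra

/-! ### Multiplication and laws of the graph substitution monad -/

namespace SBimodule

variable {k : Type u} [Field k] {L : Type} (E : SBimodule k L)

/-- The multiplication of the monad. -/
noncomputable def flatten (b : Profile L) : E.freeBimodule.Free b →ₗ[k] E.Free b :=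
  E.freeLinAlgebra.str b

theorem flatten_gen {c₀ : Profile L} {r : ℕ} {c : Fin r → Profile L} (D : WiringDiagram c c₀)
    (q : ∀ i, DecClass E.Dec (c i)) :
    E.flatten c₀.swap (E.freeBimodule.gen
      (node (E := E.freeBimodule.Dec) D fun i => E.gen (q i))) = E.gen (graft D q) :=
  E.freeLinAlgebra_str_gen D q

theorem freeMap_gen_node {E E' : SBimodule k L} (f : E ⟶ E') {c₀ : Profile L} {r : ℕ}
    {c : Fin r → Profile L} (D : WiringDiagram c c₀) (x : ∀ i, E.Dec (c i)) :
    freeMap f c₀.swap (E.gen (node D x)) =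
      E'.gen (node (E := E'.Dec) D fun i => f.hom (c i).swap (x i)) :=
  freeMap_gen f (node D x)

theorem freeMap_flatten {E E' : SBimodule k L} (f : E ⟶ E') {c₀ : Profile L}
    (x : E.freeBimodule.Free c₀.swap) :
    E'.flatten c₀.swap (freeMap ((freeFunctor k L).map f) c₀.swap x) =
      freeMap f c₀.swap (E.flatten c₀.swap x) := by
  have h : (E'.flatten c₀.swap).comp (freeMap ((freeFunctor k L).map f) c₀.swap) =
      (freeMap f c₀.swap).comp (E.flatten c₀.swap) :=
    E.freeBimodule_hom_ext (c₀ := c₀) fun {r c} D q => by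
      have h1 := freeMap_gen_node ((freeFunctor k L).map f) D fun i => E.gen (q i)
      have h2 : (fun i => ((freeFunctor k L).map f).hom (c i).swap (E.gen (q i))) =
          fun i => E'.gen (DecClass.map (E := E.Dec) (E' := E'.Dec) (fun S x => f.hom S.swap x)
            (q i)) := funext fun i => freeMap_gen f (q i)
      have h3 := E'.flatten_gen D fun i =>
        DecClass.map (E := E.Dec) (E' := E'.Dec) (fun S x => f.hom S.swap x) (q i)
      rw [← DecClass.map_graft, ← freeMap_gen, ← flatten_gen, ← h2] at h3
      exact (congrArg (E'.flatten c₀.swap) h1).trans h3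
  exact LinearMap.congr_fun h x

theorem flatten_freeMap_leafHom {c₀ : Profile L} (x : E.Free c₀.swap) :
    E.flatten c₀.swap (freeMap E.leafHom c₀.swap x) = x := by
  have h : (E.flatten c₀.swap).comp (freeMap E.leafHom c₀.swap) = LinearMap.id :=
    E.hom_ext_gen (c₀ := c₀) fun q => by
      obtain ⟨r, c, D, x, rfl⟩ := exists_eq_node q
      have h1 := freeMap_gen_node E.leafHom D x
      have h3 := E.flatten_gen D fun i => leaf (x i)
      rw [graft_leaf] at h3
      exact (congrArg (E.flatten c₀.swap) h1).trans h3
  exact LinearMap.congr_fun h x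

theorem flatten_ofGraph {b : Profile L} (G : OGraph b) (H : ∀ v, OGraph (G.c v))
    (x : ∀ v w, E.carrier ((H v).c w)) :
    E.flatten b (E.freeBimodule.ofGraph G
        (PiTensorProduct.tprod k fun v => E.ofGraph (H v) (PiTensorProduct.tprod k (x v)))) =
      E.ofGraph (G.subst H) (PiTensorProduct.tprod k fun m =>
        x (finSigmaFinEquiv.symm m).1 (finSigmaFinEquiv.symm m).2) := by
  have h : (fun v => E.ofGraph (H v) (PiTensorProduct.tprod k (x v))) = fun v =>
      E.gen (c₀ := (G.c v).swap) (node (E := E.Dec) (H v).toWiringDiagram (x v)) :=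
    funext fun v => E.ofGraph_eq_gen (H v) (x v)
  rw [h]
  refine (congrArg (E.flatten b) (E.freeBimodule.ofGraph_eq_gen G _)).trans ?_
  exact (E.flatten_gen (c₀ := b.swap) G.toWiringDiagram _).trans (E.ofGraph_subst G H x).symm

end SBimodule

namespace GraphSubstitutionMonad

variable {k : Type u} [Field k] {L : Type}

/-- The graph substitution monad, constructed from free algebras. -/
noncomputable def ofFree (k : Type u) [Field k] (L : Type) : GraphSubstitutionMonad k L where
  η :=
    { app := fun E => E.leafHom
      naturality := fun E _ f => SBimodule.Hom.ext (funext fun b => LinearMap.ext fun x =>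
        (SBimodule.freeMap_gen (c₀ := b.swap) f (leaf (E := E.Dec) x)).symm) }
  μ :=
    { app := fun E => E.freeLinAlgebra.strHom
      naturality := fun _ _ f => SBimodule.Hom.ext (funext fun b => LinearMap.ext fun x =>
        SBimodule.freeMap_flatten (c₀ := b.swap) f x) }
  η_apply E _ x := (E.gen_leaf x).symm
  μ_apply E _ G H x := E.flatten_ofGraph G H x
  assoc E := SBimodule.Hom.ext (funext fun _ => LinearMap.ext fun x =>
    E.freeLinAlgebra.str_str x)
  left_unit E := SBimodule.Hom.ext (funext fun _ => LinearMap.ext fun x =>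
    E.freeLinAlgebra.str_leaf x)
  right_unit E := SBimodule.Hom.ext (funext fun b => LinearMap.ext fun x =>
    E.flatten_freeMap_leafHom (c₀ := b.swap) x)

variable (T : GraphSubstitutionMonad k L) (E : SBimodule k L)

theorem η_leaf {b : Profile L} (x : E.carrier b) :
    (T.η.app E).hom b x = E.gen (c₀ := b.swap) (leaf (E := E.Dec) x) :=
  (T.η_apply E b x).trans (E.gen_leaf x)

/-- Uses only the prescribed values of the multiplication, so it holds for every monad of this kind
and yields uniqueness. -/
theorem μ_gen {r : ℕ} {c : Fin r → Profile L} {c₀ : Profile L} (D : WiringDiagram c c₀)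
    (q : ∀ i, DecClass E.Dec (c i)) :
    (T.μ.app E).hom c₀.swap (E.freeBimodule.gen
      (node (E := E.freeBimodule.Dec) D fun i => E.gen (q i))) = E.gen (graft D q) := by
  obtain ⟨P, rfl⟩ := exists_eq_nodes q
  have h : (fun i => E.gen (node (P i).D (P i).x)) = fun i =>
      E.ofGraph (P i).D.toGraph (PiTensorProduct.tprod k (P i).x) :=
    funext fun i => E.gen_node (P i).D (P i).x
  rw [h]
  refine (congrArg ((T.μ.app E).hom c₀.swap) (E.freeBimodule.gen_node D _)).trans ?_
  refine (T.μ_apply E c₀.swap D.toGraph (fun i => (P i).D.toGraph) fun i => (P i).x).trans ?_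
  refine (E.ofGraph_subst D.toGraph (fun i => (P i).D.toGraph) fun i => (P i).x).trans ?_
  refine congrArg E.gen ?_
  refine (congrArg (fun D => graft D _) (toWiringDiagram_toGraph D)).trans ?_
  refine congrArg (graft D) (funext fun i => ?_)
  exact congrArg (fun D => node D (P i).x) (toWiringDiagram_toGraph (P i).D)

theorem eq_ofFree : T = ofFree k L := by
  have hη : T.η = (ofFree k L).η := NatTrans.ext (funext fun E => SBimodule.Hom.ext (funext fun b =>
    LinearMap.ext fun x => T.η_leaf E x))
  have hμ : T.μ = (ofFree k L).μ := NatTrans.ext (funext fun E => SBimodule.Hom.ext (funext fun b =>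
    E.freeBimodule_hom_ext (c₀ := b.swap) fun D q =>
      (T.μ_gen E D q).trans ((ofFree k L).μ_gen E D q).symm))
  -- All fields besides `η` and `μ` are propositions, so the two equalities identify the structures.
  generalize ofFree k L = T' at hη hμ
  cases T
  cases T'
  cases hη
  cases hμ
  rfl

end GraphSubstitutionMonad

/-! ### From circuit algebras to wheeled props -/

namespace SetAlgebra

variable {L : Type} {A : Profile L → Type u} (𝒜 : SetAlgebra A)

theorem act_permDiag_one {S : Profile L} (x : A S) : 𝒜.act (permDiag (S := S) 1) (fun _ => x) = x := by
  rw [permDiag_one]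
  exact 𝒜.act_ident S x

/-- An instance of `eval_graft`, as grafting label-permuting diagrams multiplies the permutations.
It makes the spaces of a circuit algebra representations of the label groups. -/
theorem act_permDiag_mul {S : Profile L} (θ θ' : Equiv.Perm S.1 × Equiv.Perm S.2) (x : A S) :
    𝒜.act (permDiag (θ * θ')) (fun _ => x) =
      𝒜.act (permDiag θ) fun _ => 𝒜.act (permDiag θ') fun _ => x := by
  have h := 𝒜.eval_graft (permDiag θ) fun _ => node (permDiag θ') fun _ => x
  rw [graft_permDiag_permDiag] at h
  simpa only [eval_node] using h

end SetAlgebra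

namespace CircuitAlgebra

variable {k : Type u} [Field k] {L : Type} (V : CircuitAlgebra k L)

/-- The action on pure tensors. -/
def toSetAlgebra : SetAlgebra V.carrier where
  act D x := V.act D (PiTensorProduct.tprod k x)
  act_ident := V.act_ident
  act_comp := V.act_comp
  act_perm := V.act_perm

/-- The underlying bimodule of a circuit algebra. -/
noncomputable def toSBimodule : SBimodule k L where
  carrier b := V.carrier b.swap
  ρ b :=
    { toFun := fun g => (MultilinearMap.ofSubsingleton k _ _ (0 : Fin 1)).symm
        ((V.act (permDiag (S := b.swap) g.perms)).compMultilinearMap (PiTensorProduct.tprod k))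
      map_one' := LinearMap.ext fun x => by
        refine Eq.trans ?_ (V.toSetAlgebra.act_permDiag_one (S := b.swap) x)
        exact congrArg (fun θ => V.act (permDiag (S := b.swap) θ)
          (PiTensorProduct.tprod k fun _ => x)) LabelGroup.perms_one
      map_mul' := fun g h => LinearMap.ext fun x => by
        refine Eq.trans ?_ (V.toSetAlgebra.act_permDiag_mul (S := b.swap) g.perms h.perms x)
        exact congrArg (fun θ => V.act (permDiag (S := b.swap) θ)
          (PiTensorProduct.tprod k fun _ => x)) (LabelGroup.perms_mul g h) }

/-- The action on pure tensors is an algebra structure on the underlying bimodule. -/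
noncomputable def toLinAlgebra : LinAlgebra V.toSBimodule where
  toSetAlgebra := V.toSetAlgebra
  isMultilin D := MultilinearMap.isMultilin k ((V.act D).compMultilinearMap (PiTensorProduct.tprod k))
  act_permDiag _ _ _ := rfl

/-- The underlying morphism of bimodules. -/
noncomputable def mapSBimodule {V W : CircuitAlgebra k L} (f : V ⟶ W) :
    V.toSBimodule ⟶ W.toSBimodule where
  hom b := f.hom b.swap
  equivariant b g x := f.comm (permDiag (S := b.swap) g.perms) fun _ => x

end CircuitAlgebra

namespace LinAlgebra

variable {k : Type u} [Field k] {L : Type} {W W' : SBimodule k L}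

/-- A morphism of bimodules that commutes with the action of wiring diagrams commutes with the
structure maps. -/
theorem freeMap_comp_strHom (𝒜 : LinAlgebra W) (𝒜' : LinAlgebra W') (f : W ⟶ W')
    (h : ∀ {r : ℕ} {c : Fin r → Profile L} {c₀ : Profile L} (D : WiringDiagram c c₀)
      (x : ∀ i, W.Dec (c i)), f.hom c₀.swap (𝒜.act D x) = 𝒜'.act D fun i => f.hom (c i).swap (x i)) :
    (SBimodule.freeFunctor k L).map f ≫ 𝒜'.strHom = 𝒜.strHom ≫ f :=
  SBimodule.Hom.ext (funext fun b => W.hom_ext_gen (c₀ := b.swap) fun q => by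
    obtain ⟨r, c, D, x, rfl⟩ := exists_eq_node q
    refine (congrArg (𝒜'.str b) (SBimodule.freeMap_gen_node (c₀ := b.swap) f D x)).trans ?_
    refine (𝒜'.str_gen _).trans ((𝒜'.eval_node D _).trans ((h D x).symm.trans ?_))
    exact congrArg (f.hom b) ((𝒜.str_gen _).trans (𝒜.eval_node D x)).symm)

/-- The action on tensor products. -/
noncomputable def tensorAct (𝒜 : LinAlgebra W) {r : ℕ} {c : Fin r → Profile L} {c₀ : Profile L}
    (D : WiringDiagram c c₀) : (⨂[k] i, W.Dec (c i)) →ₗ[k] W.Dec c₀ :=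
  PiTensorProduct.lift (𝒜.isMultilin D).toMultilinearMap

theorem tensorAct_tprod (𝒜 : LinAlgebra W) {r : ℕ} {c : Fin r → Profile L} {c₀ : Profile L}
    (D : WiringDiagram c c₀) (x : ∀ i, W.Dec (c i)) :
    𝒜.tensorAct D (PiTensorProduct.tprod k x) = 𝒜.act D x :=
  PiTensorProduct.lift.tprod _

/-- The circuit algebra. -/
noncomputable def toCircuitAlgebra (𝒜 : LinAlgebra W) : CircuitAlgebra k L where
  carrier := W.Dec
  act D := 𝒜.tensorAct D
  act_ident c₀ x := (𝒜.tensorAct_tprod _ _).trans (𝒜.act_ident c₀ x)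
  act_comp {r s c c₀} D i {d} D' x y := by
    refine (𝒜.tensorAct_tprod _ _).trans ((𝒜.act_comp D i D' x y).trans ?_)
    refine Eq.trans ?_ (𝒜.tensorAct_tprod _ _).symm
    exact congrArg (fun a => 𝒜.act D (insertInput (E := W.Dec) i a x))
      (𝒜.tensorAct_tprod D' y).symm
  act_perm D σ x := (𝒜.tensorAct_tprod _ _).trans
    ((𝒜.act_perm D σ x).trans (𝒜.tensorAct_tprod _ _).symm)

theorem toCircuitAlgebra_act (𝒜 : LinAlgebra W) {r : ℕ} {c : Fin r → Profile L} {c₀ : Profile L}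
    (D : WiringDiagram c c₀) (x : ∀ i, W.Dec (c i)) :
    𝒜.toCircuitAlgebra.act D (PiTensorProduct.tprod k x) = 𝒜.act D x :=
  𝒜.tensorAct_tprod D x

variable (T : GraphSubstitutionMonad k L)

/-- The wheeled prop. -/
noncomputable def toAlgebra (𝒜 : LinAlgebra W) : T.monad.Algebra where
  A := W
  a := 𝒜.strHom
  unit := SBimodule.Hom.ext (funext fun b => LinearMap.ext fun x => by
    exact (congrArg (𝒜.str b) (T.η_leaf W x)).trans (𝒜.str_leaf x))
  assoc := SBimodule.Hom.ext (funext fun b => LinearMap.ext fun x => by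
    refine Eq.trans ?_ (𝒜.str_str x).symm
    refine congrArg (𝒜.str b) ?_
    exact LinearMap.congr_fun (W.freeBimodule_hom_ext (c₀ := b.swap)
      (f := (T.μ.app W).hom b) (g := W.flatten b) fun D q =>
        (T.μ_gen W D q).trans (W.flatten_gen D q).symm) x)

end LinAlgebra

/-! ### From wheeled props to circuit algebras -/

namespace GraphSubstitutionMonad

variable {k : Type u} [Field k] {L : Type} {T : GraphSubstitutionMonad k L} (P : T.monad.Algebra)

/-- The structure map on decorated wiring diagrams. -/
noncomputable def algebraEval {c₀ : Profile L} (q : DecClass P.A.Dec c₀) : P.A.Dec c₀ :=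
  P.a.hom c₀.swap (P.A.gen q)

theorem algebraEval_leaf {c₀ : Profile L} (x : P.A.Dec c₀) : algebraEval P (leaf x) = x := by
  have h := congrArg (fun f => SBimodule.Hom.hom f c₀.swap x) P.unit
  exact (congrArg (P.a.hom c₀.swap) (T.η_leaf P.A (b := c₀.swap) x)).symm.trans h

/-- The associativity axiom of the monad algebra, evaluated on `D` decorated by the generators `gen
(q i)`: multiplication flattens by `μ_gen`, while the functor evaluates each decoration. -/
theorem algebraEval_graft_fin {c₀ : Profile L} {r : ℕ} {c : Fin r → Profile L}
    (D : WiringDiagram c c₀) (q : ∀ i, DecClass P.A.Dec (c i)) :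
    algebraEval P (graft D q) = algebraEval P (node D fun i => algebraEval P (q i)) := by
  have h := congrArg (fun f => SBimodule.Hom.hom f c₀.swap (P.A.freeBimodule.gen
      (node (E := P.A.freeBimodule.Dec) D fun i => P.A.gen (q i)))) P.assoc
  have h1 := congrArg (P.a.hom c₀.swap) (T.μ_gen P.A D q)
  have h2 := congrArg (P.a.hom c₀.swap) (SBimodule.freeMap_gen_node P.a D fun i => P.A.gen (q i))
  exact h1.symm.trans (h.trans h2)

theorem algebraEval_graft {c₀ : Profile L} {ι : Type} [Finite ι] {c : ι → Profile L}
    (D : WiringDiagram c c₀) (q : ∀ i, DecClass P.A.Dec (c i)) :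
    algebraEval P (graft D q) = algebraEval P (node D fun i => algebraEval P (q i)) := by
  rw [← graft_reindex D q (Finite.equivFin ι).symm, algebraEval_graft_fin]
  exact congrArg (algebraEval P)
    (node_reindex D (fun i => algebraEval P (q i)) (Finite.equivFin ι).symm)

/-- The action of wiring diagrams on a wheeled prop. -/
noncomputable def algebraLinAlgebra : LinAlgebra P.A where
  act D x := algebraEval P (node D x)
  act_ident _ x := algebraEval_leaf P x
  act_comp {r s c c₀} D i {d} D' x y := by
    have h : algebraEval P (node (D.comp i D') fun m => compInputs x y (slot i s m)) =
        algebraEval P (node (D.compAt i D') (compInputs x y)) :=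
      congrArg (algebraEval P) (node_reindex (D.compAt i D') (compInputs x y) (slot i s))
    refine h.trans ?_
    rw [← graft_leaf, ← graft_insertInput, algebraEval_graft]
    refine congrArg (fun x => algebraEval P (node D x))
      (eq_insertInput (E := P.A.Dec) ?_ fun j => ?_)
    · refine (congrArg (algebraEval P) (insertInput_self (E := DecClass P.A.Dec) _ _)).trans ?_
      exact congrArg (algebraEval P) (graft_leaf D' y)
    · refine (congrArg (algebraEval P)
        (insertInput_of_ne (E := DecClass P.A.Dec) _ _ j.2)).trans ?_
      exact algebraEval_leaf P (x j)
  act_perm D σ x := congrArg (algebraEval P) (node_reindex D x σ)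
  isMultilin {r c c₀} D := (P.A.isMultilin_gen_node D).linear_comp (P.a.hom c₀.swap)
  act_permDiag b g x := by
    refine (congrArg (P.a.hom b) (P.A.gen_node_permDiag g x)).trans ?_
    exact algebraEval_leaf P (c₀ := b.swap) (P.A.ρ b g x)

theorem algebraLinAlgebra_act {r : ℕ} {c : Fin r → Profile L} {c₀ : Profile L}
    (D : WiringDiagram c c₀) (x : ∀ i, P.A.Dec (c i)) :
    (algebraLinAlgebra P).act D x =
      P.a.hom c₀.swap (P.A.ofGraph D.toGraph (PiTensorProduct.tprod k x)) :=
  congrArg (P.a.hom c₀.swap) (P.A.gen_node D x)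

theorem algebraLinAlgebra_strHom : (algebraLinAlgebra P).strHom = P.a :=
  SBimodule.Hom.ext (funext fun b => P.A.hom_ext_gen (c₀ := b.swap) fun q => by
    obtain ⟨r, c, D, x, rfl⟩ := exists_eq_node q
    exact ((algebraLinAlgebra P).str_gen _).trans ((algebraLinAlgebra P).eval_node D x))

theorem algebraHom_act {P Q : T.monad.Algebra} (f : P ⟶ Q) {r : ℕ} {c : Fin r → Profile L}
    {c₀ : Profile L} (D : WiringDiagram c c₀) (x : ∀ i, P.A.Dec (c i)) :
    f.f.hom c₀.swap ((algebraLinAlgebra P).act D x) =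
      (algebraLinAlgebra Q).act D fun i => f.f.hom (c i).swap (x i) := by
  have h := congrArg (fun g => SBimodule.Hom.hom g c₀.swap (P.A.gen (node D x))) f.h
  have h1 := congrArg (Q.a.hom c₀.swap) (SBimodule.freeMap_gen_node f.f D x)
  exact h.symm.trans h1

variable (T)

/-- The wheeled prop of a circuit algebra. -/
noncomputable def ofCircuitAlgebra : CircuitAlgebra k L ⥤ T.monad.Algebra where
  obj V := V.toLinAlgebra.toAlgebra T
  map {V W} f :=
    { f := CircuitAlgebra.mapSBimodule f
      h := V.toLinAlgebra.freeMap_comp_strHom W.toLinAlgebra (CircuitAlgebra.mapSBimodule f) f.comm }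

/-- The circuit algebra of a wheeled prop. -/
noncomputable def toCircuitAlgebra : T.monad.Algebra ⥤ CircuitAlgebra k L where
  obj P := (algebraLinAlgebra P).toCircuitAlgebra
  map {P Q} f :=
    { hom := fun S => f.f.hom S.swap
      comm := fun D x =>
        (congrArg (f.f.hom _) ((algebraLinAlgebra P).toCircuitAlgebra_act D x)).trans
          ((algebraHom_act f D x).trans ((algebraLinAlgebra Q).toCircuitAlgebra_act D _).symm) }

end GraphSubstitutionMonad

namespace CircuitAlgebra

variable {k : Type u} [Field k] {L : Type}

/-- An isomorphism of circuit algebras from linear isomorphisms commuting with the action. -/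
def isoMk {V W : CircuitAlgebra k L} (φ : ∀ S, V.carrier S ≃ₗ[k] W.carrier S)
    (h : ∀ {r : ℕ} {c : Fin r → Profile L} {c₀ : Profile L} (D : WiringDiagram c c₀)
      (x : ∀ i, V.carrier (c i)), φ c₀ (V.act D (PiTensorProduct.tprod k x)) =
        W.act D (PiTensorProduct.tprod k fun i => φ (c i) (x i))) : V ≅ W where
  hom := { hom := fun S => φ S, comm := h }
  inv :=
    { hom := fun S => (φ S).symm
      comm := fun D x => (φ _).symm_apply_eq.2 ((h D _).trans (by simp)).symm }
  hom_inv_id := Hom.ext (funext fun S => LinearMap.ext (φ S).symm_apply_apply)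
  inv_hom_id := Hom.ext (funext fun S => LinearMap.ext (φ S).apply_symm_apply)

end CircuitAlgebra

namespace SBimodule

variable {k : Type u} [Field k] {L : Type}

/-- An isomorphism of bimodules from equivariant linear isomorphisms. -/
def isoMk {E E' : SBimodule k L} (φ : ∀ b, E.carrier b ≃ₗ[k] E'.carrier b)
    (h : ∀ b g x, φ b (E.ρ b g x) = E'.ρ b g (φ b x)) : E ≅ E' where
  hom := { hom := fun b => φ b, equivariant := h }
  inv :=
    { hom := fun b => (φ b).symm
      equivariant := fun b g x => (φ b).symm_apply_eq.2 ((h b g _).trans (by simp)).symm }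
  hom_inv_id := Hom.ext (funext fun b => LinearMap.ext (φ b).symm_apply_apply)
  inv_hom_id := Hom.ext (funext fun b => LinearMap.ext (φ b).apply_symm_apply)

end SBimodule

/-! ### The equivalence of categories -/

namespace GraphSubstitutionMonad

variable {k : Type u} [Field k] {L : Type} (T : GraphSubstitutionMonad k L)

theorem ofCircuitAlgebra_a (V : CircuitAlgebra k L) (b : Profile L) (G : OGraph b)
    (x : ∀ v, V.toSBimodule.carrier (G.c v)) :
    ((T.ofCircuitAlgebra.obj V).a.hom b (V.toSBimodule.ofGraph G (PiTensorProduct.tprod k x)) :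
      V.carrier b.swap) = V.act G.toWiringDiagram (PiTensorProduct.tprod k x) := by
  refine (congrArg (V.toLinAlgebra.str b) (V.toSBimodule.ofGraph_eq_gen G x)).trans ?_
  exact (V.toLinAlgebra.str_gen _).trans
    (V.toLinAlgebra.eval_node (c₀ := b.swap) G.toWiringDiagram x)

theorem toCircuitAlgebra_act (P : T.monad.Algebra) {r : ℕ} {c : Fin r → Profile L}
    {c₀ : Profile L} (D : WiringDiagram c c₀) (x : ∀ i, P.A.Dec (c i)) :
    ((T.toCircuitAlgebra.obj P).act D (PiTensorProduct.tprod k x) : P.A.Dec c₀) =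
      P.a.hom c₀.swap (P.A.ofGraph D.toGraph (PiTensorProduct.tprod k x)) :=
  ((algebraLinAlgebra P).tensorAct_tprod D x).trans (algebraLinAlgebra_act P D x)

theorem algebraLinAlgebra_ofCircuitAlgebra_act (V : CircuitAlgebra k L) {r : ℕ}
    {c : Fin r → Profile L} {c₀ : Profile L} (D : WiringDiagram c c₀) (x : ∀ i, V.carrier (c i)) :
    (algebraLinAlgebra (T.ofCircuitAlgebra.obj V)).act D x =
      V.act D (PiTensorProduct.tprod k x) :=
  (V.toLinAlgebra.str_gen (b := c₀.swap) (node (E := V.toSBimodule.Dec) D x)).trans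
    (V.toLinAlgebra.eval_node D x)

/-- A circuit algebra is recovered from its wheeled prop. -/
noncomputable def unitIso : 𝟭 (CircuitAlgebra k L) ≅ T.ofCircuitAlgebra ⋙ T.toCircuitAlgebra :=
  NatIso.ofComponents
    (fun V => CircuitAlgebra.isoMk (W := (T.ofCircuitAlgebra ⋙ T.toCircuitAlgebra).obj V)
      (fun S => LinearEquiv.refl k (V.carrier S)) fun D x =>
        (((algebraLinAlgebra (T.ofCircuitAlgebra.obj V)).tensorAct_tprod D x).trans
          (T.algebraLinAlgebra_ofCircuitAlgebra_act V D x)).symm)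
    fun _ => rfl

/-- The bimodule of a wheeled prop is recovered from its circuit algebra. -/
noncomputable def counitBimoduleIso (P : T.monad.Algebra) :
    ((T.toCircuitAlgebra ⋙ T.ofCircuitAlgebra).obj P).A ≅ P.A :=
  SBimodule.isoMk (fun b => LinearEquiv.refl k (P.A.carrier b)) fun b g x =>
    ((algebraLinAlgebra P).tensorAct_tprod (permDiag (S := b.swap) g.perms) fun _ => x).trans
      ((algebraLinAlgebra P).act_permDiag b g x)

/-- A wheeled prop is recovered from its circuit algebra. -/
noncomputable def counitIso : T.toCircuitAlgebra ⋙ T.ofCircuitAlgebra ≅ 𝟭 T.monad.Algebra :=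
  NatIso.ofComponents
    (fun P => Monad.Algebra.isoMk (T.counitBimoduleIso P) (by
      -- The identity maps intertwine the two actions of diagrams, hence the two structure maps; and
      -- the structure map evaluated from the action on `P` is that of `P` itself.
      refine (LinAlgebra.freeMap_comp_strHom (T.toCircuitAlgebra.obj P).toLinAlgebra
        (algebraLinAlgebra P) (T.counitBimoduleIso P).hom fun D x => ?_).symm.trans ?_ |>.symm
      · exact (algebraLinAlgebra P).tensorAct_tprod D x
      · rw [algebraLinAlgebra_strHom]
        rfl))
    fun _ => rfl

/-- Circuit algebras are wheeled props. -/
noncomputable def equivalence : CircuitAlgebra k L ≌ T.monad.Algebra where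
  functor := T.ofCircuitAlgebra
  inverse := T.toCircuitAlgebra
  unitIso := T.unitIso
  counitIso := T.counitIso
  functor_unitIso_comp _ := rfl

end GraphSubstitutionMonad

theorem theorem4p1 (k : Type u) [Field k] (L : Type) [Countable L] :
    (∃ Φ : ∀ b : Profile L, Quot (OGraph.StrictIso (b := b)) ≃
        Σ (r : ℕ) (c : Fin r → Profile L), WiringDiagram c b.swap,
      (∀ b (G : OGraph b), Φ b (Quot.mk _ G) = ⟨G.r, _, G.toWiringDiagram⟩) ∧
      (∀ (b : Profile L) (r : ℕ) (c : Fin r → Profile L) (D : WiringDiagram c b.swap),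
        (Φ b).symm ⟨r, c, D⟩ = Quot.mk _ D.toGraph)) ∧
    (∀ {r s : ℕ} {c : Fin r → Profile L} {c₀ : Profile L} (D : WiringDiagram c c₀) (i : Fin r)
      {d : Fin s → Profile L} (D' : WiringDiagram d (c i)),
      OGraph.StrictIso (D.comp i D').toGraph (D.toGraph.substAt i D'.toGraph)) ∧
    ∃ T : GraphSubstitutionMonad k L, (∀ T', T' = T) ∧
      ∃ e : CircuitAlgebra k L ≌ T.monad.Algebra,
        (∃ f : ∀ (V : CircuitAlgebra k L) (b : Profile L),
            (e.functor.obj V).A.carrier b ≃ₗ[k] V.carrier b.swap,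
          (∀ {V W : CircuitAlgebra k L} (h : V ⟶ W) (b : Profile L) x,
            f W b ((e.functor.map h).f.hom b x) = h.hom b.swap (f V b x)) ∧
          ∀ (V : CircuitAlgebra k L) (b : Profile L) (G : OGraph b)
            (x : ∀ v, (e.functor.obj V).A.carrier (G.c v)),
            f V b ((e.functor.obj V).a.hom b
                ((e.functor.obj V).A.ofGraph G (PiTensorProduct.tprod k x))) =
              V.act G.toWiringDiagram (PiTensorProduct.tprod k fun v => f V (G.c v) (x v))) ∧
        ∃ g : ∀ (P : T.monad.Algebra) (S : Profile L),
            (e.inverse.obj P).carrier S ≃ₗ[k] P.A.carrier S.swap,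
          (∀ {P Q : T.monad.Algebra} (h : P ⟶ Q) (S : Profile L) x,
            g Q S ((e.inverse.map h).hom S x) = h.f.hom S.swap (g P S x)) ∧
          ∀ (P : T.monad.Algebra) {r : ℕ} {c : Fin r → Profile L} {c₀ : Profile L}
            (D : WiringDiagram c c₀) (x : ∀ i, (e.inverse.obj P).carrier (c i)),
            g P c₀ ((e.inverse.obj P).act D (PiTensorProduct.tprod k x)) =
              P.a.hom c₀.swap
                (P.A.ofGraph D.toGraph (PiTensorProduct.tprod k fun i => g P (c i) (x i))) := by
  -- Swapping a profile twice is definitionally the identity, so both functors keep the underlying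
  -- spaces and the comparison isomorphisms `f` and `g` are identities.
  refine ⟨OGraph.exists_equiv_wiringDiagram L, OGraph.strictIso_comp,
    GraphSubstitutionMonad.ofFree k L, fun T => T.eq_ofFree,
    (GraphSubstitutionMonad.ofFree k L).equivalence,
    ⟨fun V b => LinearEquiv.refl k (V.carrier b.swap), fun _ _ _ => rfl, fun V b G x => ?_⟩,
    fun P S => LinearEquiv.refl k (P.A.carrier S.swap), fun _ _ _ => rfl, fun P _ _ _ D x => ?_⟩
  · exact (GraphSubstitutionMonad.ofFree k L).ofCircuitAlgebra_a V b G x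
  · exact (GraphSubstitutionMonad.ofFree k L).toCircuitAlgebra_act P D x
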